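/- **Proposition 2.1.** Let $0<T<\infty$. Consider on $[0,1]\times[0,T]$ the initial-boundary-value problems (CB) $\quad\eta_t+u_x+(\eta u)_x=0,\qquad u_t+\eta_x+uu_x-\tfrac13u_{xxt}=0,$ (SCB) $\quad\eta_t+u_x+\tfrac12(\eta u)_x=0,\qquad u_t+\eta_x+\tfrac32uu_x+\tfrac12\eta\eta_x-\tfrac13u_{xxt}=0,$ each with $\eta(x,0)=\eta_0(x)$, $u(x,0)=u_0(x)$ for $x\in[0,1]$ and $u(0,t)=u(1,t)=0$ for $t\in[0,T]$. Let $(\cdot,\cdot)$ and $\|\cdot\|$ be the inner product and norm of $L^2(0,1)$, let $a(\psi,\chi)=(\psi,\chi)+\tfrac13(\psi',\chi')$, and let $\|v\|_1=(\|v\|^2+\tfrac13\|v'\|^2)^{1/2}$ on $H^1(0,1)$. For a partition $0=x_1<x_2<\dots<x_{N+1}=1$, $N\ge1$, put $h=\max_i(x_{i+1}-x_i)$, let $S_h^2$ be the space of continuous functions on $[0,1]$ that are polynomials of degree at most $1$ on each $[x_j,x_{j+1}]$, and let $S_{h,0}^2=\{\phi\in S_h^2:\phi(0)=\phi(1)=0\}$.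 Let $P$ be the $L^2$-projection onto $S_h^2$, and let $R_hw\in S_{h,0}^2$ be given by $a(R_hw,\chi)=a(w,\chi)$ for all $\chi\in S_{h,0}^2$. The partitions are assumed quasiuniform: $x_{i+1}-x_i\le\kappa\,(x_{j+1}-x_j)$ for all $i,j$, with a fixed constant $\kappa$. The standard Galerkin semidiscretization of (CB) is to find $\eta_h:[0,T]\to S_h^2$, $u_h:[0,T]\to S_{h,0}^2$, differentiable in $t$, such that for all $t\in[0,T]$ $$(\eta_{ht},\phi)+(u_{hx},\phi)+((\eta_hu_h)_x,\phi)=0\quad\forall\phi\in S_h^2,$$ $$a(u_{ht},\chi)+(\eta_{hx},\chi)+(u_hu_{hx},\chi)=0\quad\forall\chi\in S_{h,0}^2,$$ with $\eta_h(0)=P\eta_0$, $u_h(0)=R_hu_0$; that of (SCB) is to find such $\eta_h,u_h$ with $$(\eta_{ht},\phi)+(u_{hx},\phi)+\tfrac12((\eta_hu_h)_x,\phi)=0\quad\forall\phi\in S_h^2,$$ $$a(u_{ht},\chi)+(\eta_{hx},\chi)+\tfrac32(u_hu_{hx},\chi)+\tfrac12(\eta_h\eta_{hx},\chi)=0\quad\forall\chi\in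 S_{h,0}^2,$$ and the same initial conditions. For a Banach space $X$ of functions on $[0,1]$, let $C(0,T;X)$ denote the functions $\varphi$ on $[0,T]$ with values in $X$ for which $t\mapsto\|\varphi(t)\|_X$ is continuous (this includes the functions that are continuous into $X$). Let $W^2_\infty=W^2_\infty(0,1)$ carry the norm $\max_{0\le j\le2}\|w^{(j)}\|_{L^\infty(0,1)}$; its elements are identified with their continuous representatives. Let $(\eta,u)$ be a solution of (CB), respectively of (SCB), on $[0,1]\times[0,T]$, the equations holding at every point (with $u_{xxt}=(u_t)_{xx}$), such that $\eta\in C(0,T;W^2_\infty)$ and $u\in C(0,T;W^2_\infty\cap H^1_0)$. Then there are $h_0>0$ and $C$, depending only on $T$, $\kappa$ and $(\eta,u)$, such that for every partition that is quasiuniform with constant $\kappa$ and has $h\le h_0$, the semidiscretization of (CB), respectively of (SCB), has a unique solution $(\eta_h,u_h)$ on $[0,T]$, and $$\max_{0\le t\le T}\|\eta(t)-\eta_h(t)\|\le Ch,\qquad\max_{0\le t\le T}\|u(t)-u_h(t)\|_1\le Ch.$$ -/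

import Mathlib

open MeasureTheory Set
open scoped ContDiff ENNReal

namespace BoussinesqFEM

noncomputable section

/-! ### Sobolev spaces of `L^∞` type on the interval `(0,1)` -/

/-- `g` is the weak derivative of `f` on the open interval `(0,1)`. -/
def HasWeakDeriv (f g : ℝ → ℝ) : Prop :=
  LocallyIntegrableOn f (Ioo 0 1) ∧ LocallyIntegrableOn g (Ioo 0 1) ∧
    ∀ φ : ℝ → ℝ, ContDiff ℝ ∞ φ → HasCompactSupport φ → tsupport φ ⊆ Ioo 0 1 →
      ∫ x in Ioo (0 : ℝ) 1, f x * deriv φ x = - ∫ x in Ioo (0 : ℝ) 1, g x * φ x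

open Classical in
/-- A representative of the weak derivative of `f` on `(0,1)` (unique up to null sets), and `0` if
there is no weak derivative. -/
def weakDeriv (f : ℝ → ℝ) : ℝ → ℝ :=
  if h : ∃ g, HasWeakDeriv f g then h.choose else 0

/-- Membership in `W^k_∞(0,1)`: essentially bounded, with essentially bounded weak derivatives up to
order `k`. -/
def MemWInf : ℕ → (ℝ → ℝ) → Prop
  | 0, f => MemLp f ∞ (volume.restrict (Ioo (0 : ℝ) 1))
  | k + 1, f => MemLp f ∞ (volume.restrict (Ioo (0 : ℝ) 1)) ∧
      ∃ g, HasWeakDeriv f g ∧ MemWInf k g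

/-- The norm `‖f‖_{k,∞} = max_{0 ≤ j ≤ k} ‖f^{(j)}‖_∞` of `W^k_∞(0,1)`. -/
def normWInf (k : ℕ) (f : ℝ → ℝ) : ℝ :=
  ((Finset.range (k + 1)).sup fun j =>
    eLpNorm (weakDeriv^[j] f) ∞ (volume.restrict (Ioo (0 : ℝ) 1))).toReal

/-- `C(0,T;X)`: functions `φ` on `[0,T]` with values in the normed space `X` such that
`t ↦ ‖φ(t)‖_X` is continuous on `[0,T]`. The space `X` is given by its membership predicate and its
norm. Functions that are continuous from `[0,T]` into `X` belong to it. -/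
def InC (T : ℝ) (X : (ℝ → ℝ) → Prop) (normX : (ℝ → ℝ) → ℝ) (φ : ℝ → ℝ → ℝ) : Prop :=
  (∀ t ∈ Icc 0 T, X (φ t)) ∧ ContinuousOn (fun t => normX (φ t)) (Icc 0 T)

/-! ### Inner products and norms

In all integrals below the derivative `deriv` is taken of functions that are continuously
differentiable on `[0,1]`, or continuous and piecewise polynomial, or sums of the two kinds. They are
Lipschitz on `[0,1]`, so their pointwise derivative exists almost everywhere in `(0,1)` and is their
weak derivative. -/

/-- The inner product of `L²(0,1)`. -/
def inner2 (f g : ℝ → ℝ) : ℝ := ∫ x in Ioo (0 : ℝ) 1, f x * g x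

/-- The norm of `L²(0,1)`. -/
def norm2 (f : ℝ → ℝ) : ℝ := Real.sqrt (inner2 f f)

/-- The bilinear form `a(ψ,χ) = (ψ,χ) + (1/3) (ψ',χ')`. -/
def formA (f g : ℝ → ℝ) : ℝ := inner2 f g + 1 / 3 * inner2 (deriv f) (deriv g)

/-- The norm `‖v‖₁ = (‖v‖² + (1/3) ‖v'‖²)^{1/2}` of `H¹(0,1)`. -/
def normH1 (v : ℝ → ℝ) : ℝ := Real.sqrt (norm2 v ^ 2 + 1 / 3 * norm2 (deriv v) ^ 2)

/-! ### Meshes, piecewise linear functions, projections -/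

/-- A partition of `[0,1]` into `N` intervals. -/
structure Mesh (N : ℕ) where
  node : Fin (N + 1) → ℝ
  strictMono : StrictMono node
  node_zero : node 0 = 0
  node_last : node (Fin.last N) = 1

namespace Mesh

variable {N : ℕ}

/-- The length of the `i`-th interval. -/
def len (M : Mesh N) (i : Fin N) : ℝ := M.node i.succ - M.node i.castSucc

/-- The mesh size `h`, the length of the longest interval. -/
def size (M : Mesh N) : ℝ := ⨆ i, M.len i

/-- Quasiuniformity with constant `κ`: any two intervals have lengths with quotient at most `κ`. -/
def QuasiUniform (M : Mesh N) (κ : ℝ) : Prop := ∀ i j, M.len i ≤ κ * M.len j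

/-- The space of continuous functions on `[0,1]` that are polynomials of degree at most `1` on each
interval of the mesh. Values outside `[0,1]` are irrelevant. -/
def S (M : Mesh N) : Set (ℝ → ℝ) :=
  {φ | ContinuousOn φ (Icc 0 1) ∧
    ∀ i : Fin N, ∃ a b : ℝ, ∀ x ∈ Icc (M.node i.castSucc) (M.node i.succ), φ x = a + b * x}

/-- The elements of `M.S` that vanish at `0` and `1`. -/
def S0 (M : Mesh N) : Set (ℝ → ℝ) := {φ | φ ∈ M.S ∧ φ 0 = 0 ∧ φ 1 = 0}

/-- `v` is the `L²`-projection `P w` of `w` onto `M.S`. -/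
def IsL2Proj (M : Mesh N) (w v : ℝ → ℝ) : Prop :=
  v ∈ M.S ∧ ∀ φ ∈ M.S, inner2 v φ = inner2 w φ

/-- `v` is the elliptic projection `R_h w` of `w` onto `M.S0` relative to the form `a`. -/
def IsEllipticProj (M : Mesh N) (w v : ℝ → ℝ) : Prop :=
  v ∈ M.S0 ∧ ∀ χ ∈ M.S0, formA v χ = formA w χ

end Mesh

/-! ### The initial-boundary-value problems

A function `v` of time and space is written `v t x`. -/

/-- The time derivative `v_t` on `[0,T]` (one-sided at the ends of the interval). -/
def dt (T : ℝ) (v : ℝ → ℝ → ℝ) (t x : ℝ) : ℝ := derivWithin (fun s => v s x) (Icc 0 T) t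

/-- The space derivative on `[0,1]` (one-sided at the ends of the interval). -/
def dx (w : ℝ → ℝ) (x : ℝ) : ℝ := derivWithin w (Icc 0 1) x

/-- `(η, u)` is a solution on `[0,1] × [0,T]` of
`η_t + u_x + α (η u)_x = 0`, `u_t + η_x + β u u_x + γ η η_x - (1/3) u_xxt = 0`,
`η(·,0) = η₀`, `u(·,0) = u₀`, `u(0,·) = u(1,·) = 0`.
The differentiability required is that under which the derivatives in the equations exist. -/
structure IsSolution (α β γ T : ℝ) (η₀ u₀ : ℝ → ℝ) (η u : ℝ → ℝ → ℝ) : Prop where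
  diff_t_eta : ∀ x ∈ Icc (0 : ℝ) 1, DifferentiableOn ℝ (fun t => η t x) (Icc 0 T)
  diff_t_u : ∀ x ∈ Icc (0 : ℝ) 1, DifferentiableOn ℝ (fun t => u t x) (Icc 0 T)
  diff_x_eta : ∀ t ∈ Icc 0 T, DifferentiableOn ℝ (η t) (Icc 0 1)
  diff_x_u : ∀ t ∈ Icc 0 T, DifferentiableOn ℝ (u t) (Icc 0 1)
  diff_x_ut : ∀ t ∈ Icc 0 T, DifferentiableOn ℝ (dt T u t) (Icc 0 1)
  diff_xx_ut : ∀ t ∈ Icc 0 T, DifferentiableOn ℝ (dx (dt T u t)) (Icc 0 1)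
  eq_eta : ∀ t ∈ Icc 0 T, ∀ x ∈ Icc (0 : ℝ) 1,
    dt T η t x + dx (u t) x + α * dx (fun y => η t y * u t y) x = 0
  eq_u : ∀ t ∈ Icc 0 T, ∀ x ∈ Icc (0 : ℝ) 1,
    dt T u t x + dx (η t) x + β * (u t x * dx (u t) x) + γ * (η t x * dx (η t) x)
      - 1 / 3 * dx (dx (dt T u t)) x = 0
  init_eta : ∀ x ∈ Icc (0 : ℝ) 1, η 0 x = η₀ x
  init_u : ∀ x ∈ Icc (0 : ℝ) 1, u 0 x = u₀ x
  bdry_left : ∀ t ∈ Icc 0 T, u t 0 = 0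
  bdry_right : ∀ t ∈ Icc 0 T, u t 1 = 0

/-- Solutions of the classical Boussinesq system (CB). -/
def IsSolutionCB (T : ℝ) (η₀ u₀ : ℝ → ℝ) (η u : ℝ → ℝ → ℝ) : Prop :=
  IsSolution 1 1 0 T η₀ u₀ η u

/-- Solutions of the symmetric system (SCB). -/
def IsSolutionSCB (T : ℝ) (η₀ u₀ : ℝ → ℝ) (η u : ℝ → ℝ → ℝ) : Prop :=
  IsSolution (1 / 2) (3 / 2) (1 / 2) T η₀ u₀ η u

/-! ### The standard Galerkin semidiscretizations -/

/-- `(ηh, uh)` is a solution on `[0,T]` of the standard Galerkin semidiscretization on the mesh `M`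
of the problem with coefficients `α, β, γ`, with initial data `P η₀` and `R_h u₀`. As the discrete
spaces are finite-dimensional, differentiability in `t` is the same as differentiability in `t` of
all point values. -/
structure IsSemidiscrete {N : ℕ} (M : Mesh N) (α β γ T : ℝ) (η₀ u₀ : ℝ → ℝ)
    (ηh uh : ℝ → ℝ → ℝ) : Prop where
  mem_eta : ∀ t ∈ Icc 0 T, ηh t ∈ M.S
  mem_u : ∀ t ∈ Icc 0 T, uh t ∈ M.S0
  diff_eta : ∀ x ∈ Icc (0 : ℝ) 1, DifferentiableOn ℝ (fun t => ηh t x) (Icc 0 T)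
  diff_u : ∀ x ∈ Icc (0 : ℝ) 1, DifferentiableOn ℝ (fun t => uh t x) (Icc 0 T)
  eq_eta : ∀ t ∈ Icc 0 T, ∀ φ ∈ M.S,
    inner2 (dt T ηh t) φ + inner2 (deriv (uh t)) φ
      + α * inner2 (deriv fun y => ηh t y * uh t y) φ = 0
  eq_u : ∀ t ∈ Icc 0 T, ∀ χ ∈ M.S0,
    formA (dt T uh t) χ + inner2 (deriv (ηh t)) χ
      + β * inner2 (fun y => uh t y * deriv (uh t) y) χ
      + γ * inner2 (fun y => ηh t y * deriv (ηh t) y) χ = 0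
  init_eta : M.IsL2Proj η₀ (ηh 0)
  init_u : M.IsEllipticProj u₀ (uh 0)

/-- Solutions of the semidiscretization of (CB). -/
def IsSemidiscreteCB {N : ℕ} (M : Mesh N) (T : ℝ) (η₀ u₀ : ℝ → ℝ) (ηh uh : ℝ → ℝ → ℝ) : Prop :=
  IsSemidiscrete M 1 1 0 T η₀ u₀ ηh uh

/-- Solutions of the semidiscretization of (SCB). -/
def IsSemidiscreteSCB {N : ℕ} (M : Mesh N) (T : ℝ) (η₀ u₀ : ℝ → ℝ) (ηh uh : ℝ → ℝ → ℝ) : Prop :=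
  IsSemidiscrete M (1 / 2) (3 / 2) (1 / 2) T η₀ u₀ ηh uh

end

end BoussinesqFEM

open BoussinesqFEM

/-! Both systems are the case of particular coefficients α, β, γ of one system, and the estimate is
an energy argument for the pair (θ, ξ), the difference between the nodal interpolant of (η, u) and
the discrete solution. With E = ‖θ‖² + a(ξ, ξ) the claim is E ≤ Λh² on [0,T]; the interpolation
error is O(h) by the regularity of η and u.

Regularity. A bound in W²_∞ makes η_x and u_x bounded and Lipschitz uniformly in t. The first
equation then makes η_t Lipschitz in x. The second equation is an elliptic problem w - w''/3 = f for
w = u_t with bounded f, and the maximum principle bounds w', so u_t is Lipschitz as well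
(`abs_dx_le_of_elliptic`, `IsSolution.isWeakSolutionAt`). Interpolation at the nodes commutes with
∂_t, and it is orthogonal for the inner product of derivatives (`Mesh.inner2_deriv_pl_values`), so
Lipschitz bounds on η_t and u_t suffice for O(h) consistency.

Energy. In the error equations tested with θ and ξ the derivative of θ is the dangerous term. It
disappears by integration by parts: θ(θu_h)_x is an exact derivative plus θ²(u_h)_x/2, and in the
second equation all derivatives are moved to ξ. What remains is O(h² + E), provided |ξ_x| ≤ 1
(`energy_rhs_le`, `energy_deriv_le`).

Closing the loop. If E ≤ Λh², the inverse inequality and quasiuniformity give |ξ_x|² ≤ 3Λκh, which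
is at most 1 for small h. Hence E' ≤ C(h² + E) as long as E ≤ Λh², and a comparison with an
exponential barrier that stays below Λh² up to time T shows that E never leaves this range
(`gram_error_le`).

Existence and uniqueness. In coefficients the scheme is an autonomous ODE with a C¹ field. Cut off
outside a large ball, the field has global solutions. The energy estimate needs the Galerkin
equations only while E ≤ Λh², which forces the coefficients into the ball, so the cut-off is never
felt. The same bound holds for every semidiscrete solution, and uniqueness for Lipschitz fields
applies. -/

namespace BoussinesqFEM

/-! ### Weak derivatives and the classical regularity of W²_∞ functions. -/

/-- The product of a locally integrable function and a continuous function with compact support in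
`(0,1)` is integrable. -/
lemma integrableOn_mul_of_tsupport_subset {h ψ : ℝ → ℝ} (hl : LocallyIntegrableOn h (Ioo 0 1))
    (hψ : Continuous ψ) (hc : HasCompactSupport ψ) (hs : tsupport ψ ⊆ Ioo 0 1) :
    IntegrableOn (fun x => h x * ψ x) (Ioo 0 1) := by
  have h1 : IntegrableOn (fun x => h x * ψ x) (tsupport ψ) :=
    (hl.integrableOn_compact_subset hs hc.isCompact).mul_continuousOn hψ.continuousOn hc.isCompact
  refine ((integrableOn_iff_integrable_of_support_subset fun x hx => ?_).1 h1).integrableOn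
  exact subset_tsupport _ (right_ne_zero_of_mul hx)

/-- A smooth function with compact support in `(0,1)` and integral zero is the derivative of a
smooth function with compact support in `(0,1)`. -/
lemma exists_test_primitive {ψ : ℝ → ℝ} (hψ : ContDiff ℝ ∞ ψ) (hc : HasCompactSupport ψ)
    (hs : tsupport ψ ⊆ Ioo 0 1) (h0 : ∫ x, ψ x = 0) :
    ∃ φ : ℝ → ℝ, ContDiff ℝ ∞ φ ∧ HasCompactSupport φ ∧ tsupport φ ⊆ Ioo 0 1 ∧ deriv φ = ψ := by
  -- The point 1/2 only makes the set nonempty when ψ = 0, so that it has a least and a greatest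
  -- element.
  have hcomp : IsCompact (tsupport ψ ∪ {1 / 2}) := hc.isCompact.union isCompact_singleton
  have hne : (tsupport ψ ∪ {1 / 2}).Nonempty := ⟨1 / 2, by simp⟩
  have hsub : tsupport ψ ∪ {1 / 2} ⊆ Ioo 0 1 := by
    apply union_subset hs
    intro x hx
    rw [mem_singleton_iff] at hx
    subst hx
    constructor <;> norm_num
  obtain ⟨a, ha⟩ := hcomp.exists_isLeast hne
  obtain ⟨b, hb⟩ := hcomp.exists_isGreatest hne
  have ha1 := hsub ha.1
  have hb1 := hsub hb.1
  have hz : ∀ x, x ∉ Icc a b → ψ x = 0 := by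
    intro x hx
    by_contra hne
    have : x ∈ tsupport ψ := subset_tsupport _ hne
    exact hx ⟨ha.2 (Or.inl this), hb.2 (Or.inl this)⟩
  have hcont := hψ.continuous
  set φ : ℝ → ℝ := fun x => ∫ y in (0 : ℝ)..x, ψ y with hφ
  have hd : ∀ x, HasDerivAt φ (ψ x) x := fun x =>
    intervalIntegral.integral_hasDerivAt_right (hcont.intervalIntegrable _ _)
      (hcont.stronglyMeasurableAtFilter _ _) hcont.continuousAt
  have hderiv : deriv φ = ψ := funext fun x => (hd x).deriv
  have htot : ∫ y in (0 : ℝ)..1, ψ y = 0 := by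
    refine (intervalIntegral.integral_eq_integral_of_support_subset ?_).trans h0
    intro x hx
    have := hs (subset_tsupport _ hx)
    exact ⟨this.1, this.2.le⟩
  have hsupp : Function.support φ ⊆ Icc a b := by
    intro x hx
    by_contra hxm
    apply hx
    rcases lt_or_ge x a with h | h
    · apply intervalIntegral.integral_zero_ae
      refine Filter.Eventually.of_forall fun y hy => hz y fun hy' => ?_
      rw [mem_uIoc] at hy
      rcases hy with hy | hy
      · linarith [hy'.1, hy.2]
      · linarith [hy'.1, hy.2, ha1.1]
    -- To the right of the support the primitive equals the total integral, which is zero.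
    · have hbx : b < x := by
        by_contra hh
        exact hxm ⟨h, not_lt.1 hh⟩
      have : φ x = (∫ y in (0 : ℝ)..1, ψ y) + ∫ y in (1 : ℝ)..x, ψ y :=
        (intervalIntegral.integral_add_adjacent_intervals (hcont.intervalIntegrable _ _)
          (hcont.intervalIntegrable _ _)).symm
      rw [this, htot, zero_add]
      apply intervalIntegral.integral_zero_ae
      refine Filter.Eventually.of_forall fun y hy => hz y fun hy' => ?_
      rw [mem_uIoc] at hy
      rcases hy with hy | hy
      · linarith [hy'.2, hy.1, hb1.2]
      · linarith [hy'.2, hy.1]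
  have hts : tsupport φ ⊆ Icc a b := closure_minimal hsupp isClosed_Icc
  refine ⟨φ, ?_, HasCompactSupport.of_support_subset_isCompact isCompact_Icc hsupp,
    hts.trans fun x hx => ⟨ha1.1.trans_le hx.1, hx.2.trans_lt hb1.2⟩, hderiv⟩
  rw [contDiff_infty_iff_deriv]
  exact ⟨fun x => (hd x).differentiableAt, hderiv ▸ hψ⟩

/-- A locally integrable function on `(0,1)` with vanishing weak derivative is constant. -/
lemma ae_const_of_integral_deriv_eq_zero {h : ℝ → ℝ} (hl : LocallyIntegrableOn h (Ioo 0 1))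
    (hz : ∀ φ : ℝ → ℝ, ContDiff ℝ ∞ φ → HasCompactSupport φ → tsupport φ ⊆ Ioo 0 1 →
      ∫ x in Ioo (0 : ℝ) 1, h x * deriv φ x = 0) :
    ∃ c : ℝ, ∀ᵐ x ∂volume.restrict (Ioo (0 : ℝ) 1), h x = c := by
  obtain ⟨ψ₁, h1, h2, h3, h4, h5⟩ := exists_contDiff_tsupport_subset (n := ⊤)
    (Ioo_mem_nhds (show (0 : ℝ) < 1 / 2 by norm_num) (show (1 / 2 : ℝ) < 1 by norm_num))
  have h3c : Continuous ψ₁ := h3.continuous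
  have hpos : 0 < ∫ x, ψ₁ x :=
    h3c.integral_pos_of_hasCompactSupport_nonneg_nonzero h2
      (fun x => (h4 ⟨x, rfl⟩).1) (x := 1 / 2) (by rw [h5]; norm_num)
  set A := ∫ x, ψ₁ x
  have hint : ∀ ψ : ℝ → ℝ, ContDiff ℝ ∞ ψ → HasCompactSupport ψ → tsupport ψ ⊆ Ioo 0 1 →
      IntegrableOn (fun x => h x * ψ x) (Ioo 0 1) := fun ψ hψ hc hs =>
    integrableOn_mul_of_tsupport_subset hl hψ.continuous hc hs
  -- The constant is the average of h with weight ψ₁, where ψ₁ is a fixed bump function.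
  refine ⟨(∫ x in Ioo (0 : ℝ) 1, h x * ψ₁ x) / A, ?_⟩
  set c := (∫ x in Ioo (0 : ℝ) 1, h x * ψ₁ x) / A
  have key := isOpen_Ioo.ae_eq_zero_of_integral_contDiff_smul_eq_zero (μ := volume)
    (f := fun x => h x - c) (U := Ioo (0 : ℝ) 1)
    (hl.sub (locallyIntegrableOn_const c)) ?_
  · rw [ae_restrict_iff' measurableSet_Ioo]
    filter_upwards [key] with x hx hxm
    linarith [hx hxm]
  · intro ψ hψ hc hs
    set B := ∫ x, ψ x
    -- Subtracting the multiple of ψ₁ with the same integral turns any test function into a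
    -- derivative of a test function, against which h integrates to zero.
    obtain ⟨φ, f1, f2, f3, f4⟩ := exists_test_primitive (ψ := fun x => ψ x - B / A * ψ₁ x)
      (hψ.sub (contDiff_const.mul h3)) (hc.sub h2.mul_left)
      ((tsupport_sub _ _).trans (union_subset hs ((tsupport_mul_subset_right).trans h1))) (by
        rw [integral_sub (hψ.continuous.integrable_of_hasCompactSupport hc)
          ((h3c.integrable_of_hasCompactSupport h2).const_mul _), integral_const_mul]
        change B - B / A * A = 0
        field_simp
        ring)
    have e := hz φ f1 f2 f3
    rw [f4] at e
    have e1 : ∫ x in Ioo (0 : ℝ) 1, h x * (ψ x - B / A * ψ₁ x)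
        = (∫ x in Ioo (0 : ℝ) 1, h x * ψ x) - B / A * ∫ x in Ioo (0 : ℝ) 1, h x * ψ₁ x := by
      rw [← integral_const_mul, ← integral_sub (hint ψ hψ hc hs) ((hint ψ₁ h3 h2 h1).const_mul _)]
      congr 1
      ext x
      ring
    have e2 : ∫ x, ψ x • (h x - c) = ∫ x in Ioo (0 : ℝ) 1, ψ x • (h x - c) := by
      rw [setIntegral_eq_integral_of_forall_compl_eq_zero]
      intro x hx
      have : ψ x = 0 := by
        by_contra hne
        exact hx (hs (subset_tsupport _ hne))
      simp [this]
    have e3 : ∫ x in Ioo (0 : ℝ) 1, ψ x = B := by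
      rw [setIntegral_eq_integral_of_forall_compl_eq_zero]
      intro x hx
      by_contra hne
      exact hx (hs (subset_tsupport _ hne))
    have e4 : ∫ x in Ioo (0 : ℝ) 1, ψ x • (h x - c)
        = (∫ x in Ioo (0 : ℝ) 1, h x * ψ x) - c * B := by
      rw [← e3, ← integral_const_mul, ← integral_sub (hint ψ hψ hc hs)
        ((hψ.continuous.integrable_of_hasCompactSupport hc).integrableOn.const_mul _)]
      congr 1
      ext x
      simp only [smul_eq_mul]
      ring
    rw [e2, e4]
    rw [e1] at e
    change _ - (∫ x in Ioo (0 : ℝ) 1, h x * ψ₁ x) / A * B = 0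
    refine Eq.trans ?_ e
    ring

/-- Weak derivatives are unique almost everywhere. -/
lemma HasWeakDeriv.ae_eq {f g g' : ℝ → ℝ} (h : HasWeakDeriv f g) (h' : HasWeakDeriv f g') :
    g =ᵐ[volume.restrict (Ioo (0 : ℝ) 1)] g' := by
  have key := isOpen_Ioo.ae_eq_zero_of_integral_contDiff_smul_eq_zero (μ := volume)
    (f := fun x => g x - g' x) (U := Ioo (0 : ℝ) 1) (h.2.1.sub h'.2.1) ?_
  · rw [Filter.EventuallyEq, ae_restrict_iff' measurableSet_Ioo]
    filter_upwards [key] with x hx hxm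
    linarith [hx hxm]
  · intro ψ hψ hc hs
    have hint : ∀ k : ℝ → ℝ, LocallyIntegrableOn k (Ioo 0 1) →
        IntegrableOn (fun x => k x * ψ x) (Ioo 0 1) := fun k hk =>
      integrableOn_mul_of_tsupport_subset hk hψ.continuous hc hs
    have e2 : ∫ x, ψ x • (g x - g' x) = ∫ x in Ioo (0 : ℝ) 1, ψ x • (g x - g' x) := by
      rw [setIntegral_eq_integral_of_forall_compl_eq_zero]
      intro x hx
      have : ψ x = 0 := by
        by_contra hne
        exact hx (hs (subset_tsupport _ hne))
      simp [this]
    have e3 : ∫ x in Ioo (0 : ℝ) 1, ψ x • (g x - g' x)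
        = (∫ x in Ioo (0 : ℝ) 1, g x * ψ x) - ∫ x in Ioo (0 : ℝ) 1, g' x * ψ x := by
      rw [← integral_sub (hint g h.2.1) (hint g' h'.2.1)]
      congr 1
      ext x
      simp only [smul_eq_mul]
      ring
    rw [e2, e3]
    linarith [h.2.2 ψ hψ hc hs, h'.2.2 ψ hψ hc hs]

lemma HasWeakDeriv.congr_left {f f' g : ℝ → ℝ} (h : HasWeakDeriv f g)
    (hf : f =ᵐ[volume.restrict (Ioo (0 : ℝ) 1)] f') (hl : LocallyIntegrableOn f' (Ioo 0 1)) :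
    HasWeakDeriv f' g := by
  refine ⟨hl, h.2.1, fun φ h1 h2 h3 => ?_⟩
  rw [← h.2.2 φ h1 h2 h3]
  apply integral_congr_ae
  filter_upwards [hf] with x hx
  rw [hx]

lemma hasWeakDeriv_weakDeriv {f g : ℝ → ℝ} (h : HasWeakDeriv f g) :
    HasWeakDeriv f (weakDeriv f) := by
  have hex : ∃ g, HasWeakDeriv f g := ⟨g, h⟩
  rw [weakDeriv, dif_pos hex]
  exact hex.choose_spec

lemma weakDeriv_ae_eq {f g : ℝ → ℝ} (h : HasWeakDeriv f g) :
    weakDeriv f =ᵐ[volume.restrict (Ioo (0 : ℝ) 1)] g :=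
  (hasWeakDeriv_weakDeriv h).ae_eq h

/-- A function on `(0,1)` with a bounded weak derivative agrees almost everywhere with a Lipschitz
primitive of it. -/
lemma HasWeakDeriv.exists_lipschitz {f g : ℝ → ℝ} (h : HasWeakDeriv f g) {K : NNReal}
    (hK : ∀ᵐ x ∂volume.restrict (Ioo (0 : ℝ) 1), |g x| ≤ K)
    (hg : AEStronglyMeasurable g (volume.restrict (Ioo (0 : ℝ) 1))) :
    ∃ F : ℝ → ℝ, LipschitzWith K F ∧ f =ᵐ[volume.restrict (Ioo (0 : ℝ) 1)] F := by
  have hgi : Integrable g (volume.restrict (Ioo (0 : ℝ) 1)) :=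
    Integrable.of_bound hg K hK
  -- Extension by zero makes the primitive Lipschitz on all of ℝ. It has the same weak derivative as
  -- f, so the two differ by a constant.
  set k : ℝ → ℝ := (Ioo (0 : ℝ) 1).indicator g with hk
  have hki : Integrable k := (integrable_indicator_iff measurableSet_Ioo).2 hgi
  have hkb : ∀ᵐ x, ‖k x‖ ≤ K := by
    rw [ae_restrict_iff' measurableSet_Ioo] at hK
    filter_upwards [hK] with x hx
    by_cases hm : x ∈ Ioo (0 : ℝ) 1
    · simpa [hk, hm] using hx hm
    · simp [hk, hm]
  set G : ℝ → ℝ := fun x => ∫ y in (0 : ℝ)..x, k y with hG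
  have hlip : LipschitzWith K G := by
    apply LipschitzWith.of_dist_le_mul
    intro x y
    rw [Real.dist_eq, Real.dist_eq]
    have : G x - G y = ∫ t in y..x, k t :=
      intervalIntegral.integral_interval_sub_left hki.intervalIntegrable hki.intervalIntegrable
    rw [this, ← Real.norm_eq_abs]
    apply intervalIntegral.norm_integral_le_of_norm_le_const_ae
    filter_upwards [hkb] with t ht _ using ht
  have hae : ∀ᵐ x, deriv G x = k x := by
    have := LocallyIntegrable.ae_hasDerivAt_integral hki.locallyIntegrable
    filter_upwards [this] with x hx
    exact (hx 0).deriv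
  have hcst := ae_const_of_integral_deriv_eq_zero (h := fun x => f x - G x)
    (h.1.sub (hlip.continuous.locallyIntegrable.locallyIntegrableOn _)) ?_
  · obtain ⟨c, hc⟩ := hcst
    refine ⟨fun x => G x + c, ?_, ?_⟩
    · simpa using hlip.add (LipschitzWith.const c)
    · filter_upwards [hc] with x hx
      linarith
  · intro φ hφ hc hs
    have hGφ : ∫ x in Ioo (0 : ℝ) 1, G x * deriv φ x = - ∫ x in Ioo (0 : ℝ) 1, g x * φ x := by
      have ac1 : AbsolutelyContinuousOnInterval G 0 1 :=
        (hlip.lipschitzOnWith (s := uIcc 0 1)).absolutelyContinuousOnInterval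
      have ac2 : AbsolutelyContinuousOnInterval φ 0 1 :=
        ContDiffOn.absolutelyContinuousOnInterval (hφ.of_le (by simp)).contDiffOn
      have := ac1.integral_mul_deriv_eq_deriv_mul ac2
      have z : ∀ x, x ∉ Ioo (0 : ℝ) 1 → φ x = 0 := by
        intro x hx
        by_contra hne
        exact hx (hs (subset_tsupport _ hne))
      rw [z 0 (by simp), z 1 (by simp), intervalIntegral.integral_of_le zero_le_one,
        intervalIntegral.integral_of_le zero_le_one, integral_Ioc_eq_integral_Ioo,
        integral_Ioc_eq_integral_Ioo] at this
      rw [this, mul_zero, mul_zero, sub_zero, zero_sub]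
      congr 1
      apply setIntegral_congr_ae measurableSet_Ioo
      filter_upwards [hae] with x hx hxm
      rw [hx, hk, indicator_of_mem hxm]
    have hdc : Continuous (deriv φ) := hφ.continuous_deriv (by simp)
    have hdts : tsupport (deriv φ) ⊆ Ioo 0 1 := (tsupport_deriv_subset).trans hs
    have i1 : IntegrableOn (fun x => f x * deriv φ x) (Ioo 0 1) :=
      integrableOn_mul_of_tsupport_subset h.1 hdc hc.deriv hdts
    have i2 : IntegrableOn (fun x => G x * deriv φ x) (Ioo 0 1) :=
      ((hlip.continuous.mul hdc).integrable_of_hasCompactSupport hc.deriv.mul_left).integrableOn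
    have := integral_sub i1 i2
    rw [hGφ, h.2.2 φ hφ hc hs, sub_self] at this
    refine Eq.trans ?_ this
    congr 1
    ext x
    ring

/-- `f` has on `[0,1]` a derivative that is bounded by `K` and Lipschitz with constant `K`, and `f`
itself is bounded by `K`. -/
def HasLipDeriv (K : ℝ) (f : ℝ → ℝ) : Prop :=
  ∃ F : ℝ → ℝ, LipschitzWith K.toNNReal F ∧ (∀ x ∈ Icc (0 : ℝ) 1, |F x| ≤ K) ∧
    (∀ x ∈ Icc (0 : ℝ) 1, |f x| ≤ K) ∧ ∀ x ∈ Icc (0 : ℝ) 1, HasDerivWithinAt f (F x) (Icc 0 1) x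

lemma eqOn_Icc_of_ae_eq {f g : ℝ → ℝ} (hf : ContinuousOn f (Icc 0 1))
    (hg : ContinuousOn g (Icc 0 1)) (h : f =ᵐ[volume.restrict (Ioo (0 : ℝ) 1)] g) :
    EqOn f g (Icc 0 1) := by
  rw [← Measure.restrict_congr_set Ioo_ae_eq_Icc.symm] at h
  exact Measure.eqOn_Icc_of_ae_eq volume zero_ne_one h hf hg

/-- The continuous functions max(|f|, K) and K agree almost everywhere, hence everywhere. -/
lemma abs_le_of_ae_abs_le {f : ℝ → ℝ} {K : ℝ} (hf : ContinuousOn f (Icc 0 1))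
    (h : ∀ᵐ x ∂volume.restrict (Ioo (0 : ℝ) 1), |f x| ≤ K) : ∀ x ∈ Icc (0 : ℝ) 1, |f x| ≤ K := by
  have : EqOn (fun x => max |f x| K) (fun _ => K) (Icc 0 1) := by
    apply eqOn_Icc_of_ae_eq (hf.abs.sup continuousOn_const) continuousOn_const
    filter_upwards [h] with x hx
    exact max_eq_right hx
  intro x hx
  exact (le_max_left _ _).trans_eq (this hx)

/-- A continuous function in `W^2_∞(0,1)` is continuously differentiable on `[0,1]` with Lipschitz
derivative. -/
lemma MemWInf.hasLipDeriv {f : ℝ → ℝ} {K : ℝ} (hf : MemWInf 2 f) (hK : normWInf 2 f ≤ K)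
    (hc : ContinuousOn f (Icc 0 1)) : HasLipDeriv K f := by
  set μ := volume.restrict (Ioo (0 : ℝ) 1) with hμ
  obtain ⟨hf0, g, hg, hg0, g₂, hg₂, hg₂0⟩ := hf
  change MemLp g₂ ∞ μ at hg₂0
  have hloc : ∀ k : ℝ → ℝ, MemLp k ∞ μ → LocallyIntegrableOn k (Ioo 0 1) := fun k hk =>
    IntegrableOn.locallyIntegrableOn (hk.integrable le_top)
  have w1 : weakDeriv f =ᵐ[μ] g := weakDeriv_ae_eq hg
  have m1 : MemLp (weakDeriv f) ∞ μ := (memLp_congr_ae w1).2 hg0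
  have hw2 : HasWeakDeriv (weakDeriv f) g₂ := hg₂.congr_left w1.symm (hloc _ m1)
  have w2 : weakDeriv (weakDeriv f) =ᵐ[μ] g₂ := weakDeriv_ae_eq hw2
  have m2 : MemLp (weakDeriv (weakDeriv f)) ∞ μ := (memLp_congr_ae w2).2 hg₂0
  have hmem : ∀ j ∈ Finset.range 3, MemLp (weakDeriv^[j] f) ∞ μ := by
    intro j hj
    have : j < 3 := Finset.mem_range.1 hj
    interval_cases j
    · exact hf0
    · exact m1
    · exact m2
  have hbd : ∀ j ∈ Finset.range 3, ∀ᵐ x ∂μ, |(weakDeriv^[j] f) x| ≤ K := by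
    intro j hj
    -- Finiteness is essential: `toReal` sends ⊤ to 0, so otherwise the bound on `normWInf` would
    -- say nothing.
    have hsup : ((Finset.range (2 + 1)).sup fun j => eLpNorm (weakDeriv^[j] f) ∞ μ) ≠ ⊤ := by
      rw [← lt_top_iff_ne_top, Finset.sup_lt_iff ENNReal.zero_lt_top]
      exact fun j hj => (hmem j hj).2
    have hle : eLpNorm (weakDeriv^[j] f) ∞ μ ≤ ENNReal.ofReal K := by
      refine (Finset.le_sup (f := fun j => eLpNorm (weakDeriv^[j] f) ∞ μ) hj).trans ?_
      exact (ENNReal.le_ofReal_iff_toReal_le hsup (ENNReal.toReal_nonneg.trans hK)).2 hK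
    rw [eLpNorm_exponent_top] at hle
    have hK0 : 0 ≤ K := ENNReal.toReal_nonneg.trans hK
    filter_upwards [ae_le_eLpNormEssSup (f := weakDeriv^[j] f) (μ := μ)] with x hx
    have := hx.trans hle
    rw [Real.enorm_eq_ofReal_abs, ENNReal.ofReal_le_ofReal_iff hK0] at this
    exact this
  have hK0 : 0 ≤ K := ENNReal.toReal_nonneg.trans hK
  have b0 := hbd 0 (by simp)
  have b1 := hbd 1 (by simp)
  have b2 := hbd 2 (by simp)
  simp only [Function.iterate_zero, id, Function.iterate_succ, Function.comp] at b0 b1 b2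
  obtain ⟨F, hFl, hFe⟩ := (hasWeakDeriv_weakDeriv hw2).exists_lipschitz (K := K.toNNReal)
    (by rw [Real.coe_toNNReal _ hK0]; exact b2) m2.1
  have hFc := hFl.continuous
  have bF : ∀ᵐ x ∂μ, |F x| ≤ K := by
    filter_upwards [b1, hFe] with x h1 h2
    rwa [← h2]
  -- The weak derivative of f agrees almost everywhere with the Lipschitz function F, so f is the
  -- classical primitive of F up to a constant.
  set G : ℝ → ℝ := fun x => ∫ y in (0 : ℝ)..x, F y with hG
  have hGd : ∀ x, HasDerivAt G (F x) x := fun x =>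
    intervalIntegral.integral_hasDerivAt_right (hFc.intervalIntegrable _ _)
      (hFc.stronglyMeasurableAtFilter _ _) hFc.continuousAt
  have hGc : Continuous G := continuous_iff_continuousAt.2 fun x => (hGd x).continuousAt
  obtain ⟨c, hcc⟩ := ae_const_of_integral_deriv_eq_zero (h := fun x => f x - G x)
    ((hloc _ hf0).sub (hGc.locallyIntegrable.locallyIntegrableOn _)) (by
      intro φ hφ hcs hs
      have hdc : Continuous (deriv φ) := hφ.continuous_deriv (by simp)
      have hdts : tsupport (deriv φ) ⊆ Ioo 0 1 := (tsupport_deriv_subset).trans hs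
      have z : ∀ x, x ∉ Ioo (0 : ℝ) 1 → φ x = 0 := by
        intro x hx
        by_contra hne
        exact hx (hs (subset_tsupport _ hne))
      have hGφ : ∫ x in Ioo (0 : ℝ) 1, G x * deriv φ x = - ∫ x in Ioo (0 : ℝ) 1, F x * φ x := by
        have := intervalIntegral.integral_mul_deriv_eq_deriv_mul (a := 0) (b := 1)
          (u := G) (u' := F) (v := φ) (v' := deriv φ)
          (fun x _ => hGd x) (fun x _ => (hφ.differentiable (by simp) x).hasDerivAt)
          (hFc.intervalIntegrable _ _) (hdc.intervalIntegrable _ _)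
        rw [z 0 (by simp), z 1 (by simp), intervalIntegral.integral_of_le zero_le_one,
          intervalIntegral.integral_of_le zero_le_one, integral_Ioc_eq_integral_Ioo,
          integral_Ioc_eq_integral_Ioo] at this
        rw [this]
        ring
      have hFφ : ∫ x in Ioo (0 : ℝ) 1, F x * φ x = ∫ x in Ioo (0 : ℝ) 1, weakDeriv f x * φ x := by
        apply integral_congr_ae
        filter_upwards [hFe] with x hx
        rw [hx]
      have i1 := integrableOn_mul_of_tsupport_subset (hloc _ hf0) hdc hcs.deriv hdts
      have i2 := integrableOn_mul_of_tsupport_subset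
        (hGc.locallyIntegrable.locallyIntegrableOn _) hdc hcs.deriv hdts
      have := integral_sub i1 i2
      rw [hGφ, (hasWeakDeriv_weakDeriv hg).2.2 φ hφ hcs hs, hFφ, sub_self] at this
      refine Eq.trans ?_ this
      congr 1
      ext x
      ring)
  have heq : EqOn f (fun x => G x + c) (Icc 0 1) := by
    refine eqOn_Icc_of_ae_eq hc (hGc.add continuous_const).continuousOn ?_
    filter_upwards [hcc] with x hx
    linarith
  refine ⟨F, hFl, abs_le_of_ae_abs_le hFc.continuousOn bF, abs_le_of_ae_abs_le hc b0, ?_⟩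
  intro x hx
  exact ((hGd x).add_const c).hasDerivWithinAt.congr heq (heq hx)

/-! ### Lipschitz functions on `[0,1]` -/

/-- `f` is Lipschitz on `[0,1]`. -/
def IsLip (f : ℝ → ℝ) : Prop :=
  ∃ C : NNReal, LipschitzOnWith C f (Icc 0 1)

/-- `f` is measurable and bounded on `(0,1)`. -/
def IsBdd (f : ℝ → ℝ) : Prop :=
  AEStronglyMeasurable f (volume.restrict (Ioo (0 : ℝ) 1)) ∧ ∃ C : ℝ, ∀ x ∈ Ioo (0 : ℝ) 1, |f x| ≤ C

lemma isLip_of_abs_sub_le {f : ℝ → ℝ} {C : ℝ}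
    (h : ∀ x ∈ Icc (0 : ℝ) 1, ∀ y ∈ Icc (0 : ℝ) 1, |f x - f y| ≤ C * |x - y|) : IsLip f := by
  refine ⟨C.toNNReal, LipschitzOnWith.of_dist_le_mul fun x hx y hy => ?_⟩
  rw [Real.dist_eq, Real.dist_eq]
  refine (h x hx y hy).trans ?_
  gcongr
  exact Real.le_coe_toNNReal C

namespace IsLip

variable {f g : ℝ → ℝ}

lemma exists_abs_sub_le (hf : IsLip f) : ∃ C : ℝ, 0 ≤ C ∧
    ∀ x ∈ Icc (0 : ℝ) 1, ∀ y ∈ Icc (0 : ℝ) 1, |f x - f y| ≤ C * |x - y| := by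
  obtain ⟨C, hC⟩ := hf
  exact ⟨C, C.2, fun x hx y hy => by simpa [Real.dist_eq] using hC.dist_le_mul x hx y hy⟩

lemma continuousOn (hf : IsLip f) : ContinuousOn f (Icc 0 1) := hf.choose_spec.continuousOn

lemma exists_abs_le (hf : IsLip f) : ∃ B : ℝ, 0 ≤ B ∧ ∀ x ∈ Icc (0 : ℝ) 1, |f x| ≤ B := by
  obtain ⟨C, hC, h⟩ := hf.exists_abs_sub_le
  refine ⟨|f 0| + C, by positivity, fun x hx => ?_⟩
  have h1 := h x hx 0 (by simp)
  rw [sub_zero, abs_of_nonneg hx.1] at h1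
  have h2 : |f x| ≤ |f x - f 0| + |f 0| := by simpa using abs_add_le (f x - f 0) (f 0)
  nlinarith [hx.2]

lemma const (c : ℝ) : IsLip fun _ => c := ⟨0, (LipschitzWith.const c).lipschitzOnWith⟩

lemma add (hf : IsLip f) (hg : IsLip g) : IsLip fun x => f x + g x :=
  ⟨_, hf.choose_spec.add hg.choose_spec⟩

lemma sub (hf : IsLip f) (hg : IsLip g) : IsLip fun x => f x - g x :=
  ⟨_, hf.choose_spec.sub hg.choose_spec⟩

lemma mul (hf : IsLip f) (hg : IsLip g) : IsLip fun x => f x * g x := by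
  obtain ⟨C, hC, h⟩ := hf.exists_abs_sub_le
  obtain ⟨D, hD, k⟩ := hg.exists_abs_sub_le
  obtain ⟨A, hA, a⟩ := hf.exists_abs_le
  obtain ⟨B, hB, b⟩ := hg.exists_abs_le
  refine isLip_of_abs_sub_le (C := A * D + C * B) fun x hx y hy => ?_
  have e : f x * g x - f y * g y = f x * (g x - g y) + (f x - f y) * g y := by ring
  rw [e]
  refine (abs_add_le _ _).trans ?_
  rw [abs_mul, abs_mul, add_mul]
  have h1 := mul_le_mul (a x hx) (k x hx y hy) (abs_nonneg _) hA
  have h2 := mul_le_mul (h x hx y hy) (b y hy) (abs_nonneg _) (by positivity)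
  linarith

lemma const_mul (c : ℝ) (hf : IsLip f) : IsLip fun x => c * f x := (const c).mul hf

lemma ac (hf : IsLip f) : AbsolutelyContinuousOnInterval f 0 1 := by
  apply LipschitzOnWith.absolutelyContinuousOnInterval (K := hf.choose)
  rw [uIcc_of_le zero_le_one]
  exact hf.choose_spec

lemma ae_differentiableAt (hf : IsLip f) :
    ∀ᵐ x ∂volume.restrict (Ioo (0 : ℝ) 1), DifferentiableAt ℝ f x := by
  rw [ae_restrict_iff' measurableSet_Ioo]
  filter_upwards [hf.ac.ae_differentiableAt] with x hx hxm
  exact hx (by rw [uIcc_of_le zero_le_one]; exact Ioo_subset_Icc_self hxm)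

lemma integral_deriv (hf : IsLip f) : ∫ x in Ioo (0 : ℝ) 1, deriv f x = f 1 - f 0 := by
  rw [← hf.ac.integral_deriv_eq_sub, intervalIntegral.integral_of_le zero_le_one,
    integral_Ioc_eq_integral_Ioo]

lemma isBdd (hf : IsLip f) : IsBdd f := by
  obtain ⟨B, _, h⟩ := hf.exists_abs_le
  exact ⟨(hf.continuousOn.mono Ioo_subset_Icc_self).aestronglyMeasurable measurableSet_Ioo,
    B, fun x hx => h x (Ioo_subset_Icc_self hx)⟩

lemma isBdd_deriv (hf : IsLip f) : IsBdd (deriv f) := by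
  refine ⟨(measurable_deriv f).aestronglyMeasurable, hf.choose, fun x hx => ?_⟩
  rw [← Real.norm_eq_abs]
  exact norm_deriv_le_of_lipschitzOn (Icc_mem_nhds hx.1 hx.2) hf.choose_spec

lemma deriv_add (hf : IsLip f) (hg : IsLip g) :
    (deriv fun x => f x + g x) =ᵐ[volume.restrict (Ioo (0 : ℝ) 1)]
      fun x => deriv f x + deriv g x := by
  filter_upwards [hf.ae_differentiableAt, hg.ae_differentiableAt] with x h1 h2
  exact deriv_fun_add h1 h2

lemma deriv_sub (hf : IsLip f) (hg : IsLip g) :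
    (deriv fun x => f x - g x) =ᵐ[volume.restrict (Ioo (0 : ℝ) 1)]
      fun x => deriv f x - deriv g x := by
  filter_upwards [hf.ae_differentiableAt, hg.ae_differentiableAt] with x h1 h2
  exact deriv_fun_sub h1 h2

lemma deriv_mul (hf : IsLip f) (hg : IsLip g) :
    (deriv fun x => f x * g x) =ᵐ[volume.restrict (Ioo (0 : ℝ) 1)]
      fun x => deriv f x * g x + f x * deriv g x := by
  filter_upwards [hf.ae_differentiableAt, hg.ae_differentiableAt] with x h1 h2
  exact deriv_fun_mul h1 h2

end IsLip

namespace IsBdd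

variable {f g : ℝ → ℝ}

lemma integrable (hf : IsBdd f) : Integrable f (volume.restrict (Ioo (0 : ℝ) 1)) := by
  obtain ⟨h, C, hC⟩ := hf
  exact Integrable.of_bound h C ((ae_restrict_iff' measurableSet_Ioo).2 (.of_forall hC))

lemma const (c : ℝ) : IsBdd fun _ => c := ⟨aestronglyMeasurable_const, |c|, fun _ _ => le_rfl⟩

lemma add (hf : IsBdd f) (hg : IsBdd g) : IsBdd fun x => f x + g x := by
  obtain ⟨h, C, hC⟩ := hf
  obtain ⟨k, D, hD⟩ := hg
  exact ⟨h.add k, C + D, fun x hx => (abs_add_le _ _).trans (add_le_add (hC x hx) (hD x hx))⟩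

lemma mul (hf : IsBdd f) (hg : IsBdd g) : IsBdd fun x => f x * g x := by
  obtain ⟨h, C, hC⟩ := hf
  obtain ⟨k, D, hD⟩ := hg
  refine ⟨h.mul k, C * D, fun x hx => ?_⟩
  rw [abs_mul]
  exact mul_le_mul (hC x hx) (hD x hx) (abs_nonneg _) ((abs_nonneg _).trans (hC x hx))

lemma const_mul (c : ℝ) (hf : IsBdd f) : IsBdd fun x => c * f x := (const c).mul hf

end IsBdd

/-! ### The inner product -/

lemma inner2_comm (f g : ℝ → ℝ) : inner2 f g = inner2 g f := by
  unfold inner2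
  congr 1
  ext x
  ring

lemma inner2_congr_ae {f f' g g' : ℝ → ℝ} (hf : f =ᵐ[volume.restrict (Ioo (0 : ℝ) 1)] f')
    (hg : g =ᵐ[volume.restrict (Ioo (0 : ℝ) 1)] g') : inner2 f g = inner2 f' g' := by
  apply integral_congr_ae
  filter_upwards [hf, hg] with x h1 h2
  rw [h1, h2]

lemma ae_eq_of_eqOn {f g : ℝ → ℝ} (h : EqOn f g (Icc 0 1)) :
    f =ᵐ[volume.restrict (Ioo (0 : ℝ) 1)] g :=
  (ae_restrict_iff' measurableSet_Ioo).2 (.of_forall fun _ hx => h (Ioo_subset_Icc_self hx))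

lemma deriv_ae_eq_of_eqOn {f g : ℝ → ℝ} (h : EqOn f g (Icc 0 1)) :
    deriv f =ᵐ[volume.restrict (Ioo (0 : ℝ) 1)] deriv g :=
  (ae_restrict_iff' measurableSet_Ioo).2 (.of_forall fun _ hx =>
    (h.eventuallyEq_of_mem (Icc_mem_nhds hx.1 hx.2)).deriv_eq)

lemma inner2_congr {f f' g g' : ℝ → ℝ} (hf : EqOn f f' (Icc 0 1)) (hg : EqOn g g' (Icc 0 1)) :
    inner2 f g = inner2 f' g' := inner2_congr_ae (ae_eq_of_eqOn hf) (ae_eq_of_eqOn hg)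

lemma formA_congr {f f' g g' : ℝ → ℝ} (hf : EqOn f f' (Icc 0 1)) (hg : EqOn g g' (Icc 0 1)) :
    formA f g = formA f' g' := by
  rw [formA, formA, inner2_congr hf hg,
    inner2_congr_ae (deriv_ae_eq_of_eqOn hf) (deriv_ae_eq_of_eqOn hg)]

lemma inner2_add_left {f f' g : ℝ → ℝ} (hf : IsBdd f) (hf' : IsBdd f') (hg : IsBdd g) :
    inner2 (fun x => f x + f' x) g = inner2 f g + inner2 f' g := by
  unfold inner2
  rw [← integral_add (hf.mul hg).integrable (hf'.mul hg).integrable]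
  congr 1
  ext x
  ring

lemma inner2_sub_left {f f' g : ℝ → ℝ} (hf : IsBdd f) (hf' : IsBdd f') (hg : IsBdd g) :
    inner2 (fun x => f x - f' x) g = inner2 f g - inner2 f' g := by
  unfold inner2
  rw [← integral_sub (hf.mul hg).integrable (hf'.mul hg).integrable]
  congr 1
  ext x
  ring

lemma inner2_const_mul_left (c : ℝ) (f g : ℝ → ℝ) :
    inner2 (fun x => c * f x) g = c * inner2 f g := by
  unfold inner2
  rw [← integral_const_mul]
  congr 1
  ext x
  ring

lemma inner2_add_right {f g g' : ℝ → ℝ} (hf : IsBdd f) (hg : IsBdd g) (hg' : IsBdd g') :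
    inner2 f (fun x => g x + g' x) = inner2 f g + inner2 f g' := by
  rw [inner2_comm, inner2_add_left hg hg' hf, inner2_comm g, inner2_comm g']

lemma inner2_const_mul_right (c : ℝ) (f g : ℝ → ℝ) :
    inner2 f (fun x => c * g x) = c * inner2 f g := by
  rw [inner2_comm, inner2_const_mul_left, inner2_comm]

lemma inner2_self_nonneg (f : ℝ → ℝ) : 0 ≤ inner2 f f :=
  integral_nonneg fun x => mul_self_nonneg (f x)

lemma formA_self_nonneg (f : ℝ → ℝ) : 0 ≤ formA f f := by
  have := inner2_self_nonneg f
  have := inner2_self_nonneg (deriv f)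
  unfold formA
  positivity

lemma norm2_sq (f : ℝ → ℝ) : norm2 f ^ 2 = inner2 f f := Real.sq_sqrt (inner2_self_nonneg f)

lemma normH1_eq (f : ℝ → ℝ) : normH1 f = Real.sqrt (formA f f) := by
  rw [normH1, norm2_sq, norm2_sq, formA]

lemma formA_comm (f g : ℝ → ℝ) : formA f g = formA g f := by
  rw [formA, formA, inner2_comm f, inner2_comm (deriv f)]

lemma formA_add_left {f f' g : ℝ → ℝ} (hf : IsLip f) (hf' : IsLip f') (hg : IsLip g) :
    formA (fun x => f x + f' x) g = formA f g + formA f' g := by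
  rw [formA, formA, formA, inner2_add_left hf.isBdd hf'.isBdd hg.isBdd,
    inner2_congr_ae (hf.deriv_add hf') (Filter.EventuallyEq.refl _ _),
    inner2_add_left hf.isBdd_deriv hf'.isBdd_deriv hg.isBdd_deriv]
  ring

lemma formA_sub_left {f f' g : ℝ → ℝ} (hf : IsLip f) (hf' : IsLip f') (hg : IsLip g) :
    formA (fun x => f x - f' x) g = formA f g - formA f' g := by
  rw [formA, formA, formA, inner2_sub_left hf.isBdd hf'.isBdd hg.isBdd,
    inner2_congr_ae (hf.deriv_sub hf') (Filter.EventuallyEq.refl _ _),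
    inner2_sub_left hf.isBdd_deriv hf'.isBdd_deriv hg.isBdd_deriv]
  ring

lemma formA_const_mul_left (c : ℝ) (f g : ℝ → ℝ) :
    formA (fun x => c * f x) g = c * formA f g := by
  have : deriv (fun x => c * f x) = fun x => c * deriv f x := by
    ext x
    exact deriv_const_mul_field c
  rw [formA, formA, inner2_const_mul_left, this, inner2_const_mul_left]
  ring

lemma formA_add_right {f g g' : ℝ → ℝ} (hf : IsLip f) (hg : IsLip g) (hg' : IsLip g') :
    formA f (fun x => g x + g' x) = formA f g + formA f g' := by
  rw [formA_comm, formA_add_left hg hg' hf, formA_comm g, formA_comm g']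

lemma formA_const_mul_right (c : ℝ) (f g : ℝ → ℝ) :
    formA f (fun x => c * g x) = c * formA f g := by
  rw [formA_comm, formA_const_mul_left, formA_comm]

/-- A Lipschitz function with `L²`-norm zero vanishes on `[0,1]`. -/
lemma IsLip.eq_zero_of_inner2_self {f : ℝ → ℝ} (hf : IsLip f) (h : inner2 f f = 0) :
    EqOn f (fun _ => 0) (Icc 0 1) := by
  apply eqOn_Icc_of_ae_eq hf.continuousOn continuousOn_const
  have := (integral_eq_zero_iff_of_nonneg (fun x => mul_self_nonneg (f x))
    (hf.isBdd.mul hf.isBdd).integrable).1 h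
  filter_upwards [this] with x hx
  exact mul_self_eq_zero.1 hx

/-! ### Piecewise linear functions, nodal interpolation and the inverse inequality. -/

namespace Mesh

variable {N : ℕ}

lemma pos (M : Mesh N) : 0 < N := by
  rcases Nat.eq_zero_or_pos N with h | h
  · subst h
    have := M.node_zero.symm.trans M.node_last
    norm_num at this
  · exact h

variable (M : Mesh N)

/-- The derivative on the `i`-th interval of the piecewise linear function with nodal values `c`. -/
noncomputable def slope (c : Fin (N + 1) → ℝ) (i : Fin N) : ℝ :=
  (c i.succ - c i.castSucc) / M.len i

/-- The continuous piecewise linear function with nodal values `c`, extended to `ℝ` by constants. -/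
noncomputable def pl (c : Fin (N + 1) → ℝ) (x : ℝ) : ℝ :=
  c 0 + ∑ i : Fin N, M.slope c i *
    (min (max x (M.node i.castSucc)) (M.node i.succ) - M.node i.castSucc)

/-- The nodal values of a function. -/
def values (f : ℝ → ℝ) (i : Fin (N + 1)) : ℝ := f (M.node i)

lemma len_pos (i : Fin N) : 0 < M.len i := sub_pos.2 (M.strictMono Fin.castSucc_lt_succ)

lemma node_mem (j : Fin (N + 1)) : M.node j ∈ Icc (0 : ℝ) 1 :=
  ⟨M.node_zero ▸ M.strictMono.monotone (Fin.zero_le j),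
    M.node_last ▸ M.strictMono.monotone (Fin.le_last j)⟩

lemma len_le_size (i : Fin N) : M.len i ≤ M.size := le_ciSup (Finite.bddAbove_range _) i

lemma size_pos : 0 < M.size := (M.len_pos ⟨0, M.pos⟩).trans_le (M.len_le_size _)

lemma QuasiUniform.size_le {M : Mesh N} {κ : ℝ} (h : M.QuasiUniform κ) (j : Fin N) :
    M.size ≤ κ * M.len j :=
  have : Nonempty (Fin N) := ⟨j⟩
  ciSup_le fun i => h i j

lemma sum_filter_sub (c : Fin (N + 1) → ℝ) (j : Fin (N + 1)) :
    c 0 + ∑ i : Fin N with i.castSucc < j, (c i.succ - c i.castSucc) = c j := by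
  induction j using Fin.induction with
  | zero => simp
  | succ j ih =>
    have : (Finset.univ.filter fun i : Fin N => i.castSucc < j.succ)
        = insert j (Finset.univ.filter fun i : Fin N => i.castSucc < j.castSucc) := by
      ext i
      simp only [Finset.mem_filter, Finset.mem_univ, true_and, Finset.mem_insert, Fin.lt_def,
        Fin.ext_iff, Fin.val_castSucc, Fin.val_succ]
      omega
    rw [this, Finset.sum_insert (by simp)]
    linarith

/-- For x in the j-th cell, the clamped terms of earlier cells are full increments and telescope to
the value at the left node, while those of later cells vanish. -/
lemma pl_of_mem (c : Fin (N + 1) → ℝ) (j : Fin N) {x : ℝ}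
    (hx : x ∈ Icc (M.node j.castSucc) (M.node j.succ)) :
    M.pl c x = c j.castSucc + M.slope c j * (x - M.node j.castSucc) := by
  rw [← sum_filter_sub c j.castSucc, pl, add_assoc]
  congr 1
  have : ∀ i : Fin N, M.slope c i *
      (min (max x (M.node i.castSucc)) (M.node i.succ) - M.node i.castSucc)
      = (if i.castSucc < j.castSucc then c i.succ - c i.castSucc else 0)
        + if i = j then M.slope c j * (x - M.node j.castSucc) else 0 := by
    intro i
    have hlt := M.strictMono (Fin.castSucc_lt_succ (i := i))
    rcases lt_trichotomy i j with h | h | h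
    · have h1 : M.node i.succ ≤ M.node j.castSucc :=
        M.strictMono.monotone (Fin.succ_le_castSucc_iff.2 h)
      rw [if_pos (by simpa using h), if_neg h.ne, max_eq_left (by linarith [hx.1]),
        min_eq_right (by linarith [hx.1]), slope, add_zero]
      exact div_mul_cancel₀ _ (M.len_pos i).ne'
    · subst h
      rw [if_neg (lt_irrefl _), if_pos rfl, max_eq_left hx.1, min_eq_left hx.2, zero_add]
    · have h1 : M.node j.succ ≤ M.node i.castSucc :=
        M.strictMono.monotone (Fin.succ_le_castSucc_iff.2 h)
      rw [if_neg (by simpa using h.le), if_neg h.ne', max_eq_right (by linarith [hx.2]),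
        min_eq_left hlt.le]
      ring
  rw [Finset.sum_congr rfl fun i _ => this i, Finset.sum_add_distrib, Finset.sum_filter,
    Finset.sum_ite_eq' Finset.univ j]
  simp

lemma exists_mem_cell {x : ℝ} (hx : x ∈ Icc (0 : ℝ) 1) :
    ∃ j : Fin N, x ∈ Icc (M.node j.castSucc) (M.node j.succ) := by
  by_contra! h
  -- If no cell contains x, induction puts every node to the left of x; then x lies in the last cell
  -- after all.
  have key : ∀ j : Fin (N + 1), M.node j ≤ x := by
    intro j
    induction j using Fin.induction with
    | zero => rw [M.node_zero]; exact hx.1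
    | succ j ih =>
      by_contra! hlt
      exact h j ⟨ih, hlt.le⟩
  have hN := M.pos
  obtain ⟨n, rfl⟩ : ∃ n, N = n + 1 := ⟨N - 1, by omega⟩
  apply h (Fin.last n)
  refine ⟨key _, ?_⟩
  rw [Fin.succ_last, M.node_last]
  exact hx.2

lemma pl_node (c : Fin (N + 1) → ℝ) (j : Fin (N + 1)) : M.pl c (M.node j) = c j := by
  have hN := M.pos
  obtain ⟨n, rfl⟩ : ∃ n, N = n + 1 := ⟨N - 1, by omega⟩
  induction j using Fin.cases with
  | zero =>
    have := M.pl_of_mem c 0 (x := M.node 0)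
      ⟨le_rfl, M.strictMono.monotone (Fin.zero_le _)⟩
    rw [this]
    simp
  | succ j =>
    have hlt := M.strictMono (Fin.castSucc_lt_succ (i := j))
    rw [M.pl_of_mem c j ⟨hlt.le, le_rfl⟩, slope]
    have := div_mul_cancel₀ (c j.succ - c j.castSucc) (M.len_pos j).ne'
    rw [len] at this ⊢
    rw [this]
    ring

lemma pl_zero (c : Fin (N + 1) → ℝ) : M.pl c 0 = c 0 := by
  conv_lhs => rw [← M.node_zero]
  exact M.pl_node c 0

lemma pl_one (c : Fin (N + 1) → ℝ) : M.pl c 1 = c (Fin.last N) := by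
  conv_lhs => rw [← M.node_last]
  exact M.pl_node c _

lemma slope_add (c d : Fin (N + 1) → ℝ) (i : Fin N) :
    M.slope (c + d) i = M.slope c i + M.slope d i := by
  simp only [slope, Pi.add_apply]
  ring

lemma slope_smul (r : ℝ) (c : Fin (N + 1) → ℝ) (i : Fin N) :
    M.slope (r • c) i = r * M.slope c i := by
  simp only [slope, Pi.smul_apply, smul_eq_mul]
  ring

lemma pl_add (c d : Fin (N + 1) → ℝ) : M.pl (c + d) = fun x => M.pl c x + M.pl d x := by
  ext x
  simp only [pl, slope_add, add_mul, Finset.sum_add_distrib, Pi.add_apply]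
  ring

lemma pl_smul (r : ℝ) (c : Fin (N + 1) → ℝ) : M.pl (r • c) = fun x => r * M.pl c x := by
  ext x
  simp only [pl, slope_smul, mul_assoc, ← Finset.mul_sum, Pi.smul_apply, smul_eq_mul]
  ring

lemma pl_sub (c d : Fin (N + 1) → ℝ) : M.pl (c - d) = fun x => M.pl c x - M.pl d x := by
  have : c - d = c + (-1 : ℝ) • d := by
    ext i
    simp [sub_eq_add_neg]
  rw [this, pl_add, pl_smul]
  ext x
  ring

lemma lipschitz_pl (c : Fin (N + 1) → ℝ) : IsLip (M.pl c) := by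
  have key : ∀ s : Finset (Fin N), IsLip fun x => ∑ i ∈ s, M.slope c i *
      (min (max x (M.node i.castSucc)) (M.node i.succ) - M.node i.castSucc) := by
    intro s
    induction s using Finset.induction_on with
    | empty => simpa using IsLip.const 0
    | insert i s hi ih =>
      simp only [Finset.sum_insert hi]
      refine IsLip.add (IsLip.const_mul _ (IsLip.sub ⟨1, ?_⟩ (IsLip.const _))) ih
      exact ((LipschitzWith.id.max_const _).min_const _).lipschitzOnWith
  exact (IsLip.const _).add (key _)

lemma pl_mem_S (c : Fin (N + 1) → ℝ) : M.pl c ∈ M.S := by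
  refine ⟨(M.lipschitz_pl c).continuousOn, fun i => ?_⟩
  refine ⟨c i.castSucc - M.slope c i * M.node i.castSucc, M.slope c i, fun x hx => ?_⟩
  rw [M.pl_of_mem c i hx]
  ring

lemma pl_mem_S0 {c : Fin (N + 1) → ℝ} (h0 : c 0 = 0) (h1 : c (Fin.last N) = 0) :
    M.pl c ∈ M.S0 := ⟨M.pl_mem_S c, by rw [pl_zero, h0], by rw [pl_one, h1]⟩

lemma eqOn_pl_values {φ : ℝ → ℝ} (hφ : φ ∈ M.S) : EqOn φ (M.pl (M.values φ)) (Icc 0 1) := by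
  intro x hx
  obtain ⟨j, hj⟩ := M.exists_mem_cell hx
  obtain ⟨a, b, hab⟩ := hφ.2 j
  have hlt := M.strictMono (Fin.castSucc_lt_succ (i := j))
  rw [M.pl_of_mem _ j hj, slope, values, values, hab x hj, hab _ ⟨le_rfl, hlt.le⟩,
    hab _ ⟨hlt.le, le_rfl⟩]
  have : (a + b * M.node j.succ - (a + b * M.node j.castSucc)) / M.len j = b := by
    rw [div_eq_iff (M.len_pos j).ne', len]
    ring
  rw [this]
  ring

lemma values_zero (f : ℝ → ℝ) : M.values f 0 = f 0 := by rw [values, node_zero]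

lemma values_last (f : ℝ → ℝ) : M.values f (Fin.last N) = f 1 := by rw [values, node_last]

lemma eq_zero_of_pl_eqOn {c : Fin (N + 1) → ℝ} (h : EqOn (M.pl c) (fun _ => 0) (Icc 0 1)) :
    c = 0 := by
  ext j
  rw [← M.pl_node c j]
  exact h (M.node_mem j)

lemma hasDerivAt_pl (c : Fin (N + 1) → ℝ) (j : Fin N) {x : ℝ}
    (hx : x ∈ Ioo (M.node j.castSucc) (M.node j.succ)) :
    HasDerivAt (M.pl c) (M.slope c j) x := by
  have h : HasDerivAt (fun x => c j.castSucc + M.slope c j * (x - M.node j.castSucc))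
      (M.slope c j) x := by
    simpa using (((hasDerivAt_id x).sub_const _).const_mul (M.slope c j)).const_add (c j.castSucc)
  refine h.congr_of_eventuallyEq ?_
  filter_upwards [Icc_mem_nhds hx.1 hx.2] with y hy
  exact M.pl_of_mem c j hy

lemma ae_mem_cell : ∀ᵐ x ∂volume.restrict (Ioo (0 : ℝ) 1),
    ∃ j : Fin N, x ∈ Ioo (M.node j.castSucc) (M.node j.succ) := by
  rw [ae_restrict_iff' measurableSet_Ioo]
  have : ∀ᵐ x : ℝ, x ∉ range M.node := (finite_range M.node).countable.ae_notMem _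
  filter_upwards [this] with x hx hxm
  obtain ⟨j, h1, h2⟩ := M.exists_mem_cell (Ioo_subset_Icc_self hxm)
  exact ⟨j, lt_of_le_of_ne h1 fun h => hx ⟨_, h⟩, lt_of_le_of_ne h2 fun h => hx ⟨_, h.symm⟩⟩

lemma cell_subset (j : Fin N) : Icc (M.node j.castSucc) (M.node j.succ) ⊆ Icc 0 1 :=
  Icc_subset_Icc (M.node_mem _).1 (M.node_mem _).2

lemma deriv_pl_ae (c : Fin (N + 1) → ℝ) :
    deriv (M.pl c) =ᵐ[volume.restrict (Ioo (0 : ℝ) 1)] fun x =>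
      ∑ i : Fin N, M.slope c i * (Ioo (M.node i.castSucc) (M.node i.succ)).indicator 1 x := by
  filter_upwards [M.ae_mem_cell] with x ⟨j, hj⟩
  rw [(M.hasDerivAt_pl c j hj).deriv, Finset.sum_eq_single j]
  · simp [hj]
  · intro i _ hij
    have : x ∉ Ioo (M.node i.castSucc) (M.node i.succ) := by
      intro hi
      rcases lt_or_gt_of_ne hij with h | h
      · have := M.strictMono.monotone (Fin.succ_le_castSucc_iff.2 h)
        linarith [hi.2, hj.1]
      · have := M.strictMono.monotone (Fin.succ_le_castSucc_iff.2 h)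
        linarith [hi.1, hj.2]
    simp [this]
  · simp

/-- The inner product of derivatives with a piecewise linear function only involves nodal values. -/
lemma inner2_deriv_deriv_pl {g : ℝ → ℝ} (hg : IsLip g) (c : Fin (N + 1) → ℝ) :
    inner2 (deriv g) (deriv (M.pl c))
      = ∑ i : Fin N, M.slope c i * (g (M.node i.succ) - g (M.node i.castSucc)) := by
  rw [inner2_congr_ae (Filter.EventuallyEq.refl _ _) (M.deriv_pl_ae c), inner2]
  have e : ∀ i : Fin N, ∀ x, deriv g x *
      (M.slope c i * (Ioo (M.node i.castSucc) (M.node i.succ)).indicator 1 x)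
      = M.slope c i * (Ioo (M.node i.castSucc) (M.node i.succ)).indicator (deriv g) x := by
    intro i x
    by_cases hx : x ∈ Ioo (M.node i.castSucc) (M.node i.succ)
    · simp [hx, mul_comm]
    · simp [hx]
  simp only [Finset.mul_sum, e]
  have hi : ∀ i : Fin N, Integrable ((Ioo (M.node i.castSucc) (M.node i.succ)).indicator (deriv g))
      (volume.restrict (Ioo (0 : ℝ) 1)) := fun i =>
    hg.isBdd_deriv.integrable.indicator measurableSet_Ioo
  rw [integral_finsetSum _ fun i _ => (hi i).const_mul _]
  refine Finset.sum_congr rfl fun i _ => ?_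
  rw [integral_const_mul, setIntegral_indicator measurableSet_Ioo]
  congr 1
  have hsub : Ioo (M.node i.castSucc) (M.node i.succ) ⊆ Ioo 0 1 :=
    Ioo_subset_Ioo (M.node_mem _).1 (M.node_mem _).2
  have hle := (M.strictMono (Fin.castSucc_lt_succ (i := i))).le
  rw [inter_eq_right.2 hsub, ← integral_Ioc_eq_integral_Ioo, ← intervalIntegral.integral_of_le hle]
  apply AbsolutelyContinuousOnInterval.integral_deriv_eq_sub
  apply hg.ac.mono
  rw [uIcc_of_le hle, uIcc_of_le zero_le_one]
  exact M.cell_subset i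

/-- Nodal interpolation is orthogonal for the inner product of derivatives. -/
lemma inner2_deriv_pl_values {g : ℝ → ℝ} (hg : IsLip g) (c : Fin (N + 1) → ℝ) :
    inner2 (deriv (M.pl (M.values g))) (deriv (M.pl c)) = inner2 (deriv g) (deriv (M.pl c)) := by
  -- Both sides depend on the first function only through its nodal values, which interpolation
  -- preserves.
  rw [M.inner2_deriv_deriv_pl (M.lipschitz_pl _), M.inner2_deriv_deriv_pl hg]
  simp only [pl_node, values]

/-- The inverse inequality bounding slopes by the `L²`-norm of the derivative. -/
lemma len_mul_slope_sq_le (c : Fin (N + 1) → ℝ) (i : Fin N) :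
    M.len i * M.slope c i ^ 2 ≤ inner2 (deriv (M.pl c)) (deriv (M.pl c)) := by
  rw [M.inner2_deriv_deriv_pl (M.lipschitz_pl _)]
  have e : ∀ j : Fin N, M.slope c j * (M.pl c (M.node j.succ) - M.pl c (M.node j.castSucc))
      = M.len j * M.slope c j ^ 2 := by
    intro j
    rw [pl_node, pl_node, slope]
    have := (M.len_pos j).ne'
    field_simp
  rw [Finset.sum_congr rfl fun j _ => e j]
  exact Finset.single_le_sum (f := fun j => M.len j * M.slope c j ^ 2)
    (fun j _ => mul_nonneg (M.len_pos j).le (sq_nonneg _)) (Finset.mem_univ i)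

lemma abs_sub_node_le {j : Fin N} {x : ℝ} (hx : x ∈ Icc (M.node j.castSucc) (M.node j.succ)) :
    |x - M.node j.castSucc| ≤ M.size := by
  rw [abs_of_nonneg (sub_nonneg.2 hx.1)]
  refine le_trans ?_ (M.len_le_size j)
  rw [len]
  linarith [hx.2]

/-- The interpolation error of a Lipschitz function. -/
lemma abs_sub_pl_values_le {g : ℝ → ℝ} {K : ℝ} (hK : 0 ≤ K)
    (hg : ∀ x ∈ Icc (0 : ℝ) 1, ∀ y ∈ Icc (0 : ℝ) 1, |g x - g y| ≤ K * |x - y|)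
    {x : ℝ} (hx : x ∈ Icc (0 : ℝ) 1) : |g x - M.pl (M.values g) x| ≤ 2 * K * M.size := by
  obtain ⟨j, hj⟩ := M.exists_mem_cell hx
  have hlt := M.strictMono (Fin.castSucc_lt_succ (i := j))
  have h1 := hg x hx _ (M.node_mem j.castSucc)
  have hs : |M.slope (M.values g) j| ≤ K := by
    rw [slope, abs_div, abs_of_pos (M.len_pos j), div_le_iff₀ (M.len_pos j)]
    have := hg _ (M.node_mem j.succ) _ (M.node_mem j.castSucc)
    rwa [abs_of_pos (sub_pos.2 hlt)] at this
  have h2 := M.abs_sub_node_le hj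
  rw [M.pl_of_mem _ j hj]
  have e : g x - (M.values g j.castSucc + M.slope (M.values g) j * (x - M.node j.castSucc))
      = (g x - g (M.node j.castSucc)) - M.slope (M.values g) j * (x - M.node j.castSucc) := by
    rw [values]
    ring
  rw [e]
  refine (abs_sub _ _).trans ?_
  rw [abs_mul]
  have h3 := mul_le_mul hs h2 (abs_nonneg _) hK
  have h4 := mul_le_mul_of_nonneg_left h2 hK
  linarith

end Mesh

/-! ### Functions with a Lipschitz derivative -/

namespace HasLipDeriv

variable {K : ℝ} {f : ℝ → ℝ}

lemma nonneg (hf : HasLipDeriv K f) : 0 ≤ K := by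
  obtain ⟨F, -, h, -⟩ := hf
  exact (abs_nonneg _).trans (h 0 (by simp))

lemma abs_sub_le (hf : HasLipDeriv K f) :
    ∀ x ∈ Icc (0 : ℝ) 1, ∀ y ∈ Icc (0 : ℝ) 1, |f x - f y| ≤ K * |x - y| := by
  obtain ⟨F, -, hF, -, hd⟩ := hf
  intro x hx y hy
  exact (convex_Icc (0 : ℝ) 1).norm_image_sub_le_of_norm_hasDerivWithin_le hd hF hy hx

lemma isLip (hf : HasLipDeriv K f) : IsLip f := isLip_of_abs_sub_le hf.abs_sub_le

lemma abs_le (hf : HasLipDeriv K f) : ∀ x ∈ Icc (0 : ℝ) 1, |f x| ≤ K := hf.choose_spec.2.2.1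

/-- The derivative of a nodal interpolant approximates the derivative to first order. -/
lemma deriv_sub_deriv_pl (hf : HasLipDeriv K f) {N : ℕ} (M : Mesh N) :
    ∀ᵐ x ∂volume.restrict (Ioo (0 : ℝ) 1),
      |deriv f x| ≤ K ∧ |deriv f x - deriv (M.pl (M.values f)) x| ≤ K * M.size := by
  have hK := hf.nonneg
  obtain ⟨F, hF, hb, -, hd⟩ := hf
  have hD : ∀ x ∈ Ioo (0 : ℝ) 1, HasDerivAt f (F x) x := fun x hx =>
    (hd x (Ioo_subset_Icc_self hx)).hasDerivAt (Icc_mem_nhds hx.1 hx.2)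
  filter_upwards [M.ae_mem_cell] with x ⟨j, hj⟩
  have hlt := M.strictMono (Fin.castSucc_lt_succ (i := j))
  have hsub : Ioo (M.node j.castSucc) (M.node j.succ) ⊆ Ioo 0 1 :=
    Ioo_subset_Ioo (M.node_mem _).1 (M.node_mem _).2
  -- By the mean value theorem the slope of the interpolant is a value of f' in the same cell, and
  -- f' is Lipschitz.
  obtain ⟨y, hy, hyF⟩ := exists_hasDerivAt_eq_slope f F hlt
    (fun z hz => (hd z (M.cell_subset j hz)).continuousWithinAt.mono (M.cell_subset j))
    (fun z hz => hD z (hsub hz))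
  rw [(hD x (hsub hj)).deriv, (M.hasDerivAt_pl _ j hj).deriv]
  refine ⟨hb x (Ioo_subset_Icc_self (hsub hj)), ?_⟩
  have : M.slope (M.values f) j = F y := hyF.symm
  rw [this]
  have h1 := hF.dist_le_mul x y
  rw [Real.dist_eq, Real.dist_eq, Real.coe_toNNReal _ hK] at h1
  refine h1.trans (mul_le_mul_of_nonneg_left ?_ hK)
  refine le_trans ?_ (M.len_le_size j)
  rw [Mesh.len, _root_.abs_le]
  constructor <;> linarith [hj.1, hj.2, hy.1, hy.2]

end HasLipDeriv

lemma Mesh.size_le_one {N : ℕ} (M : Mesh N) : M.size ≤ 1 := by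
  have : Nonempty (Fin N) := ⟨⟨0, M.pos⟩⟩
  refine ciSup_le fun i => ?_
  have h1 := (M.node_mem i.succ).2
  have h2 := (M.node_mem i.castSucc).1
  rw [Mesh.len]
  linarith

/-! ### The elliptic problem `w - w''/3 = f` with homogeneous boundary conditions -/

lemma dx_eq_deriv (w : ℝ → ℝ) {x : ℝ} (hx : x ∈ Ioo (0 : ℝ) 1) : dx w x = deriv w x :=
  derivWithin_of_mem_nhds (Icc_mem_nhds hx.1 hx.2)

/-- The maximum principle. -/
lemma le_of_elliptic {w f : ℝ → ℝ} {A : ℝ} (hw : DifferentiableOn ℝ w (Icc 0 1))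
    (heq : ∀ x ∈ Icc (0 : ℝ) 1, w x - 1 / 3 * dx (dx w) x = f x)
    (hf : ∀ x ∈ Icc (0 : ℝ) 1, f x ≤ A) (hA : 0 ≤ A) (h0 : w 0 = 0) (h1 : w 1 = 0) :
    ∀ x ∈ Icc (0 : ℝ) 1, w x ≤ A := by
  obtain ⟨x₀, hx₀, hmax⟩ := isCompact_Icc.exists_isMaxOn (nonempty_Icc.2 zero_le_one)
    hw.continuousOn
  intro x hx
  refine (hmax hx).trans ?_
  by_contra! hlt
  have hI : x₀ ∈ Ioo (0 : ℝ) 1 := by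
    refine ⟨lt_of_le_of_ne hx₀.1 ?_, lt_of_le_of_ne hx₀.2 ?_⟩
    · rintro rfl
      linarith
    · rintro rfl
      linarith
  have hloc : IsLocalMax w x₀ := hmax.isLocalMax (Icc_mem_nhds hI.1 hI.2)
  have hev : dx w =ᶠ[nhds x₀] deriv w := by
    filter_upwards [Ioo_mem_nhds hI.1 hI.2] with y hy using dx_eq_deriv w hy
  have hdd : dx (dx w) x₀ = deriv (deriv w) x₀ := by
    rw [dx_eq_deriv _ hI, hev.deriv_eq]
  -- At a maximum above A the equation gives w'' = 3(w - f) > 0. The point is then also a local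
  -- minimum, so w is constant near it and w'' = 0, a contradiction.
  have hpos : 0 < deriv (deriv w) x₀ := by
    have := heq x₀ hx₀
    have := hf x₀ hx₀
    rw [← hdd]
    linarith
  have hmin := isLocalMin_of_deriv_deriv_pos hpos hloc.deriv_eq_zero
    (hw.continuousOn.continuousAt (Icc_mem_nhds hI.1 hI.2))
  have hcst : w =ᶠ[nhds x₀] fun _ => w x₀ := by
    filter_upwards [hloc, hmin] with y h1 h2 using le_antisymm h1 h2
  have : deriv (deriv w) x₀ = 0 := by
    rw [hcst.deriv.deriv_eq]
    simp
  linarith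

lemma abs_le_of_elliptic {w f : ℝ → ℝ} {A : ℝ} (hw : DifferentiableOn ℝ w (Icc 0 1))
    (heq : ∀ x ∈ Icc (0 : ℝ) 1, w x - 1 / 3 * dx (dx w) x = f x)
    (hf : ∀ x ∈ Icc (0 : ℝ) 1, |f x| ≤ A) (h0 : w 0 = 0) (h1 : w 1 = 0) :
    ∀ x ∈ Icc (0 : ℝ) 1, |w x| ≤ A := by
  have hA : 0 ≤ A := (abs_nonneg _).trans (hf 0 (by simp))
  intro x hx
  rw [abs_le]
  constructor
  · have e1 : dx (fun x => - w x) = fun x => - dx w x := by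
      ext x
      exact derivWithin.fun_neg
    have e2 : dx (fun x => - dx w x) = fun x => - dx (dx w) x := by
      ext x
      exact derivWithin.fun_neg
    have := le_of_elliptic (w := fun x => - w x) (f := fun x => - f x) (A := A) hw.neg
      (fun x hx => by
        rw [e1, e2, ← heq x hx]
        ring) (fun x hx => (neg_le_abs _).trans (hf x hx)) hA (by simp [h0]) (by simp [h1]) x hx
    linarith
  · exact le_of_elliptic hw heq (fun x hx => (le_abs_self _).trans (hf x hx)) hA h0 h1 x hx

/-- Solutions of the elliptic problem have derivatives that are bounded in terms of the data. -/
lemma abs_dx_le_of_elliptic {w f : ℝ → ℝ} {A : ℝ} (hw : DifferentiableOn ℝ w (Icc 0 1))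
    (hw' : DifferentiableOn ℝ (dx w) (Icc 0 1))
    (heq : ∀ x ∈ Icc (0 : ℝ) 1, w x - 1 / 3 * dx (dx w) x = f x)
    (hf : ∀ x ∈ Icc (0 : ℝ) 1, |f x| ≤ A) (h0 : w 0 = 0) (h1 : w 1 = 0) :
    (∀ x ∈ Icc (0 : ℝ) 1, ∀ y ∈ Icc (0 : ℝ) 1, |dx w x - dx w y| ≤ 6 * A * |x - y|) ∧
      ∀ x ∈ Icc (0 : ℝ) 1, |dx w x| ≤ 6 * A := by
  have hA : 0 ≤ A := (abs_nonneg _).trans (hf 0 (by simp))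
  have hb := abs_le_of_elliptic hw heq hf h0 h1
  have hl : ∀ x ∈ Icc (0 : ℝ) 1, ∀ y ∈ Icc (0 : ℝ) 1, |dx w x - dx w y| ≤ 6 * A * |x - y| := by
    intro x hx y hy
    refine (convex_Icc (0 : ℝ) 1).norm_image_sub_le_of_norm_hasDerivWithin_le
      (f' := dx (dx w)) (fun z hz => (hw' z hz).hasDerivWithinAt) (fun z hz => ?_) hy hx
    have h2 := heq z hz
    have h3 := abs_le.1 (hb z hz)
    have h4 := abs_le.1 (hf z hz)
    rw [Real.norm_eq_abs, abs_le]
    constructor <;> linarith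
  refine ⟨hl, fun x hx => ?_⟩
  -- Since |w''| = 3|w - f| ≤ 6A, the zero of w' given by Rolle's theorem turns the Lipschitz bound
  -- into a bound of w'.
  obtain ⟨c, hc, hc0⟩ := exists_deriv_eq_zero (f := w) zero_lt_one hw.continuousOn
    (h0.trans h1.symm)
  have hc' : dx w c = 0 := by rw [dx_eq_deriv w hc, hc0]
  have := hl x hx c (Ioo_subset_Icc_self hc)
  rw [hc', sub_zero] at this
  refine this.trans (mul_le_of_le_one_right (by positivity) ?_)
  rw [abs_le]
  constructor <;> linarith [hx.1, hx.2, hc.1, hc.2]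

/-- The weak form of the elliptic problem. -/
lemma formA_of_elliptic {w f χ : ℝ → ℝ} {A : ℝ} (hw : DifferentiableOn ℝ w (Icc 0 1))
    (hw' : DifferentiableOn ℝ (dx w) (Icc 0 1))
    (heq : ∀ x ∈ Icc (0 : ℝ) 1, w x - 1 / 3 * dx (dx w) x = f x)
    (hf : ∀ x ∈ Icc (0 : ℝ) 1, |f x| ≤ A) (h0 : w 0 = 0) (h1 : w 1 = 0)
    (hχ : IsLip χ) (hχ0 : χ 0 = 0) (hχ1 : χ 1 = 0) : formA w χ = inner2 f χ := by
  have hreg := abs_dx_le_of_elliptic hw hw' heq hf h0 h1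
  have hWl : IsLip (dx w) := isLip_of_abs_sub_le hreg.1
  have hwl : IsLip w := isLip_of_abs_sub_le fun x hx y hy =>
    (convex_Icc (0 : ℝ) 1).norm_image_sub_le_of_norm_hasDerivWithin_le
      (fun z hz => (hw z hz).hasDerivWithinAt) hreg.2 hy hx
  -- Integration by parts in the form ∫(w'χ)' = 0; a Lipschitz w' is enough for this.
  have hint := (hWl.mul hχ).integral_deriv
  rw [hχ0, hχ1, mul_zero, mul_zero, sub_zero, integral_congr_ae (hWl.deriv_mul hχ)] at hint
  have i1 := (hWl.isBdd_deriv.mul hχ.isBdd).integrable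
  have i2 := (hWl.isBdd.mul hχ.isBdd_deriv).integrable
  rw [integral_add i1 i2] at hint
  have e1 : inner2 (deriv w) (deriv χ) = ∫ x in Ioo (0 : ℝ) 1, dx w x * deriv χ x := by
    refine setIntegral_congr_fun measurableSet_Ioo fun x hx => ?_
    rw [dx_eq_deriv w hx]
  have e2 : inner2 f χ = inner2 w χ - 1 / 3 * ∫ x in Ioo (0 : ℝ) 1, deriv (dx w) x * χ x := by
    unfold inner2
    rw [← integral_const_mul, ← integral_sub (hwl.isBdd.mul hχ.isBdd).integrable (i1.const_mul _)]
    refine setIntegral_congr_fun measurableSet_Ioo fun x hx => ?_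
    rw [← heq x (Ioo_subset_Icc_self hx), ← dx_eq_deriv _ hx]
    ring
  rw [formA, e1, e2]
  linarith

/-! ### The energy inequality at a fixed time. -/

lemma abs_mul_le_mul {a b A B : ℝ} (ha : |a| ≤ A) (hb : |b| ≤ B) : |a * b| ≤ A * B := by
  rw [abs_mul]
  exact mul_le_mul ha hb (abs_nonneg _) ((abs_nonneg _).trans ha)

/-- The pointwise bound of the integrand in the energy identity. Here `η = ζ + e`, `u = σ + v` are
the exact solution, `ζ - θ`, `σ - ξ` the discrete one, and a final `x` marks a space derivative. -/
lemma energy_integrand_le {α β γ B h e ex v vx ζ ζx σ σx θ ξ ξx q r : ℝ} (hB : 1 ≤ B)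
    (hh : 0 ≤ h) (hh1 : h ≤ 1) (hα : |α| ≤ B) (hβ : |β| ≤ B) (hγ : |γ| ≤ B)
    (he : |e| ≤ B * h) (hex : |ex| ≤ B * h) (hv : |v| ≤ B * h) (hvx : |vx| ≤ B * h)
    (hq : |q| ≤ B * h) (hr : |r| ≤ B * h) (hζ : |ζ| ≤ B) (hζx : |ζx| ≤ B) (hσ : |σ| ≤ B)
    (hσx : |σx| ≤ B) (hξ : |ξ| ≤ 1) (hξx : |ξx| ≤ 1) :
    q * θ - (vx + ξx) * θ
      - α * (ζx * v + ζ * vx + ex * σ + e * σx + ex * v + e * vx) * θ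
      - α * (ζx * ξ + ζ * ξx) * θ - α / 2 * (σx - ξx) * θ ^ 2 + r * ξ + (e + θ) * ξx
      + β / 2 * ((v + ξ) * (2 * σ + v - ξ)) * ξx
      + γ / 2 * ((e + θ) * (2 * ζ + e - θ)) * ξx
      ≤ 128 * B ^ 3 * (h ^ 2 + θ ^ 2 + ξ ^ 2 + ξx ^ 2) := by
  have hB0 : 0 ≤ B := by linarith
  set t := |θ| with ht
  set k := |ξ| with hk
  set m := |ξx| with hm
  have ht0 : 0 ≤ t := abs_nonneg _
  have hk0 : 0 ≤ k := abs_nonneg _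
  have hm0 : 0 ≤ m := abs_nonneg _
  -- Every term is to be bounded by a power of B times s². Surplus factors are absorbed by h ≤ 1,
  -- |ξ| ≤ 1 or |ξx| ≤ 1.
  set s := h + t + k + m with hs
  have hs0 : 0 ≤ s := by positivity
  have hhs : h ≤ s := by linarith
  have hts : t ≤ s := by linarith
  have hks : k ≤ s := by linarith
  have hms : m ≤ s := by linarith
  have hBs : B * h ≤ B * s := by gcongr
  have hBh : B * h ≤ B := mul_le_of_le_one_right hB0 hh1
  have hsB : s ≤ B * s := le_mul_of_one_le_left hs0 hB
  have b1 : |q * θ| ≤ (B * s) * s := abs_mul_le_mul (hq.trans hBs) hts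
  have b2 : |(vx + ξx) * θ| ≤ (2 * (B * s)) * s := by
    refine abs_mul_le_mul ((abs_add_le _ _).trans ?_) hts
    linarith
  have b3 : |α * (ζx * v + ζ * vx + ex * σ + e * σx + ex * v + e * vx) * θ|
      ≤ (B * (6 * (B * (B * s)))) * s := by
    refine abs_mul_le_mul (abs_mul_le_mul hα ?_) hts
    have c1 := abs_mul_le_mul hζx (hv.trans hBs)
    have c2 := abs_mul_le_mul hζ (hvx.trans hBs)
    have c3 := abs_mul_le_mul hσ (hex.trans hBs)
    have c4 := abs_mul_le_mul hσx (he.trans hBs)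
    have c5 := abs_mul_le_mul (hv.trans hBh) (hex.trans hBs)
    have c6 := abs_mul_le_mul (hvx.trans hBh) (he.trans hBs)
    rw [abs_le] at c1 c2 c3 c4 c5 c6 ⊢
    constructor <;> linarith
  have b4 : |α * (ζx * ξ + ζ * ξx) * θ| ≤ (B * (2 * (B * s))) * s := by
    refine abs_mul_le_mul (abs_mul_le_mul hα ?_) hts
    have c1 := abs_mul_le_mul hζx hks
    have c2 := abs_mul_le_mul hζ hms
    rw [abs_le] at c1 c2 ⊢
    constructor <;> linarith
  have hθ2 : |θ ^ 2| ≤ s * s := by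
    rw [pow_two]
    exact abs_mul_le_mul hts hts
  have b5 : |α / 2 * (σx - ξx) * θ ^ 2| ≤ (B * (2 * B)) * (s * s) := by
    refine abs_mul_le_mul (abs_mul_le_mul ?_ ?_) hθ2
    · rw [abs_div, abs_two]
      linarith
    · refine (abs_sub _ _).trans ?_
      linarith
  have b6 : |r * ξ| ≤ (B * s) * s := abs_mul_le_mul (hr.trans hBs) hks
  have heθ : |e + θ| ≤ 2 * (B * s) := by
    refine (abs_add_le _ _).trans ?_
    linarith
  have b7 : |(e + θ) * ξx| ≤ (2 * (B * s)) * s := abs_mul_le_mul heθ hms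
  have b8 : |β / 2 * ((v + ξ) * (2 * σ + v - ξ)) * ξx| ≤ (B * ((2 * (B * s)) * (4 * B))) * s := by
    refine abs_mul_le_mul (abs_mul_le_mul ?_ (abs_mul_le_mul ?_ ?_)) hms
    · rw [abs_div, abs_two]
      linarith
    · refine (abs_add_le _ _).trans ?_
      linarith
    · rw [abs_le] at hσ hv hξ ⊢
      constructor <;> linarith
  have b9 : |γ / 2 * ((e + θ) * (2 * ζ + e - θ)) * ξx|
      ≤ B * ((2 * (B * s)) * (3 * B) * s + (B * s * s + s * s)) := by
    -- No pointwise bound of θ is available, so in the cubic term both factors of s come from e and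
    -- θ, and |ξx| ≤ 1 takes the third.
    have e9 : γ / 2 * ((e + θ) * (2 * ζ + e - θ)) * ξx
        = γ / 2 * ((e + θ) * (2 * ζ + e) * ξx - (e * θ + θ ^ 2) * ξx) := by ring
    rw [e9]
    refine abs_mul_le_mul ?_ ?_
    · rw [abs_div, abs_two]
      linarith
    · have c1 : |(e + θ) * (2 * ζ + e) * ξx| ≤ (2 * (B * s)) * (3 * B) * s := by
        refine abs_mul_le_mul (abs_mul_le_mul heθ ?_) hms
        rw [abs_le] at hζ he ⊢
        constructor <;> linarith
      have c2 : |(e * θ + θ ^ 2) * ξx| ≤ (B * s * s + s * s) * 1 := by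
        refine abs_mul_le_mul ?_ hξx
        have d1 := abs_mul_le_mul (he.trans hBs) hts
        rw [abs_le] at d1 hθ2 ⊢
        constructor <;> linarith
      rw [abs_le] at c1 c2 ⊢
      constructor <;> linarith
  -- The nine bounds add up to at most 32B³s² because B ≥ 1; together with this factor 4 they give
  -- the constant 128.
  have hs2 : s ^ 2 ≤ 4 * (h ^ 2 + θ ^ 2 + ξ ^ 2 + ξx ^ 2) := by
    rw [← sq_abs θ, ← sq_abs ξ, ← sq_abs ξx, ← ht, ← hk, ← hm, hs]
    linarith [sq_nonneg (h - t), sq_nonneg (h - k), sq_nonneg (h - m), sq_nonneg (t - k),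
      sq_nonneg (t - m), sq_nonneg (k - m)]
  have p2 : B ^ 2 ≤ B ^ 3 := pow_le_pow_right₀ hB (by norm_num)
  have p1 : B ≤ B ^ 3 := le_self_pow₀ hB (by norm_num)
  have hss : 0 ≤ s ^ 2 := by positivity
  have q2 := mul_le_mul_of_nonneg_right p2 hss
  have q1 := mul_le_mul_of_nonneg_right p1 hss
  have q3 := mul_le_mul_of_nonneg_left hs2 (show 0 ≤ 32 * B ^ 3 by positivity)
  rw [abs_le] at b1 b2 b3 b4 b5 b6 b7 b8 b9
  have hq1 : 0 ≤ B * s ^ 2 := by positivity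
  have hq2 : 0 ≤ B ^ 2 * s ^ 2 := by positivity
  linarith [b1.2, b2.1, b3.1, b4.1, b5.1, b6.2, b7.2, b8.2, b9.2]

lemma IsBdd.add_const_mul {f g : ℝ → ℝ} (hf : IsBdd f) (c : ℝ) (hg : IsBdd g) :
    IsBdd fun x => f x + c * g x := hf.add (hg.const_mul c)

lemma IsBdd.integral_add_const_mul {f g : ℝ → ℝ} (hf : IsBdd f) (c : ℝ) (hg : IsBdd g) :
    ∫ x in Ioo (0 : ℝ) 1, (f x + c * g x)
      = (∫ x in Ioo (0 : ℝ) 1, f x) + c * ∫ x in Ioo (0 : ℝ) 1, g x := by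
  rw [integral_add hf.integrable (hg.const_mul c).integrable, integral_const_mul]

/-- The spatial part of the first equation, tested with `φ`. -/
noncomputable def convEta (α : ℝ) (η u φ : ℝ → ℝ) : ℝ :=
  inner2 (deriv u) φ + α * inner2 (deriv fun y => η y * u y) φ

/-- The first-order spatial part of the second equation, tested with `χ`. -/
noncomputable def convU (β γ : ℝ) (η u χ : ℝ → ℝ) : ℝ :=
  inner2 (deriv η) χ + β * inner2 (fun y => u y * deriv u y) χ
    + γ * inner2 (fun y => η y * deriv η y) χ

/-- Two exact derivatives with vanishing integral remove every θ_x from the error terms. That of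
θ²(σ - ξ)/2 vanishes because σ and ξ are zero at both ends, with no boundary condition on θ. The
other moves the derivatives in the second equation to ξ, using uu_x = (u²)_x/2 and ηη_x = (η²)_x/2.
The remaining integrand is bounded pointwise by `energy_integrand_le`. -/
lemma energy_rhs_le {α β γ B h : ℝ} {η u ζ σ θ ξ q r : ℝ → ℝ} (hB : 1 ≤ B) (hh : 0 ≤ h)
    (hh1 : h ≤ 1) (hα : |α| ≤ B) (hβ : |β| ≤ B) (hγ : |γ| ≤ B)
    (hη : IsLip η) (hu : IsLip u) (hζ : IsLip ζ) (hσ : IsLip σ) (hθ : IsLip θ) (hξ : IsLip ξ)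
    (hq : IsBdd q) (hr : IsBdd r)
    (hσ0 : σ 0 = 0) (hσ1 : σ 1 = 0) (hξ0 : ξ 0 = 0) (hξ1 : ξ 1 = 0)
    (bη : ∀ x ∈ Icc (0 : ℝ) 1, |η x - ζ x| ≤ B * h) (bu : ∀ x ∈ Icc (0 : ℝ) 1, |u x - σ x| ≤ B * h)
    (bq : ∀ x ∈ Icc (0 : ℝ) 1, |q x| ≤ B * h) (br : ∀ x ∈ Icc (0 : ℝ) 1, |r x| ≤ B * h)
    (bζ : ∀ x ∈ Icc (0 : ℝ) 1, |ζ x| ≤ B) (bσ : ∀ x ∈ Icc (0 : ℝ) 1, |σ x| ≤ B)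
    (bξ : ∀ x ∈ Icc (0 : ℝ) 1, |ξ x| ≤ 1)
    (bηx : ∀ᵐ x ∂volume.restrict (Ioo (0 : ℝ) 1), |deriv η x - deriv ζ x| ≤ B * h)
    (bux : ∀ᵐ x ∂volume.restrict (Ioo (0 : ℝ) 1), |deriv u x - deriv σ x| ≤ B * h)
    (bζx : ∀ᵐ x ∂volume.restrict (Ioo (0 : ℝ) 1), |deriv ζ x| ≤ B)
    (bσx : ∀ᵐ x ∂volume.restrict (Ioo (0 : ℝ) 1), |deriv σ x| ≤ B)
    (bξx : ∀ᵐ x ∂volume.restrict (Ioo (0 : ℝ) 1), |deriv ξ x| ≤ 1) :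
    inner2 q θ - (convEta α η u θ - convEta α (fun x => ζ x - θ x) (fun x => σ x - ξ x) θ)
      + inner2 r ξ - (convU β γ η u ξ - convU β γ (fun x => ζ x - θ x) (fun x => σ x - ξ x) ξ)
      ≤ 128 * B ^ 3 * (h ^ 2 + inner2 θ θ + inner2 ξ ξ + inner2 (deriv ξ) (deriv ξ)) := by
  have hηh : IsLip fun x => ζ x - θ x := hζ.sub hθ
  have huh : IsLip fun x => σ x - ξ x := hσ.sub hξ
  have hg1 : IsLip fun y => θ y * (θ y * (σ y - ξ y)) := hθ.mul (hθ.mul huh)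
  have hg2 : IsLip fun y => (η y - (ζ y - θ y)
      + β / 2 * (u y * u y - (σ y - ξ y) * (σ y - ξ y))
      + γ / 2 * (η y * η y - (ζ y - θ y) * (ζ y - θ y))) * ξ y :=
    (((hη.sub hηh).add (((hu.mul hu).sub (huh.mul huh)).const_mul _)).add
      (((hη.mul hη).sub (hηh.mul hηh)).const_mul _)).mul hξ
  have z1 := hg1.integral_deriv
  have z2 := hg2.integral_deriv
  rw [hσ0, hσ1, hξ0, hξ1, sub_zero, mul_zero, mul_zero, mul_zero, mul_zero, sub_zero] at z1
  rw [hξ0, hξ1, mul_zero, mul_zero, sub_zero] at z2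
  -- The left side and the two vanishing integrals are assembled, one summand at a time, into a
  -- single integral to which the pointwise bound applies.
  have a1 := hq.mul hθ.isBdd
  have a2 := a1.add_const_mul (-1) (hu.isBdd_deriv.mul hθ.isBdd)
  have a3 := a2.add_const_mul (-α) ((hη.mul hu).isBdd_deriv.mul hθ.isBdd)
  have a4 := a3.add_const_mul 1 (huh.isBdd_deriv.mul hθ.isBdd)
  have a5 := a4.add_const_mul α ((hηh.mul huh).isBdd_deriv.mul hθ.isBdd)
  have a6 := a5.add_const_mul 1 (hr.mul hξ.isBdd)
  have a7 := a6.add_const_mul (-1) (hη.isBdd_deriv.mul hξ.isBdd)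
  have a8 := a7.add_const_mul (-β) ((hu.isBdd.mul hu.isBdd_deriv).mul hξ.isBdd)
  have a9 := a8.add_const_mul (-γ) ((hη.isBdd.mul hη.isBdd_deriv).mul hξ.isBdd)
  have a10 := a9.add_const_mul 1 (hηh.isBdd_deriv.mul hξ.isBdd)
  have a11 := a10.add_const_mul β ((huh.isBdd.mul huh.isBdd_deriv).mul hξ.isBdd)
  have a12 := a11.add_const_mul γ ((hηh.isBdd.mul hηh.isBdd_deriv).mul hξ.isBdd)
  have a13 := a12.add_const_mul (α / 2) hg1.isBdd_deriv
  have a14 := a13.add_const_mul 1 hg2.isBdd_deriv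
  have i14 := a13.integral_add_const_mul 1 hg2.isBdd_deriv
  rw [a12.integral_add_const_mul (α / 2) hg1.isBdd_deriv,
    a11.integral_add_const_mul γ ((hηh.isBdd.mul hηh.isBdd_deriv).mul hξ.isBdd),
    a10.integral_add_const_mul β ((huh.isBdd.mul huh.isBdd_deriv).mul hξ.isBdd),
    a9.integral_add_const_mul 1 (hηh.isBdd_deriv.mul hξ.isBdd),
    a8.integral_add_const_mul (-γ) ((hη.isBdd.mul hη.isBdd_deriv).mul hξ.isBdd),
    a7.integral_add_const_mul (-β) ((hu.isBdd.mul hu.isBdd_deriv).mul hξ.isBdd),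
    a6.integral_add_const_mul (-1) (hη.isBdd_deriv.mul hξ.isBdd),
    a5.integral_add_const_mul 1 (hr.mul hξ.isBdd),
    a4.integral_add_const_mul α ((hηh.mul huh).isBdd_deriv.mul hθ.isBdd),
    a3.integral_add_const_mul 1 (huh.isBdd_deriv.mul hθ.isBdd),
    a2.integral_add_const_mul (-α) ((hη.mul hu).isBdd_deriv.mul hθ.isBdd),
    a1.integral_add_const_mul (-1) (hu.isBdd_deriv.mul hθ.isBdd), z1, z2] at i14
  have c1 := IsBdd.const (128 * B ^ 3 * h ^ 2)
  have c2 := c1.add_const_mul (128 * B ^ 3) (hθ.isBdd.mul hθ.isBdd)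
  have c3 := c2.add_const_mul (128 * B ^ 3) (hξ.isBdd.mul hξ.isBdd)
  have c4 := c3.add_const_mul (128 * B ^ 3) (hξ.isBdd_deriv.mul hξ.isBdd_deriv)
  have j4 := c3.integral_add_const_mul (128 * B ^ 3) (hξ.isBdd_deriv.mul hξ.isBdd_deriv)
  rw [c2.integral_add_const_mul (128 * B ^ 3) (hξ.isBdd.mul hξ.isBdd),
    c1.integral_add_const_mul (128 * B ^ 3) (hθ.isBdd.mul hθ.isBdd)] at j4
  have hone : ∫ _ in Ioo (0 : ℝ) 1, 128 * B ^ 3 * h ^ 2 = 128 * B ^ 3 * h ^ 2 := by simp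
  rw [hone] at j4
  have mono := integral_mono_ae a14.integrable c4.integrable ?_
  · rw [i14, j4] at mono
    simp only [convEta, convU, inner2] at mono ⊢
    linarith
  · have hall : ∀ᵐ x ∂volume.restrict (Ioo (0 : ℝ) 1), x ∈ Icc (0 : ℝ) 1 :=
      (ae_restrict_iff' measurableSet_Ioo).2 (.of_forall fun x hx => Ioo_subset_Icc_self hx)
    filter_upwards [hall, hη.ae_differentiableAt, hu.ae_differentiableAt, hζ.ae_differentiableAt,
      hσ.ae_differentiableAt, hθ.ae_differentiableAt, hξ.ae_differentiableAt, bηx, bux, bζx, bσx,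
      bξx] with x hx dη du dζ dσ dθ dξ eη eu eζ eσ eξ
    have dηh := dζ.hasDerivAt.fun_sub dθ.hasDerivAt
    have duh := dσ.hasDerivAt.fun_sub dξ.hasDerivAt
    rw [(dη.hasDerivAt.fun_mul du.hasDerivAt).deriv, (dηh.fun_mul duh).deriv, dηh.deriv, duh.deriv,
      (dθ.hasDerivAt.fun_mul (dθ.hasDerivAt.fun_mul duh)).deriv,
      ((((dη.hasDerivAt.fun_sub dηh).fun_add
        (((du.hasDerivAt.fun_mul du.hasDerivAt).fun_sub (duh.fun_mul duh)).const_mul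
          (β / 2))).fun_add
        (((dη.hasDerivAt.fun_mul dη.hasDerivAt).fun_sub (dηh.fun_mul dηh)).const_mul
          (γ / 2))).fun_mul dξ.hasDerivAt).deriv]
    have key := energy_integrand_le (θ := θ x) (ξ := ξ x) (ξx := deriv ξ x) hB hh hh1 hα hβ hγ
      (bη x hx) eη (bu x hx) eu (bq x hx) (br x hx) (bζ x hx) eζ (bσ x hx) eσ (bξ x hx) eξ
    refine le_trans (le_of_eq ?_) (key.trans (le_of_eq ?_))
    · ring
    · ring

/-- A Lipschitz function that vanishes at `0` is bounded by its derivative. -/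
lemma IsLip.abs_le_of_deriv {f : ℝ → ℝ} {A : ℝ} (hf : IsLip f) (h0 : f 0 = 0)
    (hd : ∀ᵐ x ∂volume.restrict (Ioo (0 : ℝ) 1), |deriv f x| ≤ A) :
    ∀ x ∈ Icc (0 : ℝ) 1, |f x| ≤ A := by
  have hA : 0 ≤ A := by
    have : (ae (volume.restrict (Ioo (0 : ℝ) 1))).NeBot := by
      rw [ae_neBot, Ne, Measure.restrict_eq_zero]
      simp
    obtain ⟨x, hx⟩ := hd.exists
    exact (abs_nonneg _).trans hx
  intro x hx
  have hac : AbsolutelyContinuousOnInterval f 0 x := by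
    apply hf.ac.mono
    rw [uIcc_of_le zero_le_one, uIcc_of_le hx.1]
    exact Icc_subset_Icc_right hx.2
  have h1 := hac.integral_deriv_eq_sub
  rw [h0, sub_zero] at h1
  rw [← h1, ← Real.norm_eq_abs]
  have h2 : ‖∫ y in (0 : ℝ)..x, deriv f y‖ ≤ A * |x - 0| := by
    apply intervalIntegral.norm_integral_le_of_norm_le_const_ae
    rw [ae_restrict_iff' measurableSet_Ioo] at hd
    filter_upwards [hd, Measure.ae_ne volume (1 : ℝ)] with y hy hy1 hym
    rw [uIoc_of_le hx.1] at hym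
    exact hy ⟨hym.1, lt_of_le_of_ne (hym.2.trans hx.2) hy1⟩
  refine h2.trans (mul_le_of_le_one_right hA ?_)
  rw [sub_zero, abs_of_nonneg hx.1]
  exact hx.2

/-- At a fixed time, `(η, u)` with time derivatives `(p, w)` solves the weak form of the system, with
bounds `B` on the functions. -/
structure IsWeakSolutionAt (B α β γ : ℝ) (η u p w : ℝ → ℝ) : Prop where
  reg_eta : HasLipDeriv B η
  reg_u : HasLipDeriv B u
  lip_p : ∀ x ∈ Icc (0 : ℝ) 1, ∀ y ∈ Icc (0 : ℝ) 1, |p x - p y| ≤ B * |x - y|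
  lip_w : ∀ x ∈ Icc (0 : ℝ) 1, ∀ y ∈ Icc (0 : ℝ) 1, |w x - w y| ≤ B * |x - y|
  u_zero : u 0 = 0
  u_one : u 1 = 0
  w_zero : w 0 = 0
  w_one : w 1 = 0
  eq_eta : ∀ φ, IsLip φ → inner2 p φ + convEta α η u φ = 0
  eq_u : ∀ χ, IsLip χ → χ 0 = 0 → χ 1 = 0 → formA w χ + convU β γ η u χ = 0

/-- The squared error, in terms of nodal values. -/
noncomputable def Mesh.energy {N : ℕ} (M : Mesh N) (c d : Fin (N + 1) → ℝ) : ℝ :=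
  inner2 (M.pl c) (M.pl c) + formA (M.pl d) (M.pl d)

lemma Mesh.energy_nonneg {N : ℕ} (M : Mesh N) (c d : Fin (N + 1) → ℝ) : 0 ≤ M.energy c d :=
  add_nonneg (inner2_self_nonneg _) (formA_self_nonneg _)

/-- The energy inequality for the difference of the discrete solution and the nodal interpolant of
the exact solution. -/
lemma energy_deriv_le {B α β γ : ℝ} {η u p w : ℝ → ℝ} (hB : 1 ≤ B) (hα : |α| ≤ B) (hβ : |β| ≤ B)
    (hγ : |γ| ≤ B) (hs : IsWeakSolutionAt B α β γ η u p w) {N : ℕ} (M : Mesh N)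
    {a b a' b' : Fin (N + 1) → ℝ} (hb0 : b 0 = 0) (hb1 : b (Fin.last N) = 0)
    (heq : inner2 (M.pl a') (M.pl (M.values η - a)) + formA (M.pl b') (M.pl (M.values u - b))
      + (convEta α (M.pl a) (M.pl b) (M.pl (M.values η - a))
        + convU β γ (M.pl a) (M.pl b) (M.pl (M.values u - b))) = 0)
    (hsl : ∀ i, |M.slope (M.values u - b) i| ≤ 1) :
    inner2 (M.pl (M.values p - a')) (M.pl (M.values η - a))
      + formA (M.pl (M.values w - b')) (M.pl (M.values u - b))
      ≤ 10368 * B ^ 3 * (M.size ^ 2 + M.energy (M.values η - a) (M.values u - b)) := by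
  set θ := M.pl (M.values η - a) with hθ
  set ξ := M.pl (M.values u - b) with hξ
  set ζ := M.pl (M.values η) with hζ
  set σ := M.pl (M.values u) with hσ
  have lη := hs.reg_eta.isLip
  have lu := hs.reg_u.isLip
  have lp : IsLip p := isLip_of_abs_sub_le hs.lip_p
  have lw : IsLip w := isLip_of_abs_sub_le hs.lip_w
  have lθ : IsLip θ := M.lipschitz_pl _
  have lξ : IsLip ξ := M.lipschitz_pl _
  have lζ : IsLip ζ := M.lipschitz_pl _
  have lσ : IsLip σ := M.lipschitz_pl _
  have hh := M.size_pos.le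
  have hh1 := M.size_le_one
  have hB0 : 0 ≤ B := by linarith
  have hBh : 0 ≤ B * M.size := by positivity
  have hBh1 : B * M.size ≤ B := mul_le_of_le_one_right hB0 hh1
  have hξ0 : ξ 0 = 0 := by rw [hξ, M.pl_zero, Pi.sub_apply, M.values_zero, hs.u_zero, hb0, sub_zero]
  have hξ1 : ξ 1 = 0 := by rw [hξ, M.pl_one, Pi.sub_apply, M.values_last, hs.u_one, hb1, sub_zero]
  have hσ0 : σ 0 = 0 := by rw [hσ, M.pl_zero, M.values_zero, hs.u_zero]
  have hσ1 : σ 1 = 0 := by rw [hσ, M.pl_one, M.values_last, hs.u_one]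
  have ea : M.pl a = fun x => ζ x - θ x := by
    rw [hζ, hθ, ← M.pl_sub, sub_sub_cancel]
  have eb : M.pl b = fun x => σ x - ξ x := by
    rw [hσ, hξ, ← M.pl_sub, sub_sub_cancel]
  have bξx : ∀ᵐ x ∂volume.restrict (Ioo (0 : ℝ) 1), |deriv ξ x| ≤ 1 := by
    filter_upwards [M.ae_mem_cell] with x ⟨j, hj⟩
    rw [hξ, (M.hasDerivAt_pl _ j hj).deriv]
    exact hsl j
  have iη : ∀ x ∈ Icc (0 : ℝ) 1, |η x - ζ x| ≤ 2 * B * M.size := fun x hx =>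
    M.abs_sub_pl_values_le hB0 hs.reg_eta.abs_sub_le hx
  have iu : ∀ x ∈ Icc (0 : ℝ) 1, |u x - σ x| ≤ 2 * B * M.size := fun x hx =>
    M.abs_sub_pl_values_le hB0 hs.reg_u.abs_sub_le hx
  have ip : ∀ x ∈ Icc (0 : ℝ) 1, |M.pl (M.values p) x - p x| ≤ 3 * B * M.size := fun x hx => by
    rw [abs_sub_comm]
    linarith [M.abs_sub_pl_values_le hB0 hs.lip_p hx]
  have iw : ∀ x ∈ Icc (0 : ℝ) 1, |M.pl (M.values w) x - w x| ≤ 3 * B * M.size := fun x hx => by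
    rw [abs_sub_comm]
    linarith [M.abs_sub_pl_values_le hB0 hs.lip_w hx]
  have bd : ∀ {y z : ℝ}, |y| ≤ B → |y - z| ≤ 2 * B * M.size → |z| ≤ 3 * B := by
    intro y z h1 h2
    rw [abs_le] at h1 h2 ⊢
    constructor <;> linarith
  have bd' : ∀ {y z : ℝ}, |y| ≤ B → |y - z| ≤ B * M.size → |z| ≤ 3 * B := by
    intro y z h1 h2
    rw [abs_le] at h1 h2 ⊢
    constructor <;> linarith
  -- The interpolation errors are at most 2Bh and h ≤ 1, so 3B bounds these errors divided by h and
  -- also the interpolants and their derivatives.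
  have key := energy_rhs_le (α := α) (β := β) (γ := γ) (B := 3 * B) (h := M.size)
    (η := η) (u := u) (ζ := ζ) (σ := σ) (θ := θ) (ξ := ξ)
    (q := fun x => M.pl (M.values p) x - p x) (r := fun x => M.pl (M.values w) x - w x)
    (by linarith) hh hh1 (by linarith) (by linarith) (by linarith) lη lu lζ lσ lθ lξ
    ((M.lipschitz_pl _).sub lp).isBdd ((M.lipschitz_pl _).sub lw).isBdd hσ0 hσ1 hξ0 hξ1
    (fun x hx => by linarith [iη x hx]) (fun x hx => by linarith [iu x hx]) ip iw
    (fun x hx => bd (hs.reg_eta.abs_le x hx) (iη x hx)) (fun x hx => bd (hs.reg_u.abs_le x hx) (iu x hx))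
    (lξ.abs_le_of_deriv hξ0 bξx)
    (by
      filter_upwards [hs.reg_eta.deriv_sub_deriv_pl M] with x hx
      linarith [hx.2])
    (by
      filter_upwards [hs.reg_u.deriv_sub_deriv_pl M] with x hx
      linarith [hx.2])
    (by
      filter_upwards [hs.reg_eta.deriv_sub_deriv_pl M] with x hx
      exact bd' hx.1 hx.2)
    (by
      filter_upwards [hs.reg_u.deriv_sub_deriv_pl M] with x hx
      exact bd' hx.1 hx.2) bξx
  rw [← ea, ← eb, inner2_sub_left (M.lipschitz_pl _).isBdd lp.isBdd lθ.isBdd,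
    inner2_sub_left (M.lipschitz_pl _).isBdd lw.isBdd lξ.isBdd] at key
  have e1 := hs.eq_eta θ lθ
  have e2 := hs.eq_u ξ lξ hξ0 hξ1
  rw [M.pl_sub, M.pl_sub,
    inner2_sub_left (M.lipschitz_pl _).isBdd (M.lipschitz_pl _).isBdd lθ.isBdd,
    formA_sub_left (M.lipschitz_pl _) (M.lipschitz_pl _) lξ]
  -- Orthogonality of interpolation leaves only an L² term in the interpolation error of w = u_t, so
  -- no second derivatives of w are needed.
  have e3 : formA (M.pl (M.values w)) ξ = formA w ξ + inner2 (M.pl (M.values w)) ξ - inner2 w ξ := by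
    rw [formA, formA, hξ, M.inner2_deriv_pl_values lw]
    ring
  rw [e3]
  have e4 : M.energy (M.values η - a) (M.values u - b)
      = inner2 θ θ + (inner2 ξ ξ + 1 / 3 * inner2 (deriv ξ) (deriv ξ)) := rfl
  have n1 := inner2_self_nonneg θ
  have n2 := inner2_self_nonneg ξ
  have n3 : 0 ≤ M.size ^ 2 := by positivity
  -- 10368 = 3 · 128 · 27; the extra factor 3 makes up for the weight 1/3 of the derivative term in
  -- the energy.
  have e5 : 128 * (3 * B) ^ 3 * (M.size ^ 2 + inner2 θ θ + inner2 ξ ξ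
      + inner2 (deriv ξ) (deriv ξ))
      ≤ 10368 * B ^ 3 * (M.size ^ 2 + M.energy (M.values η - a) (M.values u - b)) := by
    have : 128 * (3 * B) ^ 3 * (M.size ^ 2 + inner2 θ θ + inner2 ξ ξ
      + inner2 (deriv ξ) (deriv ξ)) = 10368 * B ^ 3 * ((M.size ^ 2 + inner2 θ θ + inner2 ξ ξ
      + inner2 (deriv ξ) (deriv ξ)) / 3) := by ring
    rw [this, e4]
    refine mul_le_mul_of_nonneg_left ?_ (by positivity)
    linarith
  linarith

/-! ### Uniform bounds and weak equations for the exact solution. -/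

section Regularity

variable {α β γ T : ℝ} {η₀ u₀ : ℝ → ℝ} {η u : ℝ → ℝ → ℝ}

lemma dx_eq_of_hasDerivWithinAt {f : ℝ → ℝ} {f' x : ℝ} (hx : x ∈ Icc (0 : ℝ) 1)
    (h : HasDerivWithinAt f f' (Icc 0 1) x) : dx f x = f' :=
  h.derivWithin (uniqueDiffOn_Icc zero_lt_one x hx)

lemma HasLipDeriv.mono {K B : ℝ} {f : ℝ → ℝ} (hf : HasLipDeriv K f) (h : K ≤ B) :
    HasLipDeriv B f := by
  obtain ⟨F, h1, h2, h3, h4⟩ := hf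
  exact ⟨F, h1.weaken (Real.toNNReal_le_toNNReal h), fun x hx => (h2 x hx).trans h,
    fun x hx => (h3 x hx).trans h, h4⟩

lemma abs_mul_sub_mul_le {a b c d K δ : ℝ} (ha : |a| ≤ K) (hd : |d| ≤ K) (hac : |a - c| ≤ K * δ)
    (hbd : |b - d| ≤ K * δ) : |a * b - c * d| ≤ 2 * K ^ 2 * δ := by
  have e : a * b - c * d = a * (b - d) + (a - c) * d := by ring
  rw [e]
  refine (abs_add_le _ _).trans ?_
  have h1 := abs_mul_le_mul ha hbd
  have h2 := abs_mul_le_mul hac hd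
  linarith

/-- Bounds on time derivatives are read off from the equations: η_t = -(u_x + α(ηu)_x) is Lipschitz
because η_x and u_x are, and u_t solves the elliptic problem with bounded right-hand side and
homogeneous boundary values. The two conditions on B are the resulting constants. -/
lemma IsSolution.isWeakSolutionAt (hsol : IsSolution α β γ T η₀ u₀ η u) {K : ℝ} {t : ℝ}
    (ht : t ∈ Icc 0 T) (hη : HasLipDeriv K (η t)) (hu : HasLipDeriv K (u t)) {B : ℝ}
    (hB : K + 4 * |α| * K ^ 2 ≤ B) (hB' : 6 * (K + |β| * K ^ 2 + |γ| * K ^ 2) ≤ B) :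
    IsWeakSolutionAt B α β γ (η t) (u t) (dt T η t) (dt T u t) := by
  have lη := hη.isLip
  have lu := hu.isLip
  have hK := hη.nonneg
  obtain ⟨F, hF, bF, -, dF⟩ := id hη
  obtain ⟨G, hG, bG, -, dG⟩ := id hu
  have xF : ∀ x ∈ Icc (0 : ℝ) 1, dx (η t) x = F x := fun x hx =>
    dx_eq_of_hasDerivWithinAt hx (dF x hx)
  have xG : ∀ x ∈ Icc (0 : ℝ) 1, dx (u t) x = G x := fun x hx =>
    dx_eq_of_hasDerivWithinAt hx (dG x hx)
  have xFG : ∀ x ∈ Icc (0 : ℝ) 1, dx (fun y => η t y * u t y) x = F x * u t x + η t x * G x :=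
    fun x hx => dx_eq_of_hasDerivWithinAt hx ((dF x hx).fun_mul (dG x hx))
  have sF : ∀ x y, |F x - F y| ≤ K * |x - y| := fun x y => by
    simpa [Real.dist_eq, Real.coe_toNNReal _ hK] using hF.dist_le_mul x y
  have sG : ∀ x y, |G x - G y| ≤ K * |x - y| := fun x y => by
    simpa [Real.dist_eq, Real.coe_toNNReal _ hK] using hG.dist_le_mul x y
  have hKB : K ≤ B := by
    have : 0 ≤ 4 * |α| * K ^ 2 := by positivity
    linarith
  have pl : ∀ x ∈ Icc (0 : ℝ) 1, ∀ y ∈ Icc (0 : ℝ) 1,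
      |dt T η t x - dt T η t y| ≤ B * |x - y| := by
    have ep : ∀ x ∈ Icc (0 : ℝ) 1,
        dt T η t x = -(G x + α * (F x * u t x + η t x * G x)) := fun x hx => by
      have := hsol.eq_eta t ht x hx
      rw [xG x hx, xFG x hx] at this
      linarith
    intro x hx y hy
    rw [ep x hx, ep y hy]
    have h1 := abs_mul_sub_mul_le (bF x hx) (hu.abs_le y hy) (sF x y) (hu.abs_sub_le x hx y hy)
    have h2 := abs_mul_sub_mul_le (hη.abs_le x hx) (bG y hy) (hη.abs_sub_le x hx y hy) (sG x y)
    have e : -(G x + α * (F x * u t x + η t x * G x)) - -(G y + α * (F y * u t y + η t y * G y))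
        = -((G x - G y) + α * ((F x * u t x - F y * u t y)
          + (η t x * G x - η t y * G y))) := by ring
    rw [e, abs_neg]
    have h3 := abs_mul_le_mul (le_refl |α|) ((abs_add_le _ _).trans (add_le_add h1 h2))
    refine (abs_add_le _ _).trans ((add_le_add (sG x y) h3).trans ?_)
    have h4 := mul_le_mul_of_nonneg_right hB (abs_nonneg (x - y))
    linarith
  have lp : IsLip (dt T η t) := isLip_of_abs_sub_le pl
  set f : ℝ → ℝ := fun x => -(F x + β * (u t x * G x) + γ * (η t x * F x)) with hf
  have heq : ∀ x ∈ Icc (0 : ℝ) 1, dt T u t x - 1 / 3 * dx (dx (dt T u t)) x = f x := fun x hx => by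
    have := hsol.eq_u t ht x hx
    rw [xF x hx, xG x hx] at this
    simp only [hf]
    linarith
  have hbf : ∀ x ∈ Icc (0 : ℝ) 1, |f x| ≤ K + |β| * K ^ 2 + |γ| * K ^ 2 := fun x hx => by
    simp only [hf]
    rw [abs_neg]
    have h1 := abs_mul_le_mul (le_refl |β|) (abs_mul_le_mul (hu.abs_le x hx) (bG x hx))
    have h2 := abs_mul_le_mul (le_refl |γ|) (abs_mul_le_mul (hη.abs_le x hx) (bF x hx))
    refine (abs_add_le _ _).trans (add_le_add ((abs_add_le _ _).trans (add_le_add (bF x hx) ?_)) ?_)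
    · linarith
    · linarith
  have hw0 : dt T u t 0 = 0 := by
    have : derivWithin (fun s => u s 0) (Icc 0 T) t = derivWithin (fun _ => (0 : ℝ)) (Icc 0 T) t :=
      derivWithin_congr (fun s hs => hsol.bdry_left s hs) (hsol.bdry_left t ht)
    rw [dt, this]
    simp
  have hw1 : dt T u t 1 = 0 := by
    have : derivWithin (fun s => u s 1) (Icc 0 T) t = derivWithin (fun _ => (0 : ℝ)) (Icc 0 T) t :=
      derivWithin_congr (fun s hs => hsol.bdry_right s hs) (hsol.bdry_right t ht)
    rw [dt, this]
    simp
  have dw := hsol.diff_x_ut t ht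
  have dw' := hsol.diff_xx_ut t ht
  have hreg := abs_dx_le_of_elliptic dw dw' heq hbf hw0 hw1
  have dη : ∀ x ∈ Ioo (0 : ℝ) 1, deriv (η t) x = F x := fun x hx => by
    rw [← dx_eq_deriv _ hx, xF x (Ioo_subset_Icc_self hx)]
  have du : ∀ x ∈ Ioo (0 : ℝ) 1, deriv (u t) x = G x := fun x hx => by
    rw [← dx_eq_deriv _ hx, xG x (Ioo_subset_Icc_self hx)]
  refine ⟨hη.mono hKB, hu.mono hKB, pl, fun x hx y hy => ?_, hsol.bdry_left t ht,
    hsol.bdry_right t ht, hw0, hw1, fun φ hφ => ?_, fun χ hχ h0 h1 => ?_⟩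
  · refine ((convex_Icc (0 : ℝ) 1).norm_image_sub_le_of_norm_hasDerivWithin_le
      (f' := dx (dt T u t)) (fun z hz => (dw z hz).hasDerivWithinAt) (fun z hz => ?_) hy hx)
    exact (hreg.2 z hz).trans hB'
  · have a1 := lp.isBdd.mul hφ.isBdd
    have a2 := lu.isBdd_deriv.mul hφ.isBdd
    have a3 := (lη.mul lu).isBdd_deriv.mul hφ.isBdd
    unfold convEta inner2
    rw [← add_assoc, ← integral_add a1.integrable a2.integrable,
      ← (a1.add a2).integral_add_const_mul α a3]
    refine (setIntegral_congr_fun (g := fun _ => (0 : ℝ)) measurableSet_Ioo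
      fun x hx => ?_).trans (by simp)
    have := hsol.eq_eta t ht x (Ioo_subset_Icc_self hx)
    rw [dx_eq_deriv _ hx, dx_eq_deriv _ hx] at this
    simp only
    linear_combination φ x * this
  · rw [formA_of_elliptic dw dw' heq hbf hw0 hw1 hχ h0 h1]
    have a2 := lη.isBdd_deriv.mul hχ.isBdd
    have a3 := (lu.isBdd.mul lu.isBdd_deriv).mul hχ.isBdd
    have a4 := (lη.isBdd.mul lη.isBdd_deriv).mul hχ.isBdd
    unfold convU inner2
    rw [← a2.integral_add_const_mul β a3, ← (a2.add_const_mul β a3).integral_add_const_mul γ a4,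
      ← sub_neg_eq_add, ← integral_neg, sub_eq_zero]
    refine setIntegral_congr_fun measurableSet_Ioo fun x hx => ?_
    simp only [hf]
    rw [dη x hx, du x hx]
    ring

/-- A function in `C(0,T;X)` for `X = W^2_∞(0,1)` has uniformly bounded Lipschitz derivatives. -/
lemma InC.exists_hasLipDeriv {X : (ℝ → ℝ) → Prop} {v : ℝ → ℝ → ℝ} (hv : InC T X (normWInf 2) v)
    (hX : ∀ w, X w → MemWInf 2 w) (hc : ∀ t ∈ Icc 0 T, ContinuousOn (v t) (Icc 0 1)) :
    ∃ K : ℝ, ∀ t ∈ Icc 0 T, HasLipDeriv K (v t) := by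
  -- Continuity of the norm in time enters only through its boundedness on the compact interval.
  obtain ⟨K, hK⟩ := (isCompact_Icc (a := (0 : ℝ)) (b := T)).bddAbove_image hv.2
  exact ⟨K, fun t ht => (hX _ (hv.1 t ht)).hasLipDeriv (hK ⟨t, ht, rfl⟩) (hc t ht)⟩

/-- A solution satisfies the weak equations at all times, with uniform bounds. -/
lemma IsSolution.exists_isWeakSolutionAt (hsol : IsSolution α β γ T η₀ u₀ η u) (hT : 0 < T)
    (hη : InC T (MemWInf 2) (normWInf 2) η)
    (hu : InC T (fun w => MemWInf 2 w ∧ w 0 = 0 ∧ w 1 = 0) (normWInf 2) u) :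
    ∃ B : ℝ, 1 ≤ B ∧ |α| ≤ B ∧ |β| ≤ B ∧ |γ| ≤ B ∧ ∀ t ∈ Icc 0 T,
      IsWeakSolutionAt B α β γ (η t) (u t) (dt T η t) (dt T u t) := by
  obtain ⟨K₁, h1⟩ := hη.exists_hasLipDeriv (fun w hw => hw)
    (fun t ht => (hsol.diff_x_eta t ht).continuousOn)
  obtain ⟨K₂, h2⟩ := hu.exists_hasLipDeriv (fun w hw => hw.1)
    (fun t ht => (hsol.diff_x_u t ht).continuousOn)
  set K := max K₁ K₂
  have hK : 0 ≤ K := ((h1 0 ⟨le_rfl, hT.le⟩).nonneg).trans (le_max_left _ _)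
  have n1 : 0 ≤ 4 * |α| * K ^ 2 := by positivity
  have n2 : 0 ≤ |β| * K ^ 2 := by positivity
  have n3 : 0 ≤ |γ| * K ^ 2 := by positivity
  have m1 := abs_nonneg α
  have m2 := abs_nonneg β
  have m3 := abs_nonneg γ
  refine ⟨1 + |α| + |β| + |γ| + (K + 4 * |α| * K ^ 2) + 6 * (K + |β| * K ^ 2 + |γ| * K ^ 2),
    ?_, ?_, ?_, ?_, fun t ht => ?_⟩
  · linarith
  · linarith
  · linarith
  · linarith
  · exact hsol.isWeakSolutionAt ht ((h1 t ht).mono (le_max_left _ _))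
      ((h2 t ht).mono (le_max_right _ _)) (by linarith) (by linarith)

end Regularity

/-! ### Bilinear maps and differential equations in finite dimension -/

section FiniteDimensional

variable {E F : Type*} [NormedAddCommGroup E] [NormedSpace ℝ E] [FiniteDimensional ℝ E]
  [NormedAddCommGroup F] [NormedSpace ℝ F] [FiniteDimensional ℝ F]

/-- A bilinear form on finite-dimensional spaces as a continuous bilinear map. -/
noncomputable def contBilin (b : E →ₗ[ℝ] F →ₗ[ℝ] ℝ) : E →L[ℝ] F →L[ℝ] ℝ :=
  LinearMap.toContinuousLinearMap
    ((LinearMap.toContinuousLinearMap : (F →ₗ[ℝ] ℝ) ≃ₗ[ℝ] (F →L[ℝ] ℝ)).toLinearMap ∘ₗ b)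

lemma contDiff_bilin (b : E →ₗ[ℝ] F →ₗ[ℝ] ℝ) {G : Type*} [NormedAddCommGroup G] [NormedSpace ℝ G]
    {f : G → E} {g : G → F} (hf : ContDiff ℝ 1 f) (hg : ContDiff ℝ 1 g) :
    ContDiff ℝ 1 fun x => b (f x) (g x) :=
  (((contBilin b).contDiff.comp hf).clm_apply hg)

lemma hasDerivWithinAt_bilin (b : E →ₗ[ℝ] F →ₗ[ℝ] ℝ) {f : ℝ → E} {g : ℝ → F} {f' : E} {g' : F}
    {s : Set ℝ} {t : ℝ} (hf : HasDerivWithinAt f f' s t) (hg : HasDerivWithinAt g g' s t) :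
    HasDerivWithinAt (fun t => b (f t) (g t)) (b f' (g t) + b (f t) g') s t := by
  have := (contBilin b).hasDerivWithinAt_of_bilinear hf hg
  rw [add_comm]
  exact this

/-- The Riesz representation for a positive definite bilinear form. -/
lemma exists_riesz (b : E →ₗ[ℝ] E →ₗ[ℝ] ℝ) (hb : ∀ x, b x x = 0 → x = 0) (l : E →ₗ[ℝ] ℝ) :
    ∃ x, ∀ z, b x z = l z := by
  have hinj : Function.Injective b := by
    rw [injective_iff_map_eq_zero]
    intro x hx
    exact hb x (by rw [hx, LinearMap.zero_apply])
  have hdim : Module.finrank ℝ E = Module.finrank ℝ (E →ₗ[ℝ] ℝ) :=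
    (Subspace.dual_finrank_eq (K := ℝ) (V := E)).symm
  obtain ⟨x, hx⟩ := (LinearMap.injective_iff_surjective_of_finrank_eq_finrank hdim).1 hinj l
  exact ⟨x, fun z => by rw [hx]⟩

/-- A positive definite quadratic form in finite dimension is coercive. -/
lemma exists_coercive (b : E →ₗ[ℝ] E →ₗ[ℝ] ℝ) (hb : ∀ x, b x x = 0 → x = 0)
    (hpos : ∀ x, 0 ≤ b x x) : ∃ μ : ℝ, 0 ≤ μ ∧ ∀ x, ‖x‖ ^ 2 ≤ μ * b x x := by
  -- An empty unit sphere means that the space is trivial. Otherwise μ is the reciprocal of the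
  -- minimum of the form on the sphere, and homogeneity does the rest.
  rcases (Metric.sphere (0 : E) 1).eq_empty_or_nonempty with h | h
  · refine ⟨0, le_rfl, fun x => ?_⟩
    have : x = 0 := by
      by_contra hx
      have : ‖x‖⁻¹ • x ∈ Metric.sphere (0 : E) 1 := by
        rw [mem_sphere_zero_iff_norm, norm_smul, norm_inv, norm_norm,
          inv_mul_cancel₀ (norm_ne_zero_iff.2 hx)]
      rw [h] at this
      exact this
    simp [this]
  · have hc : Continuous fun x => b x x := (contDiff_bilin b contDiff_id contDiff_id).continuous
    obtain ⟨x₀, hx₀, hmin⟩ := (isCompact_sphere (0 : E) 1).exists_isMinOn h hc.continuousOn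
    have hx0 : x₀ ≠ 0 := by
      rintro rfl
      simp at hx₀
    have hm : 0 < b x₀ x₀ := lt_of_le_of_ne (hpos x₀) fun h => hx0 (hb x₀ h.symm)
    refine ⟨(b x₀ x₀)⁻¹, (inv_pos.2 hm).le, fun x => ?_⟩
    rcases eq_or_ne x 0 with rfl | hx
    · simp
    · have hn := norm_pos_iff.2 hx
      have : ‖x‖⁻¹ • x ∈ Metric.sphere (0 : E) 1 := by
        rw [mem_sphere_zero_iff_norm, norm_smul, norm_inv, norm_norm, inv_mul_cancel₀ hn.ne']
      have h1 : b x₀ x₀ ≤ b (‖x‖⁻¹ • x) (‖x‖⁻¹ • x) := hmin this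
      simp only [map_smul, LinearMap.smul_apply, smul_eq_mul] at h1
      rw [inv_mul_eq_div, le_div_iff₀ hm]
      have h2 := mul_le_mul_of_nonneg_left h1 (sq_nonneg ‖x‖)
      refine h2.trans (le_of_eq ?_)
      field_simp

/-- The vector field defined weakly by a positive definite form is continuously differentiable. -/
lemma exists_vectorField (b : E →ₗ[ℝ] E →ₗ[ℝ] ℝ) (hb : ∀ x, b x x = 0 → x = 0)
    (n : E → E →ₗ[ℝ] ℝ) (hn : ∀ z, ContDiff ℝ 1 fun y => n y z) :
    ∃ V : E → E, ContDiff ℝ 1 V ∧ ∀ y z, b (V y) z = n y z := by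
  set v := Module.finBasis ℝ E
  -- The field is written through the Riesz representers of the coordinate functionals, so its
  -- coefficients inherit the smoothness of y ↦ n y z.
  choose w hw using fun k => exists_riesz b hb (v.coord k)
  refine ⟨fun y => ∑ k, n y (v k) • w k, ?_, fun y z => ?_⟩
  · exact ContDiff.sum fun k _ => (hn (v k)).smul contDiff_const
  · simp only [map_sum, map_smul, LinearMap.sum_apply, LinearMap.smul_apply, smul_eq_mul, hw]
    conv_rhs => rw [← v.sum_repr z]
    simp only [map_sum, map_smul, smul_eq_mul, Module.Basis.coord_apply, mul_comm]

/-- A `C^1` vector field agrees on a ball with a Lipschitz vector field that has solutions on all of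
`[0,T]`. -/
lemma exists_truncation {V : E → E} (hV : ContDiff ℝ 1 V) {R : ℝ} (hR : 0 < R) :
    ∃ (V' : E → E) (K : NNReal), LipschitzWith K V' ∧ (∀ y, ‖y‖ ≤ R → V' y = V y) ∧
      ∀ (T : ℝ), 0 ≤ T → ∀ y₀, ∃ y : ℝ → E, y 0 = y₀ ∧
        ∀ t ∈ Icc 0 T, HasDerivWithinAt y (V' (y t)) (Icc 0 T) t := by
  have : CompleteSpace E := FiniteDimensional.complete ℝ E
  -- The cut-off is 1 on the ball of radius R, and the product with V has compact support, hence is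
  -- bounded and globally Lipschitz.
  let f : ContDiffBump (0 : E) := ⟨R, R + 1, hR, by linarith⟩
  have hf : ContDiff ℝ 1 fun y => f y • V y := f.contDiff.smul hV
  have hs : HasCompactSupport fun y => f y • V y := f.hasCompactSupport.smul_right
  obtain ⟨K, hK⟩ := hf.lipschitzWith_of_hasCompactSupport hs one_ne_zero
  obtain ⟨L, hL⟩ := hs.exists_bound_of_continuous hf.continuous
  have hL0 : 0 ≤ L := (norm_nonneg _).trans (hL 0)
  refine ⟨fun y => f y • V y, K, hK, fun y hy => ?_, fun T hT y₀ => ?_⟩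
  · have : f y = 1 := f.one_of_mem_closedBall (by simpa using hy)
    simp only
    rw [this, one_smul]
  · have hp : IsPicardLindelof (fun _ y => f y • V y) (tmin := 0) (tmax := T) ⟨0, le_rfl, hT⟩ y₀
        (⟨L, hL0⟩ * ⟨T, hT⟩) 0 ⟨L, hL0⟩ K :=
      { lipschitzOnWith := fun _ _ => hK.lipschitzOnWith
        continuousOn := fun _ _ => continuousOn_const
        norm_le := fun _ _ x _ => hL x
        mul_max_le := by
          simp only [sub_zero, sub_self, max_eq_left hT, NNReal.coe_zero]
          exact le_rfl }
    exact hp.exists_eq_forall_mem_Icc_hasDerivWithinAt₀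

end FiniteDimensional

/-! ### The semidiscrete system as an ordinary differential equation for nodal values. -/

/-- The nodal values that vanish at both ends. -/
def zeroEnds (N : ℕ) : Submodule ℝ (Fin (N + 1) → ℝ) where
  carrier := {c | c 0 = 0 ∧ c (Fin.last N) = 0}
  add_mem' := fun ha hb => ⟨by simp [ha.1, hb.1], by simp [ha.2, hb.2]⟩
  zero_mem' := ⟨rfl, rfl⟩
  smul_mem' := fun r a ha => ⟨by simp [ha.1], by simp [ha.2]⟩

/-- The projection that replaces the values at both ends by zero. -/
noncomputable def clearEnds (N : ℕ) : (Fin (N + 1) → ℝ) →ₗ[ℝ] zeroEnds N where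
  toFun c := ⟨fun i => if i = 0 ∨ i = Fin.last N then 0 else c i, by simp, by simp⟩
  map_add' c d := by
    ext i
    by_cases h : i = 0 ∨ i = Fin.last N <;> simp [h]
  map_smul' r c := by
    ext i
    by_cases h : i = 0 ∨ i = Fin.last N <;> simp [h]

lemma coe_clearEnds {N : ℕ} {c : Fin (N + 1) → ℝ} (h0 : c 0 = 0) (h1 : c (Fin.last N) = 0) :
    (clearEnds N c : Fin (N + 1) → ℝ) = c := by
  ext i
  change (if i = 0 ∨ i = Fin.last N then 0 else c i) = c i
  split_ifs with h
  · rcases h with rfl | rfl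
    · exact h0.symm
    · exact h1.symm
  · rfl

/-- The coefficient space of the semidiscrete problem. -/
abbrev State (N : ℕ) : Type := (Fin (N + 1) → ℝ) × zeroEnds N

namespace Mesh

variable {N : ℕ} (M : Mesh N)

/-- The inner product of `L² × H¹` on the coefficient space. -/
noncomputable def gram : State N →ₗ[ℝ] State N →ₗ[ℝ] ℝ :=
  LinearMap.mk₂ ℝ (fun y z => inner2 (M.pl y.1) (M.pl z.1) + formA (M.pl y.2) (M.pl z.2))
    (fun y y' z => by
      simp only [Prod.fst_add, Prod.snd_add, Submodule.coe_add, pl_add]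
      rw [inner2_add_left (M.lipschitz_pl _).isBdd (M.lipschitz_pl _).isBdd
        (M.lipschitz_pl _).isBdd,
        formA_add_left (M.lipschitz_pl _) (M.lipschitz_pl _) (M.lipschitz_pl _)]
      ring)
    (fun r y z => by
      simp only [Prod.smul_fst, Prod.smul_snd, Submodule.coe_smul, pl_smul, smul_eq_mul]
      rw [inner2_const_mul_left, formA_const_mul_left]
      ring)
    (fun y z z' => by
      simp only [Prod.fst_add, Prod.snd_add, Submodule.coe_add, pl_add]
      rw [inner2_add_right (M.lipschitz_pl _).isBdd (M.lipschitz_pl _).isBdd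
        (M.lipschitz_pl _).isBdd,
        formA_add_right (M.lipschitz_pl _) (M.lipschitz_pl _) (M.lipschitz_pl _)]
      ring)
    (fun r y z => by
      simp only [Prod.smul_fst, Prod.smul_snd, Submodule.coe_smul, pl_smul, smul_eq_mul]
      rw [inner2_const_mul_right, formA_const_mul_right]
      ring)

lemma gram_apply (y z : State N) :
    M.gram y z = inner2 (M.pl y.1) (M.pl z.1) + formA (M.pl y.2) (M.pl z.2) := rfl

lemma gram_comm (y z : State N) : M.gram y z = M.gram z y := by
  rw [gram_apply, gram_apply, inner2_comm, formA_comm]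

lemma gram_self_nonneg (y : State N) : 0 ≤ M.gram y y := M.energy_nonneg _ _

lemma eq_zero_of_gram_self (y : State N) (h : M.gram y y = 0) : y = 0 := by
  rw [gram_apply] at h
  have h1 := inner2_self_nonneg (M.pl y.1)
  have h2 := formA_self_nonneg (M.pl y.2)
  have h3 : inner2 (M.pl y.2) (M.pl y.2) ≤ formA (M.pl y.2) (M.pl y.2) := by
    have := inner2_self_nonneg (deriv (M.pl y.2))
    rw [formA]
    linarith
  have h4 := inner2_self_nonneg (M.pl y.2)
  have e1 : inner2 (M.pl y.1) (M.pl y.1) = 0 := by linarith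
  have e2 : inner2 (M.pl y.2) (M.pl y.2) = 0 := by linarith
  refine Prod.ext ?_ (Subtype.ext ?_)
  · exact M.eq_zero_of_pl_eqOn ((M.lipschitz_pl _).eq_zero_of_inner2_self e1)
  · exact M.eq_zero_of_pl_eqOn ((M.lipschitz_pl _).eq_zero_of_inner2_self e2)

lemma eq_of_gram_eq {y y' : State N} (h : ∀ z, M.gram y z = M.gram y' z) : y = y' := by
  rw [← sub_eq_zero]
  apply M.eq_zero_of_gram_self
  rw [LinearMap.map_sub₂, h, sub_self]

lemma inner2_congr_left_add {f f₁ f₂ φ : ℝ → ℝ}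
    (h : f =ᵐ[volume.restrict (Ioo (0 : ℝ) 1)] fun x => f₁ x + f₂ x) (h1 : IsBdd f₁)
    (h2 : IsBdd f₂) (hφ : IsBdd φ) : inner2 f φ = inner2 f₁ φ + inner2 f₂ φ := by
  rw [inner2_congr_ae h (Filter.EventuallyEq.refl _ _), inner2_add_left h1 h2 hφ]

lemma deriv_const_mul_fun (r : ℝ) (f : ℝ → ℝ) :
    (deriv fun x => r * f x) = fun x => r * deriv f x := by
  ext x
  exact deriv_const_mul_field r

/-- The linear form `c ↦ (v_x, φ)` for `v` with nodal values `c`. -/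
noncomputable def derivForm (φ : ℝ → ℝ) (hφ : IsBdd φ) : (Fin (N + 1) → ℝ) →ₗ[ℝ] ℝ where
  toFun c := inner2 (deriv (M.pl c)) φ
  map_add' c d := by
    rw [pl_add]
    exact inner2_congr_left_add ((M.lipschitz_pl _).deriv_add (M.lipschitz_pl _))
      (M.lipschitz_pl _).isBdd_deriv (M.lipschitz_pl _).isBdd_deriv hφ
  map_smul' r c := by
    rw [pl_smul, deriv_const_mul_fun, inner2_const_mul_left]
    rfl

/-- The bilinear form `((v w)_x, φ)` on nodal values. -/
noncomputable def fluxForm (φ : ℝ → ℝ) (hφ : IsBdd φ) :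
    (Fin (N + 1) → ℝ) →ₗ[ℝ] (Fin (N + 1) → ℝ) →ₗ[ℝ] ℝ :=
  LinearMap.mk₂ ℝ (fun c d => inner2 (deriv fun y => M.pl c y * M.pl d y) φ)
    (fun c c' d => by
      have : (fun y => M.pl (c + c') y * M.pl d y)
          = fun y => M.pl c y * M.pl d y + M.pl c' y * M.pl d y := by
        ext y
        rw [pl_add]
        ring
      have l1 := (M.lipschitz_pl c).mul (M.lipschitz_pl d)
      have l2 := (M.lipschitz_pl c').mul (M.lipschitz_pl d)
      rw [this]
      exact inner2_congr_left_add (l1.deriv_add l2) l1.isBdd_deriv l2.isBdd_deriv hφ)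
    (fun r c d => by
      have : (fun y => M.pl (r • c) y * M.pl d y) = fun y => r * (M.pl c y * M.pl d y) := by
        ext y
        rw [pl_smul]
        ring
      rw [this, deriv_const_mul_fun, inner2_const_mul_left, smul_eq_mul])
    (fun c d d' => by
      have : (fun y => M.pl c y * M.pl (d + d') y)
          = fun y => M.pl c y * M.pl d y + M.pl c y * M.pl d' y := by
        ext y
        rw [pl_add]
        ring
      have l1 := (M.lipschitz_pl c).mul (M.lipschitz_pl d)
      have l2 := (M.lipschitz_pl c).mul (M.lipschitz_pl d')
      rw [this]
      exact inner2_congr_left_add (l1.deriv_add l2) l1.isBdd_deriv l2.isBdd_deriv hφ)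
    (fun r c d => by
      have : (fun y => M.pl c y * M.pl (r • d) y) = fun y => r * (M.pl c y * M.pl d y) := by
        ext y
        rw [pl_smul]
        ring
      rw [this, deriv_const_mul_fun, inner2_const_mul_left, smul_eq_mul])

/-- The bilinear form `(v w_x, φ)` on nodal values. -/
noncomputable def advForm (φ : ℝ → ℝ) (hφ : IsBdd φ) :
    (Fin (N + 1) → ℝ) →ₗ[ℝ] (Fin (N + 1) → ℝ) →ₗ[ℝ] ℝ :=
  LinearMap.mk₂ ℝ (fun c d => inner2 (fun y => M.pl c y * deriv (M.pl d) y) φ)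
    (fun c c' d => by
      refine inner2_congr_left_add (.of_forall fun y => ?_)
        ((M.lipschitz_pl _).isBdd.mul (M.lipschitz_pl _).isBdd_deriv)
        ((M.lipschitz_pl _).isBdd.mul (M.lipschitz_pl _).isBdd_deriv) hφ
      simp only [pl_add]
      ring)
    (fun r c d => by
      rw [smul_eq_mul, ← inner2_const_mul_left]
      congr 1
      ext y
      rw [pl_smul]
      ring)
    (fun c d d' => by
      refine inner2_congr_left_add ?_
        ((M.lipschitz_pl _).isBdd.mul (M.lipschitz_pl _).isBdd_deriv)
        ((M.lipschitz_pl _).isBdd.mul (M.lipschitz_pl _).isBdd_deriv) hφ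
      filter_upwards [(M.lipschitz_pl d).deriv_add (M.lipschitz_pl d')] with y hy
      rw [pl_add, hy]
      ring)
    (fun r c d => by
      rw [smul_eq_mul, ← inner2_const_mul_left]
      congr 1
      ext y
      rw [pl_smul, deriv_const_mul_fun]
      ring)

/-- The spatial part of the semidiscrete system as a linear form in the test functions. -/
noncomputable def conv (α β γ : ℝ) (y : State N) : State N →ₗ[ℝ] ℝ where
  toFun z := convEta α (M.pl y.1) (M.pl y.2) (M.pl z.1)
    + convU β γ (M.pl y.1) (M.pl y.2) (M.pl z.2)
  map_add' z z' := by
    have l1 := M.lipschitz_pl y.1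
    have l2 := M.lipschitz_pl y.2
    have b1 := (M.lipschitz_pl z.1).isBdd
    have b2 := (M.lipschitz_pl z'.1).isBdd
    have b3 := (M.lipschitz_pl z.2).isBdd
    have b4 := (M.lipschitz_pl z'.2).isBdd
    simp only [convEta, convU, Prod.fst_add, Prod.snd_add, Submodule.coe_add, pl_add]
    rw [inner2_add_right l2.isBdd_deriv b1 b2, inner2_add_right (l1.mul l2).isBdd_deriv b1 b2,
      inner2_add_right l1.isBdd_deriv b3 b4, inner2_add_right (l2.isBdd.mul l2.isBdd_deriv) b3 b4,
      inner2_add_right (l1.isBdd.mul l1.isBdd_deriv) b3 b4]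
    ring
  map_smul' r z := by
    simp only [convEta, convU, Prod.smul_fst, Prod.smul_snd, Submodule.coe_smul, pl_smul,
      smul_eq_mul, inner2_const_mul_right, RingHom.id_apply]
    ring

lemma conv_apply (α β γ : ℝ) (y z : State N) :
    M.conv α β γ y z = convEta α (M.pl y.1) (M.pl y.2) (M.pl z.1)
      + convU β γ (M.pl y.1) (M.pl y.2) (M.pl z.2) := rfl

/-- For a fixed test function the form is a polynomial of degree two in the coefficients: linear
parts plus bilinear maps on the diagonal. -/
lemma contDiff_conv (α β γ : ℝ) (z : State N) : ContDiff ℝ 1 fun y => M.conv α β γ y z := by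
  have b1 := (M.lipschitz_pl z.1).isBdd
  have b2 := (M.lipschitz_pl z.2).isBdd
  have f1 : ContDiff ℝ 1 fun y : State N => y.1 := contDiff_fst
  have f2 : ContDiff ℝ 1 fun y : State N => (y.2 : Fin (N + 1) → ℝ) :=
    (zeroEnds N).subtypeL.contDiff.comp contDiff_snd
  have d1 := (LinearMap.toContinuousLinearMap (M.derivForm _ b1)).contDiff.comp f2
  have d2 := (LinearMap.toContinuousLinearMap (M.derivForm _ b2)).contDiff.comp f1
  exact (d1.add (contDiff_const.mul (contDiff_bilin (M.fluxForm _ b1) f1 f2))).add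
    ((d2.add (contDiff_const.mul (contDiff_bilin (M.advForm _ b2) f2 f2))).add
      (contDiff_const.mul (contDiff_bilin (M.advForm _ b2) f1 f1)))

/-- The vector field of the semidiscrete system. -/
lemma exists_galerkin_field (α β γ : ℝ) :
    ∃ V : State N → State N, ContDiff ℝ 1 V ∧ ∀ y z, M.gram (V y) z + M.conv α β γ y z = 0 := by
  obtain ⟨V, hV, h⟩ := exists_vectorField M.gram M.eq_zero_of_gram_self
    (fun y => - M.conv α β γ y) (fun z => (M.contDiff_conv α β γ z).neg)
  exact ⟨V, hV, fun y z => by rw [h, LinearMap.neg_apply, neg_add_cancel]⟩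

/-- The coefficients of the nodal interpolants of a pair of functions. -/
noncomputable def interp (f g : ℝ → ℝ) : State N := (M.values f, clearEnds N (M.values g))

lemma interp_snd {f g : ℝ → ℝ} (h0 : g 0 = 0) (h1 : g 1 = 0) :
    ((M.interp f g).2 : Fin (N + 1) → ℝ) = M.values g :=
  coe_clearEnds (by rw [values_zero, h0]) (by rw [values_last, h1])

lemma hasDerivWithinAt_interp {f g f' g' : ℝ → ℝ → ℝ} {s : Set ℝ} {t : ℝ}
    (hf : ∀ x ∈ Icc (0 : ℝ) 1, HasDerivWithinAt (fun r => f r x) (f' t x) s t)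
    (hg : ∀ x ∈ Icc (0 : ℝ) 1, HasDerivWithinAt (fun r => g r x) (g' t x) s t) :
    HasDerivWithinAt (fun r => M.interp (f r) (g r)) (M.interp (f' t) (g' t)) s t := by
  have h1 : HasDerivWithinAt (fun r => M.values (f r)) (M.values (f' t)) s t :=
    hasDerivWithinAt_pi.2 fun i => hf _ (M.node_mem i)
  have h2 : HasDerivWithinAt (fun r => M.values (g r)) (M.values (g' t)) s t :=
    hasDerivWithinAt_pi.2 fun i => hg _ (M.node_mem i)
  exact h1.prodMk ((LinearMap.toContinuousLinearMap (clearEnds N)).hasFDerivAt.comp_hasDerivWithinAt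
    t h2)

end Mesh

/-! ### Initial error, energy inequality and comparison in time. -/

section Error

variable {B α β γ : ℝ} {N : ℕ} (M : Mesh N)

/-- Young's inequality on an interval of length one. The term with the factor 1/2 is later absorbed
into the left side. -/
lemma inner2_le_of_abs_le {f g : ℝ → ℝ} {δ : ℝ} (hf : IsBdd f) (hg : IsBdd g)
    (h : ∀ x ∈ Icc (0 : ℝ) 1, |f x| ≤ δ) : inner2 f g ≤ δ ^ 2 / 2 + 1 / 2 * inner2 g g := by
  have a1 := IsBdd.const (δ ^ 2 / 2)
  have i1 := a1.integral_add_const_mul (1 / 2) (hg.mul hg)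
  have e : ∫ _ in Ioo (0 : ℝ) 1, δ ^ 2 / 2 = δ ^ 2 / 2 := by simp
  rw [e] at i1
  unfold inner2
  rw [← i1]
  refine setIntegral_mono_on (hf.mul hg).integrable (a1.add_const_mul _ (hg.mul hg)).integrable
    measurableSet_Ioo fun x hx => ?_
  have h1 := sq_le_sq' (by linarith [(abs_le.1 (h x (Ioo_subset_Icc_self hx))).1])
    (abs_le.1 (h x (Ioo_subset_Icc_self hx))).2
  nlinarith [sq_nonneg (f x - g x)]

/-- The error of the discrete initial data against the nodal interpolants. -/
lemma Mesh.gram_init_le {η u p w : ℝ → ℝ} (hs : IsWeakSolutionAt B α β γ η u p w) (y : State N)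
    (hy : ∀ z : State N, M.gram y z = inner2 η (M.pl z.1) + formA u (M.pl z.2)) :
    M.gram (M.interp η u - y) (M.interp η u - y) ≤ 8 * B ^ 2 * M.size ^ 2 := by
  set z := M.interp η u - y with hz
  have hB := hs.reg_eta.nonneg
  have lη := hs.reg_eta.isLip
  have lu := hs.reg_u.isLip
  have l1 := M.lipschitz_pl z.1
  have l2 := M.lipschitz_pl z.2
  have i1 : ∀ x ∈ Icc (0 : ℝ) 1, |M.pl (M.values η) x - η x| ≤ 2 * B * M.size := fun x hx => by
    rw [abs_sub_comm]
    exact M.abs_sub_pl_values_le hB hs.reg_eta.abs_sub_le hx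
  have i2 : ∀ x ∈ Icc (0 : ℝ) 1, |M.pl (M.values u) x - u x| ≤ 2 * B * M.size := fun x hx => by
    rw [abs_sub_comm]
    exact M.abs_sub_pl_values_le hB hs.reg_u.abs_sub_le hx
  have b1 := inner2_le_of_abs_le ((M.lipschitz_pl (M.values η)).sub lη).isBdd l1.isBdd i1
  have b2 := inner2_le_of_abs_le ((M.lipschitz_pl (M.values u)).sub lu).isBdd l2.isBdd i2
  rw [inner2_sub_left (M.lipschitz_pl _).isBdd lη.isBdd l1.isBdd] at b1
  rw [inner2_sub_left (M.lipschitz_pl _).isBdd lu.isBdd l2.isBdd] at b2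
  have e1 : M.gram z z = M.gram (M.interp η u) z - M.gram y z := by
    conv_lhs => rw [hz, LinearMap.map_sub₂]
  have e2 : M.gram (M.interp η u) z
      = inner2 (M.pl (M.values η)) (M.pl z.1) + formA (M.pl (M.values u)) (M.pl z.2) := by
    rw [M.gram_apply, M.interp_snd hs.u_zero hs.u_one]
    rfl
  have e3 : formA (M.pl (M.values u)) (M.pl z.2)
      = formA u (M.pl z.2) + inner2 (M.pl (M.values u)) (M.pl z.2) - inner2 u (M.pl z.2) := by
    rw [formA, formA, M.inner2_deriv_pl_values lu]
    ring
  have e4 : M.gram z z = inner2 (M.pl z.1) (M.pl z.1)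
      + (inner2 (M.pl z.2) (M.pl z.2) + 1 / 3 * inner2 (deriv (M.pl z.2)) (deriv (M.pl z.2))) := rfl
  have n1 := inner2_self_nonneg (deriv (M.pl z.2))
  rw [hy, e2, e3] at e1
  linarith

/-- Here quasiuniformity enters: an energy of order h² bounds the slopes of ξ by 1 through the
inverse inequality, which is the hypothesis that `energy_deriv_le` needs. -/
lemma Mesh.gram_deriv_le {η u p w : ℝ → ℝ} {κ Λ : ℝ} (hB : 1 ≤ B) (hα : |α| ≤ B) (hβ : |β| ≤ B)
    (hγ : |γ| ≤ B) (hs : IsWeakSolutionAt B α β γ η u p w) (hκ : M.QuasiUniform κ)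
    (hsize : 3 * Λ * κ * M.size ≤ 1) {y y' : State N}
    (heq : M.gram y' (M.interp η u - y) + M.conv α β γ y (M.interp η u - y) = 0)
    (hE : M.gram (M.interp η u - y) (M.interp η u - y) ≤ Λ * M.size ^ 2) :
    M.gram (M.interp p w - y') (M.interp η u - y)
      ≤ 10368 * B ^ 3 * (M.size ^ 2 + M.gram (M.interp η u - y) (M.interp η u - y)) := by
  have s1 : ((M.interp η u - y).2 : Fin (N + 1) → ℝ) = M.values u - y.2 := by
    rw [Prod.snd_sub, Submodule.coe_sub, M.interp_snd hs.u_zero hs.u_one]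
  have s2 : ((M.interp p w - y').2 : Fin (N + 1) → ℝ) = M.values w - y'.2 := by
    rw [Prod.snd_sub, Submodule.coe_sub, M.interp_snd hs.w_zero hs.w_one]
  have t1 : (M.interp η u - y).1 = M.values η - y.1 := rfl
  have t2 : (M.interp p w - y').1 = M.values p - y'.1 := rfl
  rw [M.gram_apply, M.conv_apply, s1, t1] at heq
  have hsl : ∀ i, |M.slope (M.values u - y.2) i| ≤ 1 := by
    intro i
    rw [M.gram_apply, s1, t1, formA] at hE
    have n1 := inner2_self_nonneg (M.pl (M.values η - y.1))
    have n2 := inner2_self_nonneg (M.pl (M.values u - y.2))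
    have h1 := M.len_mul_slope_sq_le (M.values u - y.2) i
    have h2 := hκ.size_le i
    have hl := M.len_pos i
    have hp := M.size_pos
    have hκ0 : 0 < κ := pos_of_mul_pos_left (hp.trans_le h2) hl.le
    set s := M.slope (M.values u - y.2) i
    have h3 : M.len i * s ^ 2 ≤ 3 * Λ * M.size ^ 2 := by linarith
    -- The single cell of slope s carries at least len · s² of ‖ξ_x‖² ≤ 3E. Replacing len by h/κ
    -- leaves one power of h to make the bound small.
    have h4 : M.size * s ^ 2 ≤ M.size * 1 := by
      calc M.size * s ^ 2 ≤ κ * M.len i * s ^ 2 := by gcongr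
        _ = κ * (M.len i * s ^ 2) := by ring
        _ ≤ κ * (3 * Λ * M.size ^ 2) := by gcongr
        _ = M.size * (3 * Λ * κ * M.size) := by ring
        _ ≤ M.size * 1 := by gcongr
    have h5 : s ^ 2 ≤ 1 := le_of_mul_le_mul_left h4 hp
    exact abs_le_one_iff_mul_self_le_one.2 (by nlinarith)
  have key := energy_deriv_le hB hα hβ hγ hs M y.2.2.1 y.2.2.2 (a' := y'.1) (b' := y'.2) heq hsl
  rw [M.gram_apply, M.gram_apply, s1, s2, t1, t2]
  exact key

end Error

section Estimate

variable {B α β γ T : ℝ} {η₀ u₀ : ℝ → ℝ} {η u : ℝ → ℝ → ℝ}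

/-- The error of every curve of coefficients that starts at the projected initial data and satisfies
the semidiscrete equations as long as it stays close to the exact solution. -/
lemma gram_error_le (hsol : IsSolution α β γ T η₀ u₀ η u) (hT : 0 < T)
    (hB : 1 ≤ B) (hα : |α| ≤ B) (hβ : |β| ≤ B) (hγ : |γ| ≤ B)
    (hs : ∀ t ∈ Icc 0 T, IsWeakSolutionAt B α β γ (η t) (u t) (dt T η t) (dt T u t))
    {Λ : ℝ} (hΛ : Λ = (8 * B ^ 2 + 1) * Real.exp (5 * (10368 * B ^ 3) * T)) {κ : ℝ} {N : ℕ}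
    (M : Mesh N) (hκ : M.QuasiUniform κ) (hsize : 3 * Λ * κ * M.size ≤ 1)
    {y y' : ℝ → State N} (hy : ∀ t ∈ Icc 0 T, HasDerivWithinAt y (y' t) (Icc 0 T) t)
    (hinit : ∀ z : State N, M.gram (y 0) z = inner2 (η 0) (M.pl z.1) + formA (u 0) (M.pl z.2))
    (heq : ∀ t ∈ Icc 0 T, M.gram (M.interp (η t) (u t) - y t) (M.interp (η t) (u t) - y t)
        ≤ Λ * M.size ^ 2 → ∀ z, M.gram (y' t) z + M.conv α β γ (y t) z = 0) :
    ∀ t ∈ Icc 0 T, M.gram (M.interp (η t) (u t) - y t) (M.interp (η t) (u t) - y t)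
        ≤ Λ * M.size ^ 2 := by
  set C := 10368 * B ^ 3 with hC
  have hC0 : 0 < C := by positivity
  have hA : 1 ≤ 8 * B ^ 2 + 1 := by nlinarith
  have hp := M.size_pos
  -- The barrier starts above the initial error 8B²h², always dominates h², and equals Λh² at time
  -- T.
  set b : ℝ → ℝ := fun t => (8 * B ^ 2 + 1) * Real.exp (5 * C * t) * M.size ^ 2 with hb
  have hbd : ∀ t, HasDerivAt b (5 * C * b t) t := by
    intro t
    have h1 : HasDerivAt (fun t => Real.exp (5 * C * t)) (Real.exp (5 * C * t) * (5 * C)) t := by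
      simpa using ((hasDerivAt_id t).const_mul (5 * C)).exp
    have h2 := (h1.const_mul (8 * B ^ 2 + 1)).mul_const (M.size ^ 2)
    refine h2.congr_deriv ?_
    simp only [hb]
    ring
  have hbΛ : ∀ t ∈ Icc 0 T, b t ≤ Λ * M.size ^ 2 := by
    intro t ht
    simp only [hb, hΛ]
    have : 5 * C * t ≤ 5 * C * T := by
      have := ht.2
      gcongr
    gcongr
  have hbs : ∀ t, 0 ≤ t → M.size ^ 2 ≤ b t := by
    intro t ht
    have h1 : 1 ≤ Real.exp (5 * C * t) := Real.one_le_exp (by positivity)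
    have h2 : 1 ≤ (8 * B ^ 2 + 1) * Real.exp (5 * C * t) := one_le_mul_of_one_le_of_one_le hA h1
    exact le_mul_of_one_le_left (by positivity) h2
  set e : ℝ → State N := fun t => M.interp (η t) (u t) - y t with he
  set e' : ℝ → State N := fun t => M.interp (dt T η t) (dt T u t) - y' t with he'
  have hed : ∀ t ∈ Icc 0 T, HasDerivWithinAt e (e' t) (Icc 0 T) t := fun t ht =>
    (M.hasDerivWithinAt_interp (f' := dt T η) (g' := dt T u)
      (fun x hx => (hsol.diff_t_eta x hx t ht).hasDerivWithinAt)
      (fun x hx => (hsol.diff_t_u x hx t ht).hasDerivWithinAt)).sub (hy t ht)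
  have hEd : ∀ t ∈ Icc 0 T, HasDerivWithinAt (fun t => M.gram (e t) (e t))
      (2 * M.gram (e' t) (e t)) (Icc 0 T) t := fun t ht => by
    have := hasDerivWithinAt_bilin M.gram (hed t ht) (hed t ht)
    rwa [M.gram_comm (e t) (e' t), ← two_mul] at this
  have h0 : (0 : ℝ) ∈ Icc 0 T := ⟨le_rfl, hT.le⟩
  have key := image_le_of_deriv_right_lt_deriv_boundary' (f := fun t => M.gram (e t) (e t))
    (f' := fun t => 2 * M.gram (e' t) (e t)) (a := 0) (b := T) (B := b) (B' := fun t => 5 * C * b t)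
    (fun t ht => (hEd t ht).continuousWithinAt)
    (fun t ht => (hEd t (Ico_subset_Icc_self ht)).mono_of_mem_nhdsWithin
      (Icc_mem_nhdsGE_of_mem ht))
    ?_ (fun t _ => (hbd t).continuousAt.continuousWithinAt) (fun t _ => (hbd t).hasDerivWithinAt) ?_
  · intro t ht
    exact (key ht).trans (hbΛ t ht)
  · refine (M.gram_init_le (hs 0 h0) (y 0) hinit).trans ?_
    simp only [hb, mul_zero, Real.exp_zero, mul_one]
    gcongr
    linarith
  -- Only times with E = b matter. There E ≤ Λh² holds automatically, and E' ≤ 2C(h² + E) ≤ 4Cb <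
  -- 5Cb = b', so E cannot cross the barrier.
  · intro t ht hEb
    have ht' := Ico_subset_Icc_self ht
    have hE : M.gram (e t) (e t) ≤ Λ * M.size ^ 2 := by
      rw [hEb]
      exact hbΛ t ht'
    have h1 := M.gram_deriv_le hB hα hβ hγ (hs t ht') hκ hsize
      (heq t ht' hE (M.interp (η t) (u t) - y t)) hE
    have h2 := hbs t ht.1
    have h3 : M.gram (e' t) (e t) ≤ C * (M.size ^ 2 + M.gram (e t) (e t)) := h1
    rw [hEb] at h3
    have h4 : 0 < C * b t := mul_pos hC0 (lt_of_lt_of_le (by positivity) h2)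
    have h5 := mul_le_mul_of_nonneg_left h2 hC0.le
    linarith

end Estimate

/-! ### From the energy bound to the norms of the errors. -/

lemma inner2_self_le_of_ae {f g k : ℝ → ℝ} {δ : ℝ} (hf : IsBdd f) (hk : IsBdd k)
    (hg : ∀ᵐ x ∂volume.restrict (Ioo (0 : ℝ) 1), |g x| ≤ δ)
    (hfg : f =ᵐ[volume.restrict (Ioo (0 : ℝ) 1)] fun x => g x + k x) :
    inner2 f f ≤ 2 * δ ^ 2 + 2 * inner2 k k := by
  have a1 := IsBdd.const (2 * δ ^ 2)
  have i1 := a1.integral_add_const_mul 2 (hk.mul hk)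
  have e : ∫ _ in Ioo (0 : ℝ) 1, 2 * δ ^ 2 = 2 * δ ^ 2 := by simp
  rw [e] at i1
  unfold inner2
  rw [← i1]
  refine integral_mono_ae (hf.mul hf).integrable (a1.add_const_mul _ (hk.mul hk)).integrable ?_
  filter_upwards [hg, hfg] with x h1 h2
  rw [h2]
  have h3 := sq_le_sq' (by linarith [(abs_le.1 h1).1]) (abs_le.1 h1).2
  nlinarith [sq_nonneg (g x - k x)]

section Norms

variable {B α β γ : ℝ} {η u p w : ℝ → ℝ} {N : ℕ} (M : Mesh N)

/-- The error of a discrete function in terms of its distance to the nodal interpolant. -/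
lemma HasLipDeriv.inner2_sub_pl_le (hη : HasLipDeriv B η) (c : Fin (N + 1) → ℝ) :
    inner2 (fun x => η x - M.pl c x) (fun x => η x - M.pl c x)
      ≤ 8 * B ^ 2 * M.size ^ 2
        + 2 * inner2 (M.pl (M.values η - c)) (M.pl (M.values η - c)) := by
  have := inner2_self_le_of_ae (f := fun x => η x - M.pl c x)
    (g := fun x => η x - M.pl (M.values η) x) (k := M.pl (M.values η - c)) (δ := 2 * B * M.size)
    (hη.isLip.sub (M.lipschitz_pl _)).isBdd (M.lipschitz_pl _).isBdd
    ((ae_restrict_iff' measurableSet_Ioo).2 (.of_forall fun x hx =>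
      M.abs_sub_pl_values_le hη.nonneg hη.abs_sub_le (Ioo_subset_Icc_self hx)))
    (.of_forall fun x => by
      simp only [M.pl_sub]
      ring)
  linarith

lemma HasLipDeriv.inner2_deriv_sub_pl_le (hη : HasLipDeriv B η) (c : Fin (N + 1) → ℝ) :
    inner2 (deriv fun x => η x - M.pl c x) (deriv fun x => η x - M.pl c x)
      ≤ 2 * B ^ 2 * M.size ^ 2
        + 2 * inner2 (deriv (M.pl (M.values η - c))) (deriv (M.pl (M.values η - c))) := by
  have := inner2_self_le_of_ae (f := deriv fun x => η x - M.pl c x)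
    (g := fun x => deriv η x - deriv (M.pl (M.values η)) x)
    (k := deriv (M.pl (M.values η - c))) (δ := B * M.size)
    (hη.isLip.sub (M.lipschitz_pl _)).isBdd_deriv (M.lipschitz_pl _).isBdd_deriv
    (by
      filter_upwards [hη.deriv_sub_deriv_pl M] with x hx using hx.2)
    (by
      rw [M.pl_sub]
      filter_upwards [hη.isLip.deriv_sub (M.lipschitz_pl c),
        (M.lipschitz_pl (M.values η)).deriv_sub (M.lipschitz_pl c)] with x h1 h2
      rw [h1, h2]
      ring)
  linarith

/-- The error splits at the nodal interpolant. The interpolation parts contribute 8B²h² to ‖·‖² and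
2B²h² to the squared norm of the derivative, which has weight 1/3, so 10B² covers both norms. -/
lemma Mesh.norm_error_le (hs : IsWeakSolutionAt B α β γ η u p w) {Λ : ℝ} (y : State N)
    (hE : M.gram (M.interp η u - y) (M.interp η u - y) ≤ Λ * M.size ^ 2) :
    norm2 (fun x => η x - M.pl y.1 x) ≤ Real.sqrt (10 * B ^ 2 + 2 * Λ) * M.size ∧
      normH1 (fun x => u x - M.pl y.2 x) ≤ Real.sqrt (10 * B ^ 2 + 2 * Λ) * M.size := by
  have s1 : ((M.interp η u - y).2 : Fin (N + 1) → ℝ) = M.values u - y.2 := by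
    rw [Prod.snd_sub, Submodule.coe_sub, M.interp_snd hs.u_zero hs.u_one]
  have t1 : (M.interp η u - y).1 = M.values η - y.1 := rfl
  rw [M.gram_apply, s1, t1, formA] at hE
  have n1 := inner2_self_nonneg (M.pl (M.values η - y.1))
  have n2 := inner2_self_nonneg (M.pl (M.values u - y.2))
  have n3 := inner2_self_nonneg (deriv (M.pl (M.values u - y.2)))
  have b1 := hs.reg_eta.inner2_sub_pl_le M y.1
  have b2 := hs.reg_u.inner2_sub_pl_le M y.2
  have b3 := hs.reg_u.inner2_deriv_sub_pl_le M y.2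
  have hp := M.size_pos.le
  have e : Real.sqrt (10 * B ^ 2 + 2 * Λ) * M.size
      = Real.sqrt ((10 * B ^ 2 + 2 * Λ) * M.size ^ 2) := by
    rw [Real.sqrt_mul' _ (sq_nonneg _), Real.sqrt_sq hp]
  have hB : 0 ≤ B ^ 2 * M.size ^ 2 := by positivity
  rw [e]
  constructor
  · refine Real.sqrt_le_sqrt ?_
    linarith
  · rw [normH1_eq, formA]
    refine Real.sqrt_le_sqrt ?_
    linarith

end Norms

/-- Values off [0,1] do not matter, since the derivatives are integrated only over the open
interval. This allows passing between an element of the discrete space and the `pl` of its nodal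
values. -/
lemma convEta_congr {α : ℝ} {η η' u u' φ φ' : ℝ → ℝ} (h1 : EqOn η η' (Icc 0 1))
    (h2 : EqOn u u' (Icc 0 1)) (h3 : EqOn φ φ' (Icc 0 1)) :
    convEta α η u φ = convEta α η' u' φ' := by
  have h4 : EqOn (fun y => η y * u y) (fun y => η' y * u' y) (Icc 0 1) := fun y hy => by
    simp only [h1 hy, h2 hy]
  rw [convEta, convEta, inner2_congr_ae (deriv_ae_eq_of_eqOn h2) (ae_eq_of_eqOn h3),
    inner2_congr_ae (deriv_ae_eq_of_eqOn h4) (ae_eq_of_eqOn h3)]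

lemma convU_congr {β γ : ℝ} {η η' u u' φ φ' : ℝ → ℝ} (h1 : EqOn η η' (Icc 0 1))
    (h2 : EqOn u u' (Icc 0 1)) (h3 : EqOn φ φ' (Icc 0 1)) :
    convU β γ η u φ = convU β γ η' u' φ' := by
  have h4 : ∀ {f g : ℝ → ℝ}, EqOn f g (Icc 0 1) → (fun y => f y * deriv f y)
      =ᵐ[volume.restrict (Ioo (0 : ℝ) 1)] fun y => g y * deriv g y := fun h =>
    (ae_eq_of_eqOn h).mul (deriv_ae_eq_of_eqOn h)
  rw [convU, convU, inner2_congr_ae (deriv_ae_eq_of_eqOn h1) (ae_eq_of_eqOn h3),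
    inner2_congr_ae (h4 h2) (ae_eq_of_eqOn h3), inner2_congr_ae (h4 h1) (ae_eq_of_eqOn h3)]

/-! ### Equivalence of the semidiscrete problem and its coefficient form. -/

section Semidiscrete

variable {α β γ T : ℝ} {η₀ u₀ : ℝ → ℝ} {N : ℕ} (M : Mesh N)

lemma Mesh.pl_zero_values : M.pl 0 = fun _ => 0 := by
  ext x
  simp [Mesh.pl, Mesh.slope]

lemma Mesh.eqOn_pl_values_of_mem_S0 {φ : ℝ → ℝ} (hφ : φ ∈ M.S0) :
    EqOn φ (M.pl (clearEnds N (M.values φ))) (Icc 0 1) := by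
  rw [coe_clearEnds (by rw [M.values_zero, hφ.2.1]) (by rw [M.values_last, hφ.2.2])]
  exact M.eqOn_pl_values hφ.1

lemma Mesh.dt_pl (hT : 0 < T) {c : ℝ → Fin (N + 1) → ℝ} {c' : Fin (N + 1) → ℝ} {t : ℝ}
    (ht : t ∈ Icc 0 T) (hc : HasDerivWithinAt c c' (Icc 0 T) t) (x : ℝ) :
    HasDerivWithinAt (fun s => M.pl (c s) x) (M.pl c' x) (Icc 0 T) t ∧
      dt T (fun s => M.pl (c s)) t x = M.pl c' x := by
  let l : (Fin (N + 1) → ℝ) →ₗ[ℝ] ℝ :=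
    { toFun := fun c => M.pl c x
      map_add' := fun c d => by rw [M.pl_add]
      map_smul' := fun r c => by rw [M.pl_smul]; rfl }
  have h : HasDerivWithinAt (fun s => M.pl (c s) x) (M.pl c' x) (Icc 0 T) t :=
    (LinearMap.toContinuousLinearMap l).hasFDerivAt.comp_hasDerivWithinAt t hc
  exact ⟨h, h.derivWithin (uniqueDiffOn_Icc hT t ht)⟩

/-- A curve of coefficients solving the weak system gives a semidiscrete solution. -/
lemma Mesh.isSemidiscrete_pl (hT : 0 < T) {y y' : ℝ → State N}
    (hy : ∀ t ∈ Icc 0 T, HasDerivWithinAt y (y' t) (Icc 0 T) t)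
    (heq : ∀ t ∈ Icc 0 T, ∀ z, M.gram (y' t) z + M.conv α β γ (y t) z = 0)
    (hinit : ∀ z : State N, M.gram (y 0) z = inner2 η₀ (M.pl z.1) + formA u₀ (M.pl z.2)) :
    IsSemidiscrete M α β γ T η₀ u₀ (fun t => M.pl (y t).1) (fun t => M.pl (y t).2) := by
  have h1 : ∀ t ∈ Icc 0 T, HasDerivWithinAt (fun t => (y t).1) (y' t).1 (Icc 0 T) t :=
    fun t ht => (hy t ht).fst
  have h2 : ∀ t ∈ Icc 0 T, HasDerivWithinAt (fun t => ((y t).2 : Fin (N + 1) → ℝ))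
      (y' t).2 (Icc 0 T) t := fun t ht =>
    (zeroEnds N).subtypeL.hasFDerivAt.comp_hasDerivWithinAt t (hy t ht).snd
  have zA : ∀ f : ℝ → ℝ, formA f (M.pl ((0 : zeroEnds N) : Fin (N + 1) → ℝ)) = 0 := fun f => by
    rw [Submodule.coe_zero, M.pl_zero_values]
    simp [formA, inner2]
  have zU : ∀ f g : ℝ → ℝ, convU β γ f g (M.pl ((0 : zeroEnds N) : Fin (N + 1) → ℝ)) = 0 :=
    fun f g => by
      rw [Submodule.coe_zero, M.pl_zero_values]
      simp [convU, inner2]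
  have zI : ∀ f : ℝ → ℝ, inner2 f (M.pl 0) = 0 := fun f => by
    rw [M.pl_zero_values]
    simp [inner2]
  have zE : ∀ f g : ℝ → ℝ, convEta α f g (M.pl 0) = 0 := fun f g => by
    rw [M.pl_zero_values]
    simp [convEta, inner2]
  have mS0 : ∀ c : zeroEnds N, M.pl c ∈ M.S0 := fun c => M.pl_mem_S0 c.2.1 c.2.2
  refine ⟨fun t _ => M.pl_mem_S _, fun t _ => mS0 _,
    fun x _ t ht => (M.dt_pl hT ht (h1 t ht) x).1.differentiableWithinAt,
    fun x _ t ht => (M.dt_pl hT ht (h2 t ht) x).1.differentiableWithinAt,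
    fun t ht φ hφ => ?_, fun t ht χ hχ => ?_, ⟨M.pl_mem_S _, fun φ hφ => ?_⟩,
    ⟨mS0 _, fun χ hχ => ?_⟩⟩
  -- The combined equation splits into the two equations of the scheme by test pairs with one zero
  -- component.
  · have h := heq t ht (M.values φ, 0)
    have e : dt T (fun t => M.pl (y t).1) t = M.pl (y' t).1 :=
      funext fun x => (M.dt_pl hT ht (h1 t ht) x).2
    rw [M.gram_apply, M.conv_apply, zA, zU, add_zero, add_zero] at h
    rw [e, add_assoc]
    change _ + convEta α _ _ φ = 0
    rw [inner2_congr (fun _ _ => rfl) (M.eqOn_pl_values hφ),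
      convEta_congr (fun _ _ => rfl) (fun _ _ => rfl) (M.eqOn_pl_values hφ)]
    exact h
  · have h := heq t ht (0, clearEnds N (M.values χ))
    have e : dt T (fun t => M.pl (y t).2) t = M.pl (y' t).2 :=
      funext fun x => (M.dt_pl hT ht (h2 t ht) x).2
    rw [M.gram_apply, M.conv_apply, zI, zE, zero_add, zero_add] at h
    rw [e, add_assoc, add_assoc, ← add_assoc (inner2 _ _)]
    change _ + convU β γ _ _ χ = 0
    have hc := M.eqOn_pl_values_of_mem_S0 hχ
    rw [formA_congr (fun _ _ => rfl) hc, convU_congr (fun _ _ => rfl) (fun _ _ => rfl) hc]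
    exact h
  · have h := hinit (M.values φ, 0)
    rw [M.gram_apply, zA, zA, add_zero, add_zero] at h
    rw [inner2_congr (fun _ _ => rfl) (M.eqOn_pl_values hφ), h]
    exact (inner2_congr (fun _ _ => rfl) (M.eqOn_pl_values hφ)).symm
  · have h := hinit (0, clearEnds N (M.values χ))
    have hc := M.eqOn_pl_values_of_mem_S0 hχ
    rw [M.gram_apply, zI, zI, zero_add, zero_add] at h
    rw [formA_congr (fun _ _ => rfl) hc, h]
    exact (formA_congr (fun _ _ => rfl) hc).symm

/-- The nodal values of a semidiscrete solution solve the weak system. -/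
lemma IsSemidiscrete.exists_curve {M : Mesh N} {ηh uh : ℝ → ℝ → ℝ}
    (h : IsSemidiscrete M α β γ T η₀ u₀ ηh uh) (hT : 0 < T) :
    ∃ y y' : ℝ → State N, (∀ t ∈ Icc 0 T, HasDerivWithinAt y (y' t) (Icc 0 T) t) ∧
      (∀ t ∈ Icc 0 T, ∀ z, M.gram (y' t) z + M.conv α β γ (y t) z = 0) ∧
      (∀ z : State N, M.gram (y 0) z = inner2 η₀ (M.pl z.1) + formA u₀ (M.pl z.2)) ∧
      ∀ t ∈ Icc 0 T, EqOn (ηh t) (M.pl (y t).1) (Icc 0 1) ∧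
        EqOn (uh t) (M.pl (y t).2) (Icc 0 1) := by
  set y : ℝ → State N := fun t => M.interp (ηh t) (uh t) with hyd
  set y' : ℝ → State N := fun t => M.interp (dt T ηh t) (dt T uh t) with hyd'
  have hy : ∀ t ∈ Icc 0 T, HasDerivWithinAt y (y' t) (Icc 0 T) t := fun t ht =>
    M.hasDerivWithinAt_interp (f' := dt T ηh) (g' := dt T uh)
      (fun x hx => (h.diff_eta x hx t ht).hasDerivWithinAt)
      (fun x hx => (h.diff_u x hx t ht).hasDerivWithinAt)
  have e1 : ∀ t ∈ Icc 0 T, EqOn (ηh t) (M.pl (y t).1) (Icc 0 1) := fun t ht =>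
    M.eqOn_pl_values (h.mem_eta t ht)
  have e2 : ∀ t ∈ Icc 0 T, EqOn (uh t) (M.pl (y t).2) (Icc 0 1) := fun t ht =>
    M.eqOn_pl_values_of_mem_S0 (h.mem_u t ht)
  have h1 : ∀ t ∈ Icc 0 T, HasDerivWithinAt (fun t => (y t).1) (y' t).1 (Icc 0 T) t :=
    fun t ht => (hy t ht).fst
  have h2 : ∀ t ∈ Icc 0 T, HasDerivWithinAt (fun t => ((y t).2 : Fin (N + 1) → ℝ))
      (y' t).2 (Icc 0 T) t := fun t ht =>
    (zeroEnds N).subtypeL.hasFDerivAt.comp_hasDerivWithinAt t (hy t ht).snd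
  have d1 : ∀ t ∈ Icc 0 T, EqOn (dt T ηh t) (M.pl (y' t).1) (Icc 0 1) := fun t ht x hx => by
    rw [← (M.dt_pl hT ht (h1 t ht) x).2]
    exact derivWithin_congr (fun s hs => e1 s hs hx) (e1 t ht hx)
  have d2 : ∀ t ∈ Icc 0 T, EqOn (dt T uh t) (M.pl (y' t).2) (Icc 0 1) := fun t ht x hx => by
    rw [← (M.dt_pl hT ht (h2 t ht) x).2]
    exact derivWithin_congr (fun s hs => e2 s hs hx) (e2 t ht hx)
  have h0 : (0 : ℝ) ∈ Icc 0 T := ⟨le_rfl, hT.le⟩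
  refine ⟨y, y', hy, fun t ht z => ?_, fun z => ?_, fun t ht => ⟨e1 t ht, e2 t ht⟩⟩
  · have k1 := h.eq_eta t ht _ (M.pl_mem_S z.1)
    have k2 := h.eq_u t ht _ (M.pl_mem_S0 z.2.2.1 z.2.2.2)
    rw [add_assoc] at k1
    rw [add_assoc, add_assoc, ← add_assoc (inner2 _ _)] at k2
    change _ + convEta α (ηh t) (uh t) _ = 0 at k1
    change _ + convU β γ (ηh t) (uh t) _ = 0 at k2
    rw [inner2_congr (d1 t ht) (fun _ _ => rfl),
      convEta_congr (e1 t ht) (e2 t ht) (fun _ _ => rfl)] at k1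
    rw [formA_congr (d2 t ht) (fun _ _ => rfl),
      convU_congr (e1 t ht) (e2 t ht) (fun _ _ => rfl)] at k2
    rw [M.gram_apply, M.conv_apply]
    linarith
  · rw [M.gram_apply, ← inner2_congr (e1 0 h0) (fun _ _ => rfl),
      ← formA_congr (e2 0 h0) (fun _ _ => rfl), h.init_eta.2 _ (M.pl_mem_S z.1),
      h.init_u.2 _ (M.pl_mem_S0 z.2.2.1 z.2.2.2)]

end Semidiscrete

/-! ### Conclusion: existence, uniqueness and the error bound. -/

/-- Existence, uniqueness and first-order convergence of the semidiscrete solutions. -/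
theorem exists_semidiscrete_error_le {α β γ T : ℝ} {η₀ u₀ : ℝ → ℝ} {η u : ℝ → ℝ → ℝ} (hT : 0 < T)
    (κ : ℝ) (hsol : IsSolution α β γ T η₀ u₀ η u) (hη : InC T (MemWInf 2) (normWInf 2) η)
    (hu : InC T (fun w => MemWInf 2 w ∧ w 0 = 0 ∧ w 1 = 0) (normWInf 2) u) :
    ∃ h₀ > 0, ∃ C : ℝ, ∀ (N : ℕ) (M : Mesh N), M.QuasiUniform κ → M.size ≤ h₀ →
      ∃ ηh uh : ℝ → ℝ → ℝ, IsSemidiscrete M α β γ T η₀ u₀ ηh uh ∧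
        (∀ ηh' uh' : ℝ → ℝ → ℝ, IsSemidiscrete M α β γ T η₀ u₀ ηh' uh' →
          ∀ t ∈ Icc 0 T, ∀ x ∈ Icc (0 : ℝ) 1, ηh' t x = ηh t x ∧ uh' t x = uh t x) ∧
        (∀ t ∈ Icc 0 T, norm2 (fun x => η t x - ηh t x) ≤ C * M.size) ∧
        (∀ t ∈ Icc 0 T, normH1 (fun x => u t x - uh t x) ≤ C * M.size) := by
  obtain ⟨B, hB, hα, hβ, hγ, hs⟩ := hsol.exists_isWeakSolutionAt hT hη hu
  set Λ := (8 * B ^ 2 + 1) * Real.exp (5 * (10368 * B ^ 3) * T) with hΛ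
  have hΛ0 : 0 ≤ Λ := by positivity
  -- This h₀ ensures 3Λκh ≤ 1; the absolute value and the added 1 keep the denominator positive for
  -- every κ.
  refine ⟨1 / (3 * Λ * |κ| + 1), by positivity, Real.sqrt (10 * B ^ 2 + 2 * Λ),
    fun N M hκ hsize => ?_⟩
  have hp := M.size_pos
  have hsize' : 3 * Λ * κ * M.size ≤ 1 := by
    rw [le_div_iff₀ (by positivity)] at hsize
    have : 3 * Λ * κ * M.size ≤ 3 * Λ * |κ| * M.size := by
      gcongr
      exact le_abs_self κ
    linarith
  have h0 : (0 : ℝ) ∈ Icc 0 T := ⟨le_rfl, hT.le⟩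
  have hη0 : EqOn (η 0) η₀ (Icc 0 1) := hsol.init_eta
  have hu0 : EqOn (u 0) u₀ (Icc 0 1) := hsol.init_u
  have lη := (hs 0 h0).reg_eta.isLip
  have lu := (hs 0 h0).reg_u.isLip
  have hdata : ∀ z : State N, inner2 η₀ (M.pl z.1) + formA u₀ (M.pl z.2)
      = inner2 (η 0) (M.pl z.1) + formA (u 0) (M.pl z.2) := fun z => by
    rw [inner2_congr hη0 (fun _ _ => rfl), formA_congr hu0 (fun _ _ => rfl)]
  obtain ⟨V, hV, hVeq⟩ := M.exists_galerkin_field α β γ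
  obtain ⟨μ, hμ, hcoer⟩ := exists_coercive M.gram M.eq_zero_of_gram_self M.gram_self_nonneg
  -- The ball contains all coefficient vectors with error energy at most Λh². The radius may depend
  -- on the mesh, since it does not enter the error bound.
  set R := 1 + (B + Real.sqrt (μ * (Λ * M.size ^ 2))) with hR
  have hR0 : 0 < R := by positivity
  have hbound : ∀ t ∈ Icc 0 T, ∀ y : State N,
      M.gram (M.interp (η t) (u t) - y) (M.interp (η t) (u t) - y) ≤ Λ * M.size ^ 2 → ‖y‖ ≤ R := by
    intro t ht y hE
    have h1 : ‖M.interp (η t) (u t) - y‖ ≤ Real.sqrt (μ * (Λ * M.size ^ 2)) := by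
      apply Real.le_sqrt_of_sq_le
      exact (hcoer _).trans (mul_le_mul_of_nonneg_left hE hμ)
    have hB0 : 0 ≤ B := by linarith
    have h2 : ‖M.interp (η t) (u t)‖ ≤ B := by
      rw [Prod.norm_def, max_le_iff]
      constructor
      · rw [pi_norm_le_iff_of_nonneg hB0]
        exact fun i => (hs t ht).reg_eta.abs_le _ (M.node_mem i)
      · rw [Submodule.coe_norm, M.interp_snd (hs t ht).u_zero (hs t ht).u_one,
          pi_norm_le_iff_of_nonneg hB0]
        exact fun i => (hs t ht).reg_u.abs_le _ (M.node_mem i)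
    have h3 : ‖y‖ ≤ ‖M.interp (η t) (u t)‖ + ‖M.interp (η t) (u t) - y‖ := by
      have := norm_sub_le (M.interp (η t) (u t)) (M.interp (η t) (u t) - y)
      rwa [sub_sub_cancel] at this
    linarith
  obtain ⟨V', K, hlip, hV', hex⟩ := exists_truncation hV hR0
  let l : State N →ₗ[ℝ] ℝ :=
    { toFun := fun z => inner2 (η 0) (M.pl z.1) + formA (u 0) (M.pl z.2)
      map_add' := fun z z' => by
        simp only [Prod.fst_add, Prod.snd_add, Submodule.coe_add, M.pl_add]
        rw [inner2_add_right lη.isBdd (M.lipschitz_pl _).isBdd (M.lipschitz_pl _).isBdd,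
          formA_add_right lu (M.lipschitz_pl _) (M.lipschitz_pl _)]
        ring
      map_smul' := fun r z => by
        simp only [Prod.smul_fst, Prod.smul_snd, Submodule.coe_smul, M.pl_smul, smul_eq_mul,
          inner2_const_mul_right, formA_const_mul_right, RingHom.id_apply]
        ring }
  obtain ⟨y₀, hy₀⟩ := exists_riesz M.gram M.eq_zero_of_gram_self l
  obtain ⟨y, hy0, hy⟩ := hex T hT.le y₀
  have hinit : ∀ z : State N, M.gram (y 0) z
      = inner2 (η 0) (M.pl z.1) + formA (u 0) (M.pl z.2) := fun z => by
    rw [hy0]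
    exact hy₀ z
  -- While the energy is at most Λh² the curve is in the ball, where the truncated field is the
  -- Galerkin field. The estimate then shows that this is so at all times.
  have hE := gram_error_le hsol hT hB hα hβ hγ hs hΛ M hκ hsize' hy hinit
    (fun t ht hE z => by rw [hV' _ (hbound t ht _ hE), hVeq])
  have hyeq : ∀ t ∈ Icc 0 T, ∀ z, M.gram (V' (y t)) z + M.conv α β γ (y t) z = 0 :=
    fun t ht z => by rw [hV' _ (hbound t ht _ (hE t ht)), hVeq]
  refine ⟨fun t => M.pl (y t).1, fun t => M.pl (y t).2,
    M.isSemidiscrete_pl hT hy hyeq fun z => by rw [hinit, hdata], ?_,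
    fun t ht => (M.norm_error_le (hs t ht) (y t) (hE t ht)).1,
    fun t ht => (M.norm_error_le (hs t ht) (y t) (hE t ht)).2⟩
  intro ηh' uh' hsd
  obtain ⟨v, v', hv, hveq, hvinit, hve⟩ := hsd.exists_curve hT
  -- An arbitrary semidiscrete solution obeys the same bound, so it stays in the ball and also
  -- solves the truncated equation, whose field is Lipschitz.
  have hvE := gram_error_le hsol hT hB hα hβ hγ hs hΛ M hκ hsize' hv
    (fun z => by rw [hvinit, hdata]) (fun t ht _ z => hveq t ht z)
  have hvV : ∀ t ∈ Icc 0 T, v' t = V' (v t) := fun t ht => by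
    rw [hV' _ (hbound t ht _ (hvE t ht))]
    exact M.eq_of_gram_eq fun z => by linarith [hveq t ht z, hVeq (v t) z]
  have huniq : EqOn v y (Icc 0 T) := by
    refine ODE_solution_unique (v := fun _ => V') (fun _ => hlip)
      (fun t ht => (hv t ht).continuousWithinAt) (fun t ht => ?_)
      (fun t ht => (hy t ht).continuousWithinAt) (fun t ht => ?_) ?_
    · have ht' := Ico_subset_Icc_self ht
      rw [← hvV t ht']
      exact (hv t ht').mono_of_mem_nhdsWithin (Icc_mem_nhdsGE_of_mem ht)
    · exact (hy t (Ico_subset_Icc_self ht)).mono_of_mem_nhdsWithin (Icc_mem_nhdsGE_of_mem ht)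
    · exact M.eq_of_gram_eq fun z => by rw [hvinit, hinit, hdata]
  intro t ht x hx
  rw [(hve t ht).1 hx, (hve t ht).2 hx, huniq ht]
  exact ⟨rfl, rfl⟩

end BoussinesqFEM

theorem proposition2p1 (T : ℝ) (hT : 0 < T) (κ : ℝ) :
    (∀ (η₀ u₀ : ℝ → ℝ) (η u : ℝ → ℝ → ℝ), IsSolutionCB T η₀ u₀ η u →
      InC T (MemWInf 2) (normWInf 2) η →
      InC T (fun w => MemWInf 2 w ∧ w 0 = 0 ∧ w 1 = 0) (normWInf 2) u →
      ∃ h₀ > 0, ∃ C : ℝ, ∀ (N : ℕ) (M : Mesh N), M.QuasiUniform κ → M.size ≤ h₀ →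
        ∃ ηh uh : ℝ → ℝ → ℝ, IsSemidiscreteCB M T η₀ u₀ ηh uh ∧
          (∀ ηh' uh' : ℝ → ℝ → ℝ, IsSemidiscreteCB M T η₀ u₀ ηh' uh' →
            ∀ t ∈ Icc 0 T, ∀ x ∈ Icc (0 : ℝ) 1, ηh' t x = ηh t x ∧ uh' t x = uh t x) ∧
          (∀ t ∈ Icc 0 T, norm2 (fun x => η t x - ηh t x) ≤ C * M.size) ∧
          (∀ t ∈ Icc 0 T, normH1 (fun x => u t x - uh t x) ≤ C * M.size)) ∧
    (∀ (η₀ u₀ : ℝ → ℝ) (η u : ℝ → ℝ → ℝ), IsSolutionSCB T η₀ u₀ η u →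
      InC T (MemWInf 2) (normWInf 2) η →
      InC T (fun w => MemWInf 2 w ∧ w 0 = 0 ∧ w 1 = 0) (normWInf 2) u →
      ∃ h₀ > 0, ∃ C : ℝ, ∀ (N : ℕ) (M : Mesh N), M.QuasiUniform κ → M.size ≤ h₀ →
        ∃ ηh uh : ℝ → ℝ → ℝ, IsSemidiscreteSCB M T η₀ u₀ ηh uh ∧
          (∀ ηh' uh' : ℝ → ℝ → ℝ, IsSemidiscreteSCB M T η₀ u₀ ηh' uh' →
            ∀ t ∈ Icc 0 T, ∀ x ∈ Icc (0 : ℝ) 1, ηh' t x = ηh t x ∧ uh' t x = uh t x) ∧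
          (∀ t ∈ Icc 0 T, norm2 (fun x => η t x - ηh t x) ≤ C * M.size) ∧
          (∀ t ∈ Icc 0 T, normH1 (fun x => u t x - uh t x) ≤ C * M.size)) := by
  refine ⟨fun η₀ u₀ η u hsol hη hu => ?_, fun η₀ u₀ η u hsol hη hu => ?_⟩
  · exact exists_semidiscrete_error_le hT κ hsol hη hu
  · exact exists_semidiscrete_error_le hT κ hsol hη hu
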